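/- Let $d\in\mathbb{N}$, let $J=\begin{pmatrix}0&-\mathrm{Id}\\ \mathrm{Id}&0\end{pmatrix}$ and $\sigma(\rho,\rho')=\langle\rho,J\rho'\rangle$ on $\mathbb{R}^{2d}$, and let $A\in Sp(2d,\mathbb{Z})$ be a matrix which does not have $1$ as an eigenvalue and which has an eigenvalue of modulus larger than $1$. Put $\lambda_{\max}=\sup\{\log|\beta|:\beta\in\mathrm{spec}(A)\}>0$ and let $0<\lambda_1^+<\dots<\lambda_r^+=\lambda_{\max}$ be the positive Lyapunov exponents of $A$ (the distinct positive values of $\log|\beta|$, $\beta\in\mathrm{spec}(A)$). Symplectic reduction. For matrices $M_i=\begin{pmatrix}A_i&B_i\\C_i&D_i\end{pmatrix}\in M(2d_i,\mathbb{R})$ with blocks of size $d_i$, let $$M_0\diamond\dots\diamond M_r=\begin{pmatrix}\mathrm{diag}(A_0,\dots,A_r)&\mathrm{diag}(B_0,\dots,B_r)\\ \mathrm{diag}(C_0,\dots,C_r)&\mathrm{diag}(D_0,\dots,D_r)\end{pmatrix}.$$ Let $Q\in Sp(2d,\mathbb{R})$ be such that $A=Q(A_0\diamond A_1\diamond\dots\diamond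 A_r)Q^{-1}$, where $d=d_0+\dots+d_r$ with $d_0\ge 0$ and $d_i\geq 1$ for $1\le i\le r$; $A_0\in Sp(2d_0,\mathbb{R})$ has its spectrum in $\{|z|=1\}$; and, for $1\le i\le r$, $A_i=\mathrm{diag}(D_i,(D_i^{*})^{-1})$ with $D_i\in GL(d_i,\mathbb{R})$ of spectrum included in $\{|z|=e^{\lambda_i^+}\}$. Adapted Gaussian. Fix $\varepsilon_0\in(0,\lambda_{\max}]$. For $\hbar\in(0,1]$ put $$D_1(\hbar)=\mathrm{diag}\Big(\hbar^{-\frac{\varepsilon_0}{2\lambda_{\max}}}\mathrm{Id}_{\mathbb{R}^{d_0}},\hbar^{-\frac{\lambda_1^+}{2\lambda_{\max}}}\mathrm{Id}_{\mathbb{R}^{d_1}},\dots,\hbar^{-\frac{\lambda_r^+}{2\lambda_{\max}}}\mathrm{Id}_{\mathbb{R}^{d_r}}\Big),\qquad B(\hbar)=Q\begin{pmatrix}D_1(\hbar)&0\\0&D_1(\hbar)\end{pmatrix}Q^{-1},$$ $$G_\hbar(\rho)=2^{d/2}|\det B(\hbar)|^{1/2}e^{-\pi\|B(\hbar)\rho\|^2},\qquad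 \rho\in\mathbb{R}^{2d}.$$ Quantizations. $\mathrm{Op}_\hbar^w(a)$ is the Weyl quantization, $$[\mathrm{Op}_\hbar^w(a)u](x)=\frac1{(2\pi\hbar)^d}\int_{\mathbb{R}^d}\Big(\int_{\mathbb{R}^d}e^{\frac i\hbar\langle x-y,\xi\rangle}a\big(\tfrac{x+y}2,\xi\big)u(y)\,dy\Big)d\xi,\qquad u\in\mathcal{S}(\mathbb{R}^d),$$ extended to a bounded operator on $L^2(\mathbb{R}^d)$. Let $a\star b$ denote convolution, let $$(a\sharp b)(\rho)=\frac1{(\pi\hbar)^{2d}}\int_{\mathbb{R}^{4d}}e^{-\frac{2i}{\hbar}\sigma(w_1,w_2)}a(\rho+w_1)b(\rho+w_2)\,dw_1dw_2$$ be the Moyal product (the Weyl symbol of $\mathrm{Op}_\hbar^w(a)\circ\mathrm{Op}_\hbar^w(b)$), and put $$\mathrm{Op}_\hbar^+(a)=\mathrm{Op}_\hbar^w\big(a\star(G_\hbar\sharp G_\hbar)\big).$$ Let $S^0(1)$ be the set of (possibly $\hbar$-dependent) $a\in\mathcal{C}^\infty(\mathbb{R}^{2d},\mathbb{C})$ such that,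 for every multi-index $\alpha$, $\|\partial^\alpha a\|_\infty\le C_\alpha$ with $C_\alpha$ independent of $\hbar\in(0,1]$. Lemma. There is $\gamma>0$, depending only on $A$ and on the fixed parameter $\varepsilon_0$, such that for every reduction as above and every $a\in S^0(1)$ there is a constant $C$ such that, for all $\hbar\in(0,1]$: $\mathrm{Op}_\hbar^w(G_\hbar)$, $\mathrm{Op}_\hbar^w(a)$ and $\mathrm{Op}_\hbar^+(a)$ are bounded on $L^2(\mathbb{R}^d)$, $\mathrm{Op}_\hbar^w(G_\hbar\sharp G_\hbar)=\mathrm{Op}_\hbar^w(G_\hbar)\circ\mathrm{Op}_\hbar^w(G_\hbar)$, and $$\big\|\mathrm{Op}_\hbar^w(a)-\mathrm{Op}_\hbar^+(a)\big\|_{L^2(\mathbb{R}^d)\to L^2(\mathbb{R}^d)}\le C\hbar^\gamma .$$ -/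

import Mathlib

open scoped SchwartzMap ContDiff

noncomputable section

/-- Configuration space `ℝ^d`. -/
abbrev Config (d : ℕ) : Type := EuclideanSpace ℝ (Fin d)

/-- Phase space `ℝ^{2d}` with its Euclidean norm; the first `d` coordinates of `ρ = (x, ξ)` are the
position `x`, the last `d` the momentum `ξ`. -/
abbrev Phase (d : ℕ) : Type := EuclideanSpace ℝ (Fin d ⊕ Fin d)

/-- The point `(x, ξ)` of phase space. -/
def phasePt {d : ℕ} (x ξ : Config d) : Phase d :=
  WithLp.toLp 2 (Sum.elim (fun i => x i) (fun i => ξ i))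

/-- The linear action of a `2d × 2d` matrix on phase space. -/
def matAct {d : ℕ} (M : Matrix (Fin d ⊕ Fin d) (Fin d ⊕ Fin d) ℝ) (ρ : Phase d) : Phase d :=
  WithLp.toLp 2 (M.mulVec (fun i => ρ i))

/-- The symplectic form `σ(ρ, ρ') = ⟨ρ, J ρ'⟩` with `J = (0, -Id; Id, 0)`. -/
def sympForm {d : ℕ} (ρ ρ' : Phase d) : ℝ :=
  inner ℝ ρ (matAct (Matrix.J (Fin d) ℝ) ρ')

/-- The symbol class `S^0(1)`: (possibly `ħ`-dependent) complex-valued smooth functions on phase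
space, all of whose derivatives of each order are bounded, uniformly in `ħ ∈ (0, 1]`. -/
def IsSymbolS0 {d : ℕ} (a : ℝ → Phase d → ℂ) : Prop :=
  (∀ h ∈ Set.Ioc (0 : ℝ) 1, ContDiff ℝ ∞ (a h)) ∧
  ∀ n : ℕ, ∃ C : ℝ, ∀ h ∈ Set.Ioc (0 : ℝ) 1, ∀ ρ : Phase d, ‖iteratedFDeriv ℝ n (a h) ρ‖ ≤ C

/-- The integrand `e^{(i/ħ)⟨x - y, ξ⟩} a((x + y)/2, ξ) u(y)` of the Weyl quantization. -/
def weylIntegrand {d : ℕ} (h : ℝ) (a : Phase d → ℂ) (u : Config d → ℂ) (x ξ y : Config d) : ℂ :=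
  Complex.exp (Complex.I * ((inner ℝ (x - y) ξ / h : ℝ) : ℂ)) *
    a (phasePt ((1 / 2 : ℝ) • (x + y)) ξ) * u y

/-- The Weyl quantization `(2πħ)^{-d} ∫ (∫ e^{(i/ħ)⟨x-y,ξ⟩} a((x+y)/2, ξ) u(y) dy) dξ`. For a symbol
with bounded derivatives and a Schwartz function `u` the double integral does not converge
absolutely; integrating first in `y`, then in `ξ`, gives its value as an oscillatory integral. -/
def weylApply {d : ℕ} (h : ℝ) (a : Phase d → ℂ) (u : Config d → ℂ) (x : Config d) : ℂ :=
  (((2 * Real.pi * h) ^ d : ℝ) : ℂ)⁻¹ * ∫ ξ : Config d, ∫ y : Config d, weylIntegrand h a u x ξ y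

/-- `T` is the bounded operator `Op_ħ^w(a)` on `L²(ℝ^d)`: for every Schwartz function `u` the
integrals which define `Op_ħ^w(a) u` converge, and `T u = Op_ħ^w(a) u`. As Schwartz functions are
dense in `L²(ℝ^d)`, there is at most one such `T`. -/
def IsWeylOp {d : ℕ} (h : ℝ) (a : Phase d → ℂ)
    (T : MeasureTheory.Lp ℂ 2 (MeasureTheory.volume : MeasureTheory.Measure (Config d)) →L[ℂ]
      MeasureTheory.Lp ℂ 2 (MeasureTheory.volume : MeasureTheory.Measure (Config d))) : Prop :=
  ∀ u : 𝓢(Config d, ℂ),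
    (∀ x ξ : Config d, MeasureTheory.Integrable (fun y => weylIntegrand h a u x ξ y)) ∧
    (∀ x : Config d, MeasureTheory.Integrable (fun ξ => ∫ y, weylIntegrand h a u x ξ y)) ∧
    T (u.toLp 2) =ᵐ[MeasureTheory.volume] weylApply h a u

/-- The Moyal product
`(a ♯ b)(ρ) = (πħ)^{-2d} ∫ e^{-(2i/ħ) σ(w₁, w₂)} a(ρ + w₁) b(ρ + w₂) dw₁ dw₂`. -/
def moyal {d : ℕ} (h : ℝ) (a b : Phase d → ℂ) (ρ : Phase d) : ℂ :=
  (((Real.pi * h) ^ (2 * d) : ℝ) : ℂ)⁻¹ *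
    ∫ w : Phase d × Phase d,
      Complex.exp (-(2 * Complex.I) * ((sympForm w.1 w.2 / h : ℝ) : ℂ)) * a (ρ + w.1) * b (ρ + w.2)

/-- The convolution `(a ⋆ b)(ρ) = ∫ a(ρ₀) b(ρ - ρ₀) dρ₀`. -/
def conv {d : ℕ} (a b : Phase d → ℂ) : Phase d → ℂ :=
  MeasureTheory.convolution a b (ContinuousLinearMap.mul ℝ ℂ) MeasureTheory.volume

/-- The complex spectrum of a real square matrix. -/
def complexSpectrum {n : Type} [Fintype n] [DecidableEq n] (M : Matrix n n ℝ) : Set ℂ :=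
  spectrum ℂ (M.map (fun t : ℝ => (t : ℂ)))

/-- An integer matrix regarded as a real one. -/
def toRealMat {n : Type} (A : Matrix n n ℤ) : Matrix n n ℝ := A.map (fun t : ℤ => (t : ℝ))

/-- `λ_max = sup {log |β| : β in the spectrum of A}`. -/
def lyapMax {n : Type} [Fintype n] [DecidableEq n] (A : Matrix n n ℤ) : ℝ :=
  sSup ((fun β : ℂ => Real.log ‖β‖) '' complexSpectrum (toRealMat A))

/-- The `⋄`-product `M_0 ⋄ ⋯ ⋄ M_r` of matrices `M_i = (A_i, B_i; C_i, D_i)` in `M(2d_i, ℝ)`: the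
matrix `(diag A_i, diag B_i; diag C_i, diag D_i)` in `M(2(d_0 + ⋯ + d_r), ℝ)`. -/
def diamondProd {r : ℕ} {dim : Fin (r + 1) → ℕ}
    (M : ∀ i, Matrix (Fin (dim i) ⊕ Fin (dim i)) (Fin (dim i) ⊕ Fin (dim i)) ℝ) :
    Matrix ((Σ i, Fin (dim i)) ⊕ (Σ i, Fin (dim i))) ((Σ i, Fin (dim i)) ⊕ (Σ i, Fin (dim i))) ℝ :=
  Matrix.fromBlocks
    (Matrix.blockDiagonal' fun i => (M i).toBlocks₁₁)
    (Matrix.blockDiagonal' fun i => (M i).toBlocks₁₂)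
    (Matrix.blockDiagonal' fun i => (M i).toBlocks₂₁)
    (Matrix.blockDiagonal' fun i => (M i).toBlocks₂₂)

/-- The consecutive numbering of `d = d_0 + ⋯ + d_r` coordinates which are grouped in blocks of
sizes `d_0, …, d_r`. -/
def blockNumbering {r d : ℕ} {dim : Fin (r + 1) → ℕ} (hdim : ∑ i, dim i = d) :
    (Σ i, Fin (dim i)) ≃ Fin d :=
  finSigmaFinEquiv.trans (finCongr hdim)

/-- The blocks `A_0` and `A_i = diag(D_i, (D_i^*)⁻¹)`, `1 ≤ i ≤ r`. -/
def reductionBlock {r : ℕ} {dim : Fin (r + 1) → ℕ}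
    (A₀ : Matrix (Fin (dim 0) ⊕ Fin (dim 0)) (Fin (dim 0) ⊕ Fin (dim 0)) ℝ)
    (D : ∀ i : Fin r, Matrix (Fin (dim i.succ)) (Fin (dim i.succ)) ℝ) :
    ∀ i, Matrix (Fin (dim i) ⊕ Fin (dim i)) (Fin (dim i) ⊕ Fin (dim i)) ℝ :=
  Fin.cases A₀ fun i => Matrix.fromBlocks (D i) 0 0 ((D i).transpose)⁻¹

/-- A symplectic reduction `A = Q (A_0 ⋄ A_1 ⋄ ⋯ ⋄ A_r) Q⁻¹` of `A`, adapted to its positive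
Lyapunov exponents `0 < λ_1 < ⋯ < λ_r` (here `lyap`, indexed from `0`). The block `A_0`, of size
`2 d_0` with `d_0 ≥ 0`, carries the eigenvalues of modulus one. -/
structure SympReduction {d : ℕ} (A : Matrix (Fin d ⊕ Fin d) (Fin d ⊕ Fin d) ℤ) where
  r : ℕ
  dim : Fin (r + 1) → ℕ
  dim_sum : ∑ i, dim i = d
  dim_pos : ∀ i : Fin r, 0 < dim i.succ
  lyap : Fin r → ℝ
  lyap_pos : ∀ i, 0 < lyap i
  lyap_strictMono : StrictMono lyap
  A₀ : Matrix (Fin (dim 0) ⊕ Fin (dim 0)) (Fin (dim 0) ⊕ Fin (dim 0)) ℝ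
  A₀_symp : A₀ ∈ Matrix.symplecticGroup (Fin (dim 0)) ℝ
  A₀_spec : ∀ z ∈ complexSpectrum A₀, ‖z‖ = 1
  D : ∀ i : Fin r, Matrix (Fin (dim i.succ)) (Fin (dim i.succ)) ℝ
  D_inv : ∀ i, IsUnit (D i)
  D_spec : ∀ i, ∀ z ∈ complexSpectrum (D i), ‖z‖ = Real.exp (lyap i)
  Q : Matrix (Fin d ⊕ Fin d) (Fin d ⊕ Fin d) ℝ
  Q_symp : Q ∈ Matrix.symplecticGroup (Fin d) ℝ
  conj : toRealMat A =
    Q * Matrix.reindex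
        (Equiv.sumCongr (blockNumbering dim_sum) (blockNumbering dim_sum))
        (Equiv.sumCongr (blockNumbering dim_sum) (blockNumbering dim_sum))
        (diamondProd (reductionBlock A₀ D)) * Q⁻¹

namespace SympReduction

variable {d : ℕ} {A : Matrix (Fin d ⊕ Fin d) (Fin d ⊕ Fin d) ℤ}

/-- `γ_0 = ε₀ / (2 λ_max)` and `γ_i = λ_i / (2 λ_max)` for `1 ≤ i ≤ r`. -/
def exponent (R : SympReduction A) (ε₀ : ℝ) : Fin (R.r + 1) → ℝ :=
  Fin.cases (ε₀ / (2 * lyapMax A)) fun i => R.lyap i / (2 * lyapMax A)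

/-- The diagonal matrix `(ħ^{-γ_0} Id_{d_0}, ħ^{-γ_1} Id_{d_1}, …, ħ^{-γ_r} Id_{d_r})`. -/
def scaling (R : SympReduction A) (ε₀ h : ℝ) : Matrix (Fin d) (Fin d) ℝ :=
  Matrix.diagonal fun j => h ^ (-(R.exponent ε₀ ((blockNumbering R.dim_sum).symm j).1))

/-- `B(ħ) = Q diag(D_1(ħ), D_1(ħ)) Q⁻¹`, with `D_1(ħ)` the diagonal matrix `scaling`. -/
def B (R : SympReduction A) (ε₀ h : ℝ) : Matrix (Fin d ⊕ Fin d) (Fin d ⊕ Fin d) ℝ :=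
  R.Q * Matrix.fromBlocks (R.scaling ε₀ h) 0 0 (R.scaling ε₀ h) * R.Q⁻¹

/-- The adapted Gaussian `G_ħ = 2^{d/2} |det B(ħ)|^{1/2} G ∘ B(ħ)`, where
`G(ρ) = exp(-π ‖ρ‖²)`. -/
def gaussian (R : SympReduction A) (ε₀ h : ℝ) (ρ : Phase d) : ℂ :=
  (((2 : ℝ) ^ ((d : ℝ) / 2) * |(R.B ε₀ h).det| ^ ((1 : ℝ) / 2) *
    Real.exp (-Real.pi * ‖matAct (R.B ε₀ h) ρ‖ ^ 2) : ℝ) : ℂ)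

/-- The Weyl symbol `a ⋆ (G_ħ ♯ G_ħ)` of `Op_ħ^+(a)`. -/
def plusSymbol (R : SympReduction A) (ε₀ h : ℝ) (a : Phase d → ℂ) : Phase d → ℂ :=
  conv a (moyal h (R.gaussian ε₀ h) (R.gaussian ε₀ h))

end SympReduction

end

/-! The Weyl symbol of Op⁺(a) is a ⋆ K with K = G_ħ ♯ G_ħ, and K turns out to be a nonnegative
function of integral one. Hence a - a ⋆ K is the average of a(ρ) - a(ρ - t) with respect to K(t) dt
(`smoothErr`). Each derivative of this error is bounded by the next derivative of a times the first
moment of K. The Calderón–Vaillancourt theorem `exists_isWeylOp` turns such bounds into an operator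
norm bound, so everything reduces to showing that the first moment of K is O(ħ^γ).

The Moyal square is computed in `moyal_normGaussian`. In terms of the half sum s and the half
difference t of the two integration variables, the parallelogram law decouples the two Gaussians.
The substitution s = ħ J Bᵀ y then turns the phase into the inner product of y and B t, up to a
constant. The integral in t is a Gaussian Fourier transform, so no oscillation remains: K averages
the Gaussian in B ρ over the shifts ħ J Bᵀ y, with a Gaussian weight in y. The first moment is
therefore at most C Λ as soon as Λ bounds both B⁻¹ and ħ J Bᵀ (`exists_moment_moyalKernel_le`).

Up to factors that depend on Q, these two matrices have sizes ħ^{γ_i} and ħ^{1 - γ_i} on the i-th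
block. Since ε₀ and the λ_i are at most λ_max, every γ_i is at most 1/2. Each λ_i is log |β| for
some eigenvalue β of A, so every γ_i is at least γ = μ / (2 λ_max), with μ the least element of the
finite set made of ε₀ and the positive values of log |β|. This γ does not see the chosen reduction,
and both sizes are at most ħ^γ.

Calderón–Vaillancourt is proved with wave packets. After a dilation by √(2πħ), the symbol is cut by
Gaussian windows centred at all points z of phase space, and each piece is expanded in plane waves.
A plane wave times a Gaussian pairs u and v through their wave packet transforms at two points
displaced from z in opposite directions (`integral_amplitude_packet`). Cauchy–Schwarz in z, with
Plancherel for the transform, bounds each plane wave, and 2d + 1 derivatives of the symbol make the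
expansion summable over the 2d-dimensional dual space.

The identity Op(G ♯ G) = Op(G) Op(G) is an identity of integral kernels: in the momentum, the Moyal
product is the Fourier transform of the composed kernel (`stdMoyal_eq_fourier`), and Fourier
inversion gives it back. For a symbol with Gaussian decay the kernel is square integrable in its
second variable, so the integral formula holds not only on Schwartz functions but on bounded
elements of L² (`ae_eq_weylApply`), such as Op(G) u. -/

noncomputable section

open MeasureTheory Real FourierTransform
open scoped ComplexConjugate

namespace WeylCalculus

set_option linter.unusedSectionVars false

/-! ### Gaussians as Schwartz functions, and their integrals. -/

section Gaussian

variable {V : Type*} [NormedAddCommGroup V]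

/-- The real Gaussian `exp (-b ‖x‖²)`. -/
def gauss (b : ℝ) (x : V) : ℝ := Real.exp (-(b * ‖x‖ ^ 2))

lemma gauss_pos (b : ℝ) (x : V) : 0 < gauss b x := Real.exp_pos _

lemma gauss_le_one {b : ℝ} (hb : 0 ≤ b) (x : V) : gauss b x ≤ 1 :=
  Real.exp_le_one_iff.mpr (neg_nonpos.mpr (by positivity))

@[fun_prop] lemma continuous_gauss (b : ℝ) : Continuous (gauss b : V → ℝ) := by
  unfold gauss; fun_prop

variable [InnerProductSpace ℝ V]

lemma contDiff_gauss (b : ℝ) {n : WithTop ℕ∞} : ContDiff ℝ n (gauss b : V → ℝ) := by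
  unfold gauss
  exact Real.contDiff_exp.comp ((contDiff_const.mul (contDiff_norm_sq ℝ)).neg)

/-- The first derivative of the exponent is linear, the second constant, the higher ones zero. The
bound is an `i`-th power because `norm_iteratedFDeriv_comp_le` wants the inner function controlled
in this form. -/
lemma norm_iteratedFDeriv_norm_sq_le (b : ℝ) (x : V) {i : ℕ} (hi : 1 ≤ i) :
    ‖iteratedFDeriv ℝ i (fun x : V => -(b * ‖x‖ ^ 2)) x‖ ≤ (2 * (1 + |b|) * (1 + ‖x‖)) ^ i := by
  obtain ⟨A, hA, hAn⟩ : ∃ A : V →L[ℝ] V →L[ℝ] ℝ,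
      fderiv ℝ (fun x : V => -(b * ‖x‖ ^ 2)) = A ∧ ‖A‖ ≤ 2 * |b| := by
    obtain ⟨I, hI, hIn⟩ : ∃ I : V →L[ℝ] V →L[ℝ] ℝ, (∀ y v, I y v = inner ℝ y v) ∧ ‖I‖ ≤ 1 :=
      ⟨innerSL ℝ, fun _ _ => rfl, norm_innerSL_le ℝ⟩
    refine ⟨(-(2 * b)) • I, ?_, ?_⟩
    · ext1 y
      have h : HasFDerivAt (fun x : V => -(b * ‖x‖ ^ 2)) _ y :=
        ((hasStrictFDerivAt_norm_sq y).hasFDerivAt.const_mul b).neg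
      rw [h.fderiv]
      ext v
      simp [hI]
      ring
    · refine (ContinuousLinearMap.opNorm_smul_le _ _).trans ?_
      rw [norm_neg, norm_mul, Real.norm_eq_abs, Real.norm_eq_abs, abs_two]
      nlinarith [abs_nonneg b]
  have hb : (0 : ℝ) ≤ |b| := abs_nonneg b
  have hx : (0 : ℝ) ≤ ‖x‖ := norm_nonneg x
  have hone : 1 ≤ 2 * (1 + |b|) * (1 + ‖x‖) := by nlinarith [mul_nonneg hb hx]
  obtain ⟨j, rfl⟩ : ∃ j, i = j + 1 := ⟨i - 1, by omega⟩
  rw [← norm_iteratedFDeriv_fderiv, hA]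
  rcases j with _ | _ | j
  · rw [norm_iteratedFDeriv_zero]
    refine (A.le_opNorm _).trans ?_
    simp only [zero_add, pow_one]
    nlinarith [mul_nonneg hb hx]
  · rw [← norm_iteratedFDeriv_fderiv, norm_iteratedFDeriv_zero, ContinuousLinearMap.fderiv]
    refine hAn.trans ?_
    calc 2 * |b| ≤ (2 * (1 + |b|) * (1 + ‖x‖)) ^ 1 := by nlinarith [mul_nonneg hb hx]
      _ ≤ _ := pow_le_pow_right₀ hone (by norm_num)
  · rw [← norm_iteratedFDeriv_fderiv]
    have : fderiv ℝ A = fun _ => A := by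
      ext1 y; exact ContinuousLinearMap.fderiv _
    rw [this, iteratedFDeriv_const_of_ne (by omega)]
    simp only [Pi.zero_apply, norm_zero]
    positivity

lemma norm_iteratedFDeriv_gauss_le (b : ℝ) (n : ℕ) (x : V) :
    ‖iteratedFDeriv ℝ n (gauss b : V → ℝ) x‖ ≤
      n.factorial * gauss b x * (2 * (1 + |b|) * (1 + ‖x‖)) ^ n := by
  have := norm_iteratedFDeriv_comp_le (𝕜 := ℝ) (g := Real.exp)
    (f := fun x : V => -(b * ‖x‖ ^ 2)) (n := n) (N := n)
    Real.contDiff_exp ((contDiff_const.mul (contDiff_norm_sq ℝ)).neg) le_rfl x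
    (C := gauss b x) (D := 2 * (1 + |b|) * (1 + ‖x‖)) ?_ ?_
  · exact this
  · intro i _
    rw [norm_iteratedFDeriv_eq_norm_iteratedDeriv, iteratedDeriv_eq_iterate, Real.iter_deriv_exp]
    simp [gauss]
  · intro i hi _
    exact norm_iteratedFDeriv_norm_sq_le b x hi

/-- Gaussians decay faster than any power. -/
lemma exists_pow_mul_gauss_le {b : ℝ} (hb : 0 < b) (k : ℕ) :
    ∃ C : ℝ, 0 ≤ C ∧ ∀ x : V, (1 + ‖x‖) ^ k * gauss b x ≤ C := by
  have hcont : Continuous fun t : ℝ => (1 + t) ^ k * Real.exp (-(b * t ^ 2)) := by fun_prop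
  -- The power is at most `k! exp (1 + ‖x‖)`, and completing the square bounds `‖x‖ - b ‖x‖ ^ 2` by
  -- `1 / (4 b)`.
  refine ⟨k.factorial * Real.exp (1 + 1 / (4 * b)), by positivity, fun x => ?_⟩
  have h1 : (1 + ‖x‖) ^ k ≤ k.factorial * Real.exp (1 + ‖x‖) := by
    have := Real.pow_div_factorial_le_exp (1 + ‖x‖) (by positivity) k
    rwa [div_le_iff₀ (by positivity), mul_comm] at this
  calc (1 + ‖x‖) ^ k * gauss b x ≤ (k.factorial * Real.exp (1 + ‖x‖)) * gauss b x := by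
        gcongr; exact (gauss_pos b x).le
    _ = k.factorial * Real.exp (1 + ‖x‖ - b * ‖x‖ ^ 2) := by
        rw [gauss, mul_assoc, ← Real.exp_add]; ring_nf
    _ ≤ _ := by
        gcongr
        have : ‖x‖ - b * ‖x‖ ^ 2 = 1 / (4 * b) - b * (‖x‖ - 1 / (2 * b)) ^ 2 := by
          field_simp; ring
        nlinarith [mul_nonneg hb.le (sq_nonneg (‖x‖ - 1 / (2 * b)))]

variable (V) in
/-- The Gaussian `exp (-b ‖x‖²)` as a complex-valued Schwartz function. -/
def gaussSchwartz (b : ℝ) (hb : 0 < b) : 𝓢(V, ℂ) where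
  toFun x := (gauss b x : ℂ)
  smooth' := Complex.ofRealCLM.contDiff.comp (contDiff_gauss b)
  decay' k n := by
    obtain ⟨C, hC, h⟩ := exists_pow_mul_gauss_le (V := V) hb (k + n)
    refine ⟨n.factorial * (2 * (1 + |b|)) ^ n * C, fun x => ?_⟩
    have h1 : ‖iteratedFDeriv ℝ n (fun x : V => (gauss b x : ℂ)) x‖ =
        ‖iteratedFDeriv ℝ n (gauss b : V → ℝ) x‖ :=
      Complex.ofRealLI.norm_iteratedFDeriv_comp_left (contDiff_gauss b).contDiffAt le_rfl
    rw [h1]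
    calc ‖x‖ ^ k * ‖iteratedFDeriv ℝ n (gauss b : V → ℝ) x‖
        ≤ (1 + ‖x‖) ^ k * (n.factorial * gauss b x * (2 * (1 + |b|) * (1 + ‖x‖)) ^ n) := by
          have h2 : ‖x‖ ≤ 1 + ‖x‖ := by linarith
          gcongr
          exact norm_iteratedFDeriv_gauss_le b n x
      _ = n.factorial * (2 * (1 + |b|)) ^ n * ((1 + ‖x‖) ^ (k + n) * gauss b x) := by
          rw [mul_pow, pow_add]; ring
      _ ≤ _ := by gcongr; exact h x

@[simp] lemma gaussSchwartz_apply (b : ℝ) (hb : 0 < b) (x : V) :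
    gaussSchwartz V b hb x = (gauss b x : ℂ) := rfl

variable [FiniteDimensional ℝ V] [MeasurableSpace V] [BorelSpace V]

lemma integrable_gauss {b : ℝ} (hb : 0 < b) : Integrable (gauss b : V → ℝ) := by
  have := (gaussSchwartz V b hb).integrable (μ := volume)
  simpa using this.re

lemma integral_gauss {b : ℝ} (hb : 0 < b) :
    ∫ x : V, gauss b x = (π / b) ^ (Module.finrank ℝ V / 2 : ℝ) := by
  rw [← GaussianFourier.integral_rexp_neg_mul_sq_norm hb]
  simp [gauss]

end Gaussian

/-! ### Decay of Fourier transforms with constants linear in the symbol bounds. -/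

section FourierDecay

variable {V : Type*} [NormedAddCommGroup V] [InnerProductSpace ℝ V] [FiniteDimensional ℝ V]
  [MeasurableSpace V] [BorelSpace V]

lemma norm_iteratedFDeriv_mul_schwartz_le (φ : 𝓢(V, ℂ)) {n : ℕ} {b : V → ℂ} {M : ℝ}
    (hb : ContDiff ℝ n b) (hM : ∀ k ≤ n, ∀ x, ‖iteratedFDeriv ℝ k b x‖ ≤ M) {k : ℕ} (hk : k ≤ n)
    (x : V) :
    ‖iteratedFDeriv ℝ k (fun x => b x * φ x) x‖ ≤
      M * ∑ i ∈ Finset.range (k + 1), (k.choose i : ℝ) * ‖iteratedFDeriv ℝ (k - i) φ x‖ := by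
  refine (norm_iteratedFDeriv_mul_le (N := n) hb (φ.smooth n) x (by exact_mod_cast hk)).trans ?_
  rw [Finset.mul_sum]
  refine Finset.sum_le_sum fun i hi => ?_
  have hi' : i ≤ n := by
    have := Finset.mem_range.mp hi; omega
  calc _ ≤ (k.choose i : ℝ) * M * ‖iteratedFDeriv ℝ (k - i) φ x‖ := by gcongr; exact hM i hi' x
    _ = _ := by ring

lemma one_add_pow_le {t : ℝ} (ht : 0 ≤ t) (n : ℕ) : (1 + t) ^ n ≤ 2 ^ n * (1 + t ^ n) := by
  rcases le_total t 1 with h | h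
  · calc (1 + t) ^ n ≤ 2 ^ n := by gcongr; linarith
      _ ≤ _ := le_mul_of_one_le_right (by positivity) (by linarith [pow_nonneg ht n])
  · calc (1 + t) ^ n ≤ (2 * t) ^ n := by gcongr; linarith
      _ = 2 ^ n * t ^ n := mul_pow _ _ _
      _ ≤ _ := by gcongr; linarith

/-- The Fourier transform of `b φ`, with `φ` Schwartz and `b` bounded with its derivatives up to the
order `n`, decays like `‖w‖ ^ (-n)`, with a constant linear in the bound for `b`. -/
lemma exists_fourier_mul_decay (φ : 𝓢(V, ℂ)) (n : ℕ) :
    ∃ C : ℝ, 0 ≤ C ∧ ∀ (b : V → ℂ) (M : ℝ), ContDiff ℝ n b →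
      (∀ k ≤ n, ∀ x, ‖iteratedFDeriv ℝ k b x‖ ≤ M) →
      ∀ w, (1 + ‖w‖) ^ n * ‖𝓕 (fun x => b x * φ x) w‖ ≤ C * M := by
  set c : ℕ → ℝ := fun k => ∫ x, ∑ i ∈ Finset.range (k + 1),
    (k.choose i : ℝ) * ‖iteratedFDeriv ℝ (k - i) φ x‖ with hc
  have hc0 : ∀ k, 0 ≤ c k := fun k => integral_nonneg fun x => by positivity
  have hint : ∀ k, Integrable fun x => ∑ i ∈ Finset.range (k + 1),
      (k.choose i : ℝ) * ‖iteratedFDeriv ℝ (k - i) φ x‖ := fun k =>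
    integrable_finsetSum _ fun i _ => Integrable.const_mul
      (by simpa using φ.integrable_pow_mul_iteratedFDeriv volume 0 (k - i)) _
  -- The term `c 0` bounds the transform itself, the sum bounds it after multiplication by `‖w‖ ^
  -- n`. The outer `2 ^ n` comes from `one_add_pow_le`, the inner one from
  -- `Real.pow_mul_norm_iteratedFDeriv_fourier_le`.
  refine ⟨2 ^ n * (c 0 + (2 ^ n * ∑ k ∈ Finset.range (n + 1), c k)), ?_, ?_⟩
  · have := Finset.sum_nonneg fun k (_ : k ∈ Finset.range (n + 1)) => hc0 k
    have := hc0 0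
    positivity
  intro b M hb hM w
  have hf : ContDiff ℝ n (fun x => b x * φ x) := hb.mul (φ.smooth n)
  have hI : ∀ k ≤ n, Integrable fun x => ‖iteratedFDeriv ℝ k (fun x => b x * φ x) x‖ := by
    intro k hk
    refine ((hint k).const_mul M).mono' ?_ ?_
    · exact (hf.continuous_iteratedFDeriv (by exact_mod_cast hk)).norm.aestronglyMeasurable
    · refine Filter.Eventually.of_forall fun x => ?_
      rw [norm_norm]
      exact norm_iteratedFDeriv_mul_schwartz_le φ hb hM hk x
  have hle : ∀ k ≤ n, ∫ x, ‖iteratedFDeriv ℝ k (fun x => b x * φ x) x‖ ≤ M * c k := by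
    intro k hk
    rw [hc, ← integral_const_mul]
    exact integral_mono (hI k hk) ((hint k).const_mul M)
      (norm_iteratedFDeriv_mul_schwartz_le φ hb hM hk)
  have h0 : ‖𝓕 (fun x => b x * φ x) w‖ ≤ M * c 0 := by
    refine le_trans ?_ (hle 0 (Nat.zero_le _))
    simp only [norm_iteratedFDeriv_zero]
    rw [Real.fourier_eq]
    refine (norm_integral_le_integral_norm _).trans (le_of_eq ?_)
    simp
  have hn : ‖w‖ ^ n * ‖𝓕 (fun x => b x * φ x) w‖ ≤
      2 ^ n * ∑ k ∈ Finset.range (n + 1), M * c k := by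
    have := Real.pow_mul_norm_iteratedFDeriv_fourier_le (K := 0) (N := n)
      (f := fun x => b x * φ x) (by exact_mod_cast hf) (k := 0) (n := n) ?_ le_rfl le_rfl w
    · simp only [norm_iteratedFDeriv_zero] at this
      refine this.trans ?_
      simp only [pow_zero, CharP.cast_eq_zero, mul_zero, zero_add, one_mul]
      gcongr
      rw [Finset.sum_product]
      simp only [Finset.range_one, Finset.sum_singleton, pow_zero, one_mul]
      exact Finset.sum_le_sum fun k hk => hle k (by have := Finset.mem_range.mp hk; omega)
    · intro k m hk hm
      obtain rfl : k = 0 := by simpa using hk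
      simpa using hI m (by exact_mod_cast hm)
  calc (1 + ‖w‖) ^ n * ‖𝓕 (fun x => b x * φ x) w‖
      ≤ 2 ^ n * (1 + ‖w‖ ^ n) * ‖𝓕 (fun x => b x * φ x) w‖ := by
        gcongr; exact one_add_pow_le (norm_nonneg _) n
    _ = 2 ^ n * (‖𝓕 (fun x => b x * φ x) w‖ + ‖w‖ ^ n * ‖𝓕 (fun x => b x * φ x) w‖) := by ring
    _ ≤ 2 ^ n * (M * c 0 + 2 ^ n * ∑ k ∈ Finset.range (n + 1), M * c k) := by gcongr
    _ = _ := by rw [← Finset.mul_sum]; ring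

lemma integrable_one_add_norm_pow_inv {n : ℕ} (hn : Module.finrank ℝ V < n) :
    Integrable fun x : V => ((1 + ‖x‖) ^ n)⁻¹ := by
  have := integrable_one_add_norm (E := V) (μ := volume) (r := n) (by exact_mod_cast hn)
  refine this.congr (Filter.Eventually.of_forall fun x => ?_)
  simp only
  rw [Real.rpow_neg (by positivity), Real.rpow_natCast]

end FourierDecay

/-- Integrals over pairs of points are translated and dilated below, which requires the Haar
property of the product volume. -/
instance isAddHaarMeasure_volume_prod {V W : Type*} [NormedAddCommGroup V] [InnerProductSpace ℝ V]
    [FiniteDimensional ℝ V] [MeasurableSpace V] [BorelSpace V] [NormedAddCommGroup W]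
    [InnerProductSpace ℝ W] [FiniteDimensional ℝ W] [MeasurableSpace W] [BorelSpace W] :
    (volume : Measure (V × W)).IsAddHaarMeasure :=
  Measure.prod.instIsAddHaarMeasure volume volume

/-! ### Position and momentum coordinates on phase space; matrices and the symplectic form. -/

section Coordinates

variable {d : ℕ}

@[simp] lemma phasePt_inl (x ξ : Config d) (i : Fin d) : phasePt x ξ (Sum.inl i) = x i := rfl

@[simp] lemma phasePt_inr (x ξ : Config d) (i : Fin d) : phasePt x ξ (Sum.inr i) = ξ i := rfl

lemma phasePt_add (x ξ y η : Config d) :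
    phasePt x ξ + phasePt y η = phasePt (x + y) (ξ + η) := by
  ext i; rcases i with i | i <;> simp

lemma phasePt_sub (x ξ y η : Config d) :
    phasePt x ξ - phasePt y η = phasePt (x - y) (ξ - η) := by
  ext i; rcases i with i | i <;> simp

lemma smul_phasePt (c : ℝ) (x ξ : Config d) : c • phasePt x ξ = phasePt (c • x) (c • ξ) := by
  ext i; rcases i with i | i <;> simp

lemma inner_phasePt (x ξ y η : Config d) :
    inner ℝ (phasePt x ξ) (phasePt y η) = inner ℝ x y + inner ℝ ξ η := by
  simp [PiLp.inner_apply, Fintype.sum_sum_type]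

lemma norm_sq_phasePt (x ξ : Config d) : ‖phasePt x ξ‖ ^ 2 = ‖x‖ ^ 2 + ‖ξ‖ ^ 2 := by
  rw [← real_inner_self_eq_norm_sq, inner_phasePt, real_inner_self_eq_norm_sq,
    real_inner_self_eq_norm_sq]

variable (d) in
/-- The coordinates `(x, ξ)` of phase space, as a linear equivalence. -/
def phaseCoord : (Config d × Config d) ≃L[ℝ] Phase d :=
  LinearEquiv.toContinuousLinearEquiv
    { toFun := fun p => phasePt p.1 p.2
      map_add' := fun p q => (phasePt_add p.1 p.2 q.1 q.2).symm
      map_smul' := fun c p => (smul_phasePt c p.1 p.2).symm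
      invFun := fun ρ => (WithLp.toLp 2 fun i => ρ (Sum.inl i), WithLp.toLp 2 fun i => ρ (Sum.inr i))
      left_inv := fun p => by ext <;> simp
      right_inv := fun ρ => by ext i; rcases i with i | i <;> simp }

@[fun_prop] lemma _root_.Continuous.phasePt {X : Type*} [TopologicalSpace X] {f g : X → Config d}
    (hf : Continuous f) (hg : Continuous g) : Continuous fun t => phasePt (f t) (g t) :=
  (phaseCoord d).continuous.comp (hf.prodMk hg)

lemma exists_phasePt_eq (ρ : Phase d) : ∃ x ξ : Config d, phasePt x ξ = ρ :=
  ⟨((phaseCoord d).symm ρ).1, ((phaseCoord d).symm ρ).2, (phaseCoord d).apply_symm_apply ρ⟩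

/-- Both volumes are Lebesgue measure on a product of lines, so only the regrouping of coordinates
along `Fin d ⊕ Fin d` matters. -/
lemma measurePreserving_phaseCoord : MeasurePreserving (phaseCoord d) := by
  have h1 := (EuclideanSpace.volume_preserving_symm_measurableEquiv_toLp (Fin d)).prod
    (EuclideanSpace.volume_preserving_symm_measurableEquiv_toLp (Fin d))
  have h2 := volume_measurePreserving_sumPiEquivProdPi_symm (fun _ : Fin d ⊕ Fin d => ℝ)
  have h3 := (EuclideanSpace.volume_preserving_symm_measurableEquiv_toLp (Fin d ⊕ Fin d)).symm
  have := h3.comp (h2.comp h1)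
  convert! this using 1

lemma measurableEmbedding_phaseCoord : MeasurableEmbedding (phaseCoord d) :=
  (phaseCoord d).toHomeomorph.measurableEmbedding

lemma integral_phase {E : Type*} [NormedAddCommGroup E] [NormedSpace ℝ E] (f : Phase d → E) :
    ∫ ρ, f ρ = ∫ p : Config d × Config d, f (phasePt p.1 p.2) :=
  (measurePreserving_phaseCoord.integral_comp measurableEmbedding_phaseCoord f).symm

lemma integrable_phase_iff {E : Type*} [NormedAddCommGroup E] {f : Phase d → E} :
    Integrable (fun p : Config d × Config d => f (phasePt p.1 p.2)) ↔ Integrable f :=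
  measurePreserving_phaseCoord.integrable_comp_emb measurableEmbedding_phaseCoord

lemma integral_phase_prod {E : Type*} [NormedAddCommGroup E] [NormedSpace ℝ E] {f : Phase d → E}
    (hf : Integrable f) : ∫ ρ, f ρ = ∫ x : Config d, ∫ ξ : Config d, f (phasePt x ξ) := by
  rw [integral_phase, Measure.volume_eq_prod, integral_prod _
    ((Measure.volume_eq_prod (Config d) (Config d)) ▸ integrable_phase_iff.mpr hf)]

lemma gauss_phasePt (b : ℝ) (x ξ : Config d) :
    gauss b (phasePt x ξ) = gauss b x * gauss b ξ := by
  rw [gauss, gauss, gauss, ← Real.exp_add, norm_sq_phasePt]; ring_nf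

/-- The linear map of phase space with a given matrix. -/
def matL (M : Matrix (Fin d ⊕ Fin d) (Fin d ⊕ Fin d) ℝ) : Phase d →L[ℝ] Phase d :=
  LinearMap.toContinuousLinearMap (Matrix.toEuclideanLin M)

@[simp] lemma matL_apply (M : Matrix (Fin d ⊕ Fin d) (Fin d ⊕ Fin d) ℝ) (ρ : Phase d) :
    matL M ρ = matAct M ρ := rfl

lemma matAct_mul (M N : Matrix (Fin d ⊕ Fin d) (Fin d ⊕ Fin d) ℝ) (ρ : Phase d) :
    matAct (M * N) ρ = matAct M (matAct N ρ) := by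
  simp [matAct, Matrix.mulVec_mulVec]

@[simp] lemma matAct_one (ρ : Phase d) : matAct 1 ρ = ρ := by
  simp [matAct]

lemma det_matL (M : Matrix (Fin d ⊕ Fin d) (Fin d ⊕ Fin d) ℝ) :
    LinearMap.det (matL M : Phase d →ₗ[ℝ] Phase d) = M.det := by
  have : (matL M : Phase d →ₗ[ℝ] Phase d) =
      Matrix.toLin (EuclideanSpace.basisFun (Fin d ⊕ Fin d) ℝ).toBasis
        (EuclideanSpace.basisFun (Fin d ⊕ Fin d) ℝ).toBasis M := by
    rw [← Matrix.toEuclideanLin_eq_toLin_orthonormal]; rfl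
  rw [this, LinearMap.det_toLin]

lemma inner_matAct_transpose (M : Matrix (Fin d ⊕ Fin d) (Fin d ⊕ Fin d) ℝ) (ρ ρ' : Phase d) :
    inner ℝ (matAct M.transpose ρ) ρ' = inner ℝ ρ (matAct M ρ') := by
  simp only [PiLp.inner_apply, matAct, RCLike.inner_apply, conj_trivial]
  have := Matrix.dotProduct_mulVec (fun i => ρ i) M (fun i => ρ' i)
  simp only [dotProduct] at this
  rw [Matrix.mulVec_transpose]
  simp_rw [mul_comm _ (ρ _)]
  rw [this]
  simp_rw [mul_comm]

lemma sympForm_phasePt (x ξ y η : Config d) :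
    sympForm (phasePt x ξ) (phasePt y η) = inner ℝ ξ y - inner ℝ x η := by
  have : matAct (Matrix.J (Fin d) ℝ) (phasePt y η) = phasePt (-η) y := by
    ext i
    rcases i with i | i <;>
      simp [matAct, Matrix.J, Matrix.mulVec, dotProduct, Fintype.sum_sum_type, Matrix.one_apply]
  rw [sympForm, this, inner_phasePt, inner_neg_right]; ring

lemma sympForm_smul_left (c : ℝ) (ρ ρ' : Phase d) : sympForm (c • ρ) ρ' = c * sympForm ρ ρ' := by
  simp [sympForm, real_inner_smul_left]

lemma sympForm_smul_right (c : ℝ) (ρ ρ' : Phase d) : sympForm ρ (c • ρ') = c * sympForm ρ ρ' := by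
  rw [sympForm, ← matL_apply, map_smul, real_inner_smul_right]; rfl

lemma finrank_config : Module.finrank ℝ (Config d) = d := by simp

lemma finrank_phase : Module.finrank ℝ (Phase d) = 2 * d := by simp [two_mul]

end Coordinates

/-! ### The character `exp (2πit)` and Gaussian Fourier integrals. -/

section Character

/-- The character `t ↦ exp (2πit)`. -/
def ex (t : ℝ) : ℂ := Complex.exp (((2 * π * t : ℝ) : ℂ) * Complex.I)

@[simp] lemma norm_ex (t : ℝ) : ‖ex t‖ = 1 := Complex.norm_exp_ofReal_mul_I _

lemma ex_add (s t : ℝ) : ex (s + t) = ex s * ex t := by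
  rw [ex, ex, ex, ← Complex.exp_add]; push_cast; ring_nf

lemma conj_ex (t : ℝ) : conj (ex t) = ex (-t) := by
  rw [ex, ex, ← Complex.exp_conj, map_mul, Complex.conj_ofReal, Complex.conj_I]
  push_cast; ring_nf

@[fun_prop] lemma continuous_ex : Continuous ex := by unfold ex; fun_prop

variable {V : Type*} [NormedAddCommGroup V] [InnerProductSpace ℝ V] [FiniteDimensional ℝ V]
  [MeasurableSpace V] [BorelSpace V]

lemma fourier_eq_ex (f : V → ℂ) (w : V) : 𝓕 f w = ∫ v, ex (-inner ℝ v w) * f v := by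
  rw [Real.fourier_eq']
  refine integral_congr_ae (Filter.Eventually.of_forall fun v => ?_)
  simp only [smul_eq_mul, ex]
  congr 3; push_cast; ring

lemma fourierInv_eq_ex (f : V → ℂ) (w : V) : 𝓕⁻ f w = ∫ v, ex (inner ℝ v w) * f v := by
  rw [Real.fourierInv_eq']
  rfl

lemma integral_ex_mul_gauss {b : ℝ} (hb : 0 < b) (w : V) :
    ∫ v : V, ex (inner ℝ w v) * (gauss b v : ℂ) =
      (((π / b) ^ (Module.finrank ℝ V / 2 : ℝ) : ℝ) : ℂ) * (gauss (π ^ 2 / b) w : ℂ) := by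
  have h := GaussianFourier.integral_cexp_neg_mul_sq_norm_add (b := (b : ℂ)) (by simpa using hb)
    (2 * π * Complex.I) w
  have e1 : ∀ v : V, ex (inner ℝ w v) * (gauss b v : ℂ) =
      Complex.exp (-(b : ℂ) * (‖v‖ : ℂ) ^ 2 + 2 * π * Complex.I * (inner ℝ w v : ℝ)) := by
    intro v
    rw [ex, gauss, Complex.ofReal_exp, ← Complex.exp_add]
    push_cast; ring_nf
  simp_rw [e1]
  rw [h, gauss, Complex.ofReal_cpow (by positivity), Complex.ofReal_exp]
  have hb' : (b : ℂ) ≠ 0 := by exact_mod_cast hb.ne'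
  congr 2
  · push_cast; ring
  · push_cast; ring
  · push_cast
    rw [mul_pow, mul_pow, Complex.I_sq]
    field_simp
    ring

lemma integral_ex_mul_gauss_sub {b : ℝ} (hb : 0 < b) (w p : V) :
    ∫ v : V, ex (inner ℝ w v) * (gauss b (v - p) : ℂ) =
      ex (inner ℝ w p) *
        ((((π / b) ^ (Module.finrank ℝ V / 2 : ℝ) : ℝ) : ℂ) * (gauss (π ^ 2 / b) w : ℂ)) := by
  rw [← integral_ex_mul_gauss hb, ← integral_const_mul, ← integral_add_right_eq_self _ p]
  refine integral_congr_ae (Filter.Eventually.of_forall fun v => ?_)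
  simp only [add_sub_cancel_right, inner_add_right, ex_add]
  ring

end Character

/-! ### Wave packets and Plancherel for the wave packet transform. -/

section WavePackets

variable {d : ℕ}

/-- The Fourier integral of the wave packet decomposition of the Weyl quantization. -/
lemma integral_packet (q p f e x y : Config d) :
    ∫ ξ : Config d, ex (inner ℝ (x - y) ξ) *
        ex (inner ℝ (phasePt ((1 / 2 : ℝ) • (x + y)) ξ) (phasePt f e)) *
        (gauss (2 * π) (phasePt ((1 / 2 : ℝ) • (x + y)) ξ - phasePt q p) : ℂ) =
      (((1 / 2 : ℝ) ^ (d / 2 : ℝ) : ℝ) : ℂ) * ex (inner ℝ e p) *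
        (ex (inner ℝ x (p + (1 / 2 : ℝ) • f)) * (gauss π (x - (q - (1 / 2 : ℝ) • e)) : ℂ)) *
        (ex (-inner ℝ y (p - (1 / 2 : ℝ) • f)) * (gauss π (y - (q + (1 / 2 : ℝ) • e)) : ℂ)) := by
  set m : Config d := (1 / 2 : ℝ) • (x + y) with hm
  have h := integral_ex_mul_gauss_sub (b := 2 * π) (by positivity) (x - y + e) p
  have e1 : ∀ ξ : Config d, ex (inner ℝ (x - y) ξ) *
      ex (inner ℝ (phasePt m ξ) (phasePt f e)) * (gauss (2 * π) (phasePt m ξ - phasePt q p) : ℂ) =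
      ex (inner ℝ m f) * (gauss (2 * π) (m - q) : ℂ) *
        (ex (inner ℝ (x - y + e) ξ) * (gauss (2 * π) (ξ - p) : ℂ)) := by
    intro ξ
    rw [inner_phasePt, phasePt_sub, gauss_phasePt, inner_add_left, real_inner_comm e ξ, ex_add,
      ex_add]
    push_cast; ring
  simp_rw [e1]
  rw [integral_const_mul, h]
  have hpi : π / (2 * π) = 1 / 2 := by field_simp
  have hpi2 : π ^ 2 / (2 * π) = π / 2 := by field_simp
  rw [hpi, hpi2, finrank_config]
  -- The parallelogram law for `m - q` and half of `x - y + e` separates `x` from `y`; this is what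
  -- makes the integral factor into two wave packets.
  have hg : gauss (2 * π) (m - q) * gauss (π / 2) (x - y + e) =
      gauss π (x - (q - (1 / 2 : ℝ) • e)) * gauss π (y - (q + (1 / 2 : ℝ) • e)) := by
    rw [gauss, gauss, gauss, gauss, ← Real.exp_add, ← Real.exp_add]
    congr 1
    have hp := parallelogram_law_with_norm ℝ (m - q) ((1 / 2 : ℝ) • (x - y + e))
    have h1 : m - q + (1 / 2 : ℝ) • (x - y + e) = x - (q - (1 / 2 : ℝ) • e) := by
      rw [hm]; module
    have h2 : m - q - (1 / 2 : ℝ) • (x - y + e) = y - (q + (1 / 2 : ℝ) • e) := by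
      rw [hm]; module
    have h3 : ‖(1 / 2 : ℝ) • (x - y + e)‖ = 1 / 2 * ‖x - y + e‖ := by
      rw [norm_smul]; norm_num
    rw [h1, h2, h3] at hp
    linear_combination π * hp
  have he : ex (inner ℝ m f) * ex (inner ℝ (x - y + e) p) =
      ex (inner ℝ e p) * ex (inner ℝ x (p + (1 / 2 : ℝ) • f)) *
        ex (-inner ℝ y (p - (1 / 2 : ℝ) • f)) := by
    rw [← ex_add, ← ex_add, ← ex_add]
    congr 1
    simp only [hm, inner_add_left, inner_sub_left, inner_add_right, inner_sub_right,
      real_inner_smul_left, real_inner_smul_right]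
    ring
  have hg' : (gauss (2 * π) (m - q) : ℂ) * (gauss (π / 2) (x - y + e) : ℂ) =
      (gauss π (x - (q - (1 / 2 : ℝ) • e)) : ℂ) * (gauss π (y - (q + (1 / 2 : ℝ) • e)) : ℂ) := by
    exact_mod_cast hg
  linear_combination (((1 / 2 : ℝ) ^ (d / 2 : ℝ) : ℝ) : ℂ) *
      (gauss (2 * π) (m - q) : ℂ) * (gauss (π / 2) (x - y + e) : ℂ) * he +
    (((1 / 2 : ℝ) ^ (d / 2 : ℝ) : ℝ) : ℂ) * ex (inner ℝ e p) *
      ex (inner ℝ x (p + (1 / 2 : ℝ) • f)) * ex (-inner ℝ y (p - (1 / 2 : ℝ) • f)) * hg'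

/-- The wave packet transform of `u` at the point `z = (q, p)`. -/
def fbi (u : Config d → ℂ) (z : Config d × Config d) : ℂ :=
  ∫ y, ex (-inner ℝ y z.2) * (gauss π (y - z.1) : ℂ) * u y

lemma continuous_fbi (u : 𝓢(Config d, ℂ)) : Continuous (fbi u) := by
  unfold fbi
  refine continuous_of_dominated (bound := fun y => ‖u y‖) (fun z => ?_) (fun z => ?_)
    u.integrable.norm ?_
  · have := u.continuous
    exact Continuous.aestronglyMeasurable (by fun_prop)
  · refine Filter.Eventually.of_forall fun y => ?_
    rw [norm_mul, norm_mul, norm_ex, one_mul, Complex.norm_real, Real.norm_eq_abs,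
      abs_of_pos (gauss_pos _ _)]
    exact mul_le_of_le_one_left (norm_nonneg _) (gauss_le_one pi_pos.le _)
  · refine Filter.Eventually.of_forall fun y => ?_
    fun_prop

lemma enorm_sq_eq_ofReal (z : ℂ) : ‖z‖ₑ ^ 2 = ENNReal.ofReal (‖z‖ ^ 2) := by
  rw [ENNReal.ofReal_pow (norm_nonneg _), ofReal_norm]

lemma lintegral_enorm_sq_fourier {V : Type*} [NormedAddCommGroup V] [InnerProductSpace ℝ V]
    [FiniteDimensional ℝ V] [MeasurableSpace V] [BorelSpace V] (f : 𝓢(V, ℂ)) :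
    ∫⁻ w, ‖𝓕 (f : V → ℂ) w‖ₑ ^ 2 = ∫⁻ x, ‖f x‖ₑ ^ 2 := by
  have hint : ∀ g : 𝓢(V, ℂ), Integrable fun x => ‖g x‖ ^ 2 := fun g =>
    (memLp_two_iff_integrable_sq_norm (g.continuous.aestronglyMeasurable)).mp (g.memLp 2)
  simp_rw [enorm_sq_eq_ofReal]
  rw [← ofReal_integral_eq_lintegral_ofReal (hint f)
      (Filter.Eventually.of_forall fun x => by positivity),
    ← SchwartzMap.integral_norm_sq_fourier,
    ofReal_integral_eq_lintegral_ofReal (hint (𝓕 f))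
      (Filter.Eventually.of_forall fun x => by positivity)]
  simp only [SchwartzMap.fourier_coe]

/-- For fixed `q` the transform is, in `p`, the Fourier transform of `u` times a Gaussian window at
`q`. Plancherel in `p` followed by Tonelli in `q` gives the result; `lintegral` makes square
integrability a consequence instead of a prerequisite. -/
lemma lintegral_enorm_sq_fbi (u : 𝓢(Config d, ℂ)) :
    ∫⁻ z, ‖fbi u z‖ₑ ^ 2 =
      (∫⁻ q : Config d, ENNReal.ofReal (gauss (2 * π) q)) * ∫⁻ y, ‖u y‖ₑ ^ 2 := by
  have hu : Measurable fun y => ‖u y‖ₑ ^ 2 := u.continuous.measurable.enorm.pow_const 2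
  rw [Measure.volume_eq_prod, lintegral_prod _
    ((continuous_fbi u).measurable.enorm.pow_const 2).aemeasurable]
  have h1 : ∀ q : Config d, ∫⁻ p, ‖fbi u (q, p)‖ₑ ^ 2 =
      ∫⁻ y, ENNReal.ofReal (gauss (2 * π) (y - q)) * ‖u y‖ₑ ^ 2 := by
    intro q
    set g : 𝓢(Config d, ℂ) := SchwartzMap.pairing (ContinuousLinearMap.mul ℝ ℂ)
      (SchwartzMap.compSubConstCLM ℝ q (gaussSchwartz (Config d) π pi_pos)) u with hgdef
    have hgy : ∀ y, g y = (gauss π (y - q) : ℂ) * u y := fun y => by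
      rw [hgdef, SchwartzMap.pairing_apply_apply]
      simp
    have := lintegral_enorm_sq_fourier g
    have hf : ∀ p, 𝓕 (g : Config d → ℂ) p = fbi u (q, p) := by
      intro p
      rw [fourier_eq_ex, fbi]
      simp_rw [hgy, mul_assoc]
    simp_rw [hf] at this
    rw [this]
    refine lintegral_congr fun y => ?_
    rw [hgy, enorm_mul, mul_pow]
    congr 1
    rw [enorm_sq_eq_ofReal, Complex.norm_real, Real.norm_eq_abs, sq_abs, gauss, gauss,
      ← Real.exp_nat_mul]
    congr 2; push_cast; ring
  simp_rw [h1]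
  rw [lintegral_lintegral_swap]
  · have h2 : ∀ y, ∫⁻ q, ENNReal.ofReal (gauss (2 * π) (y - q)) * ‖u y‖ₑ ^ 2 =
        (∫⁻ q : Config d, ENNReal.ofReal (gauss (2 * π) q)) * ‖u y‖ₑ ^ 2 := by
      intro y
      rw [lintegral_mul_const _ (by
          exact (Continuous.measurable (by fun_prop)).ennreal_ofReal),
        lintegral_sub_left_eq_self (fun q : Config d => ENNReal.ofReal (gauss (2 * π) q)) y]
    simp_rw [h2]
    rw [lintegral_const_mul _ hu]
  · have h3 : Continuous fun z : Config d × Config d => gauss (2 * π) (z.2 - z.1) := by fun_prop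
    exact (h3.measurable.ennreal_ofReal.mul (hu.comp measurable_snd)).aemeasurable

end WavePackets

/-! ### Fourier decay of localized symbols, uniformly in the place of localization. -/

section FourierLocal

variable {V : Type*} [NormedAddCommGroup V] [InnerProductSpace ℝ V] [FiniteDimensional ℝ V]
  [MeasurableSpace V] [BorelSpace V]

lemma continuous_fourier_of_integrable {f : V → ℂ} (hf : Integrable f) : Continuous (𝓕 f) := by
  have : 𝓕 f = fun w => ∫ v, ex (-inner ℝ v w) * f v := funext (fourier_eq_ex f)
  rw [this]
  refine continuous_of_dominated (bound := fun y => ‖f y‖) (fun w => ?_) (fun w => ?_) hf.norm ?_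
  · exact (Continuous.aestronglyMeasurable (by fun_prop)).mul hf.aestronglyMeasurable
  · exact Filter.Eventually.of_forall fun y => by simp
  · exact Filter.Eventually.of_forall fun y => by fun_prop

/-- Translation by `z` only multiplies the Fourier transform by a character, and it preserves the
bounds on `a`; hence one constant serves all `z`. -/
lemma exists_fourier_local_decay (φ : 𝓢(V, ℂ)) (n : ℕ) :
    ∃ C : ℝ, 0 ≤ C ∧ ∀ (a : V → ℂ) (M : ℝ), ContDiff ℝ n a →
      (∀ k ≤ n, ∀ x, ‖iteratedFDeriv ℝ k a x‖ ≤ M) →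
      ∀ z w, ‖𝓕 (fun x => a x * φ (x - z)) w‖ ≤ C * M * ((1 + ‖w‖) ^ n)⁻¹ := by
  obtain ⟨C, hC, h⟩ := exists_fourier_mul_decay φ n
  refine ⟨C, hC, fun a M ha hM z w => ?_⟩
  have h1 := h (fun x => a (x + z)) M (ha.comp (contDiff_id.add contDiff_const))
    (fun k hk x => by rw [iteratedFDeriv_comp_add_right]; exact hM k hk _) w
  have h2 : 𝓕 (fun x => a x * φ (x - z)) w =
      ex (-inner ℝ z w) * 𝓕 (fun x => a (x + z) * φ x) w := by
    rw [fourier_eq_ex, fourier_eq_ex, ← integral_add_right_eq_self _ z, ← integral_const_mul]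
    refine integral_congr_ae (Filter.Eventually.of_forall fun v => ?_)
    simp only [add_sub_cancel_right, inner_add_left, neg_add, ex_add]
    ring
  rw [h2, norm_mul, norm_ex, one_mul, ← div_eq_mul_inv, le_div_iff₀ (by positivity), mul_comm]
  exact h1

lemma lintegral_enorm_sq_schwartz (u : 𝓢(V, ℂ)) : ∫⁻ y, ‖u y‖ₑ ^ 2 = ‖u.toLp 2‖ₑ ^ 2 := by
  have h := eLpNorm_nnreal_pow_eq_lintegral (μ := (volume : Measure V)) (f := u)
    (p := 2) (by norm_num)
  rw [Lp.enorm_def, eLpNorm_congr_ae (u.coeFn_toLp 2 volume)]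
  have h' : eLpNorm (⇑u) 2 volume ^ (2 : ℝ) = ∫⁻ x, ‖u x‖ₑ ^ (2 : ℝ) := by simpa using h
  simp only [← ENNReal.rpow_natCast]
  simpa using h'.symm

end FourierLocal

/-! ### Calderón–Vaillancourt for symbols that decay in the momentum. -/

section WeylBound

variable {d : ℕ}

/-- The Weyl quantization for the value `(2π)⁻¹` of the semiclassical parameter. -/
def stdWeyl (a : Phase d → ℂ) (u : Config d → ℂ) (x : Config d) : ℂ :=
  ∫ ξ, ∫ y, ex (inner ℝ (x - y) ξ) * a (phasePt ((1 / 2 : ℝ) • (x + y)) ξ) * u y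

/-- The phase space point at which the symbol is evaluated in the Weyl quantization. -/
abbrev midPt (t : (Config d × Config d) × Config d) : Phase d :=
  phasePt ((1 / 2 : ℝ) • (t.1.1 + t.1.2)) t.2

/-- The amplitude of the bilinear form of the Weyl quantization. -/
def amplitude (u v : Config d → ℂ) (t : (Config d × Config d) × Config d) : ℂ :=
  conj (v t.1.1) * u t.1.2 * ex (inner ℝ (t.1.1 - t.1.2) t.2)

lemma continuous_amplitude (u v : 𝓢(Config d, ℂ)) : Continuous (amplitude u v) := by
  have := u.continuous
  have := v.continuous
  have := Complex.continuous_conj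
  unfold amplitude
  fun_prop

lemma norm_amplitude (u v : Config d → ℂ) (t : (Config d × Config d) × Config d) :
    ‖amplitude u v t‖ = ‖v t.1.1‖ * ‖u t.1.2‖ := by
  simp [amplitude]

/-- The Schwartz functions give integrability in both positions, so the remaining factor has to
decay in the momentum only. -/
lemma integrable_amplitude_mul (u v : 𝓢(Config d, ℂ)) {g : (Config d × Config d) × Config d → ℂ}
    (hg : Continuous g) {b : Config d → ℝ} (hb : Integrable b) (hgb : ∀ t, ‖g t‖ ≤ b t.2) :
    Integrable fun t => amplitude u v t * g t := by
  have h1 : Integrable fun t : (Config d × Config d) × Config d =>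
      (‖v t.1.1‖ * ‖u t.1.2‖) * b t.2 :=
    Integrable.mul_prod (f := fun p : Config d × Config d => ‖v p.1‖ * ‖u p.2‖)
      (Integrable.mul_prod v.integrable.norm u.integrable.norm) hb
  refine h1.mono' ((continuous_amplitude u v).mul hg).aestronglyMeasurable
    (Filter.Eventually.of_forall fun t => ?_)
  rw [norm_mul, norm_amplitude]
  gcongr
  exact hgb t

lemma gauss_phasePt_sub_le {b : ℝ} (hb : 0 ≤ b) (x ξ q p : Config d) :
    gauss b (phasePt x ξ - phasePt q p) ≤ gauss b (ξ - p) := by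
  rw [phasePt_sub, gauss_phasePt]
  exact mul_le_of_le_one_left (gauss_pos _ _).le (gauss_le_one hb _)

lemma integrable_amplitude_gauss (u v : 𝓢(Config d, ℂ)) (z : Config d × Config d) :
    Integrable fun t => amplitude u v t * (gauss (2 * π) (midPt t - phasePt z.1 z.2) : ℂ) := by
  refine integrable_amplitude_mul u v (b := fun ξ => gauss (2 * π) (ξ - z.2)) (by fun_prop)
    ((integrable_gauss (by positivity)).comp_sub_right z.2) fun t => ?_
  rw [Complex.norm_real, Real.norm_eq_abs, abs_of_pos (gauss_pos _ _)]
  exact gauss_phasePt_sub_le (by positivity) _ _ _ _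

lemma conj_fbi (v : Config d → ℂ) (z : Config d × Config d) :
    conj (fbi v z) = ∫ x, conj (v x) * (ex (inner ℝ x z.2) * (gauss π (x - z.1) : ℂ)) := by
  rw [fbi, ← integral_conj]
  refine integral_congr_ae (Filter.Eventually.of_forall fun v => ?_)
  simp only [map_mul, conj_ex, neg_neg, Complex.conj_ofReal]
  ring

/-- The shift in the wave packet matrix elements of `exp (2πi⟨ρ, ζ⟩)`. -/
def packetShift (ζ : Config d × Config d) : Config d × Config d :=
  ((1 / 2 : ℝ) • ζ.2, -((1 / 2 : ℝ) • ζ.1))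

/-- By `integral_packet` the momentum integral is a product of a function of `x` and a function of
`y`. The plane wave of frequency `ζ` thus couples `v` and `u` at points displaced by opposite
shifts, with a coefficient of constant modulus. -/
lemma integral_amplitude_packet (u v : 𝓢(Config d, ℂ)) (z ζ : Config d × Config d) :
    ∫ t, amplitude u v t * (gauss (2 * π) (midPt t - phasePt z.1 z.2) : ℂ) *
        ex (inner ℝ (midPt t) (phasePt ζ.1 ζ.2)) =
      (((1 / 2 : ℝ) ^ (d / 2 : ℝ) : ℝ) : ℂ) * ex (inner ℝ ζ.2 z.2) *
        (conj (fbi v (z - packetShift ζ)) * fbi u (z + packetShift ζ)) := by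
  have hint : Integrable fun t => amplitude u v t *
      (gauss (2 * π) (midPt t - phasePt z.1 z.2) : ℂ) *
        ex (inner ℝ (midPt t) (phasePt ζ.1 ζ.2)) := by
    refine (integrable_amplitude_gauss u v z).mono ?_ (Filter.Eventually.of_forall fun t => ?_)
    · have := continuous_amplitude u v
      exact Continuous.aestronglyMeasurable (by fun_prop)
    · rw [norm_mul _ (ex _), norm_ex, mul_one]
  have h1 := integral_prod (μ := (volume : Measure (Config d × Config d)))
    (ν := (volume : Measure (Config d))) _ hint
  refine h1.trans ?_
  have h2 : ∀ w : Config d × Config d, ∫ ξ : Config d, amplitude u v (w, ξ) *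
      (gauss (2 * π) (midPt (w, ξ) - phasePt z.1 z.2) : ℂ) *
        ex (inner ℝ (midPt (w, ξ)) (phasePt ζ.1 ζ.2)) =
      (((1 / 2 : ℝ) ^ (d / 2 : ℝ) : ℝ) : ℂ) * ex (inner ℝ ζ.2 z.2) *
        ((conj (v w.1) * (ex (inner ℝ w.1 (z - packetShift ζ).2) *
            (gauss π (w.1 - (z - packetShift ζ).1) : ℂ))) *
          (ex (-inner ℝ w.2 (z + packetShift ζ).2) *
            (gauss π (w.2 - (z + packetShift ζ).1) : ℂ) * u w.2)) := by
    intro w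
    have h3 := integral_packet z.1 z.2 ζ.1 ζ.2 w.1 w.2
    have h4 : (z - packetShift ζ).2 = z.2 + (1 / 2 : ℝ) • ζ.1 := by simp [packetShift]
    have h5 : (z + packetShift ζ).2 = z.2 - (1 / 2 : ℝ) • ζ.1 := by
      simp [packetShift, sub_eq_add_neg]
    have h6 : (z - packetShift ζ).1 = z.1 - (1 / 2 : ℝ) • ζ.2 := rfl
    have h7 : (z + packetShift ζ).1 = z.1 + (1 / 2 : ℝ) • ζ.2 := rfl
    rw [h4, h5, h6, h7]
    calc _ = conj (v w.1) * u w.2 * ∫ ξ : Config d, ex (inner ℝ (w.1 - w.2) ξ) *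
          ex (inner ℝ (phasePt ((1 / 2 : ℝ) • (w.1 + w.2)) ξ) (phasePt ζ.1 ζ.2)) *
          (gauss (2 * π) (phasePt ((1 / 2 : ℝ) • (w.1 + w.2)) ξ - phasePt z.1 z.2) : ℂ) := by
          rw [← integral_const_mul]
          refine integral_congr_ae (Filter.Eventually.of_forall fun ξ => ?_)
          simp only [amplitude, midPt]
          ring
      _ = _ := by rw [h3]; ring
  simp_rw [h2]
  rw [integral_const_mul, conj_fbi, fbi]
  congr 1
  exact integral_prod_mul (μ := (volume : Measure (Config d))) (ν := (volume : Measure (Config d)))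
    (fun x => conj (v x) * (ex (inner ℝ x (z - packetShift ζ).2) *
            (gauss π (x - (z - packetShift ζ).1) : ℂ)))
    (fun y => ex (-inner ℝ y (z + packetShift ζ).2) *
            (gauss π (y - (z + packetShift ζ).1) : ℂ) * u y)

lemma integrable_ex_mul {X : Type*} [MeasurableSpace X] {μ : Measure X} {f : X → ℂ}
    (hf : Integrable f μ) {g : X → ℝ} (hg : Measurable g) :
    Integrable (fun t => f t * ex (g t)) μ := by
  refine hf.mono (hf.aestronglyMeasurable.mul
    (continuous_ex.measurable.comp hg).aestronglyMeasurable)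
    (Filter.Eventually.of_forall fun t => ?_)
  rw [norm_mul, norm_ex, mul_one]

/-- The part of the bilinear form of `stdWeyl a` which comes from the symbol near `z`, in terms of
wave packets. -/
lemma integral_amplitude_local (u v : 𝓢(Config d, ℂ)) {a : Phase d → ℂ} (ha : Continuous a)
    (z : Config d × Config d)
    (hint : Integrable fun ρ => a ρ * (gauss (2 * π) (ρ - phasePt z.1 z.2) : ℂ))
    (hFint : Integrable (𝓕 fun ρ => a ρ * (gauss (2 * π) (ρ - phasePt z.1 z.2) : ℂ))) :
    ∫ t, amplitude u v t * a (midPt t) * (gauss (4 * π) (midPt t - phasePt z.1 z.2) : ℂ) =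
      ∫ ζ : Config d × Config d,
        (𝓕 fun ρ => a ρ * (gauss (2 * π) (ρ - phasePt z.1 z.2) : ℂ)) (phasePt ζ.1 ζ.2) *
          ((((1 / 2 : ℝ) ^ (d / 2 : ℝ) : ℝ) : ℂ) * ex (inner ℝ ζ.2 z.2) *
        (conj (fbi v (z - packetShift ζ)) * fbi u (z + packetShift ζ))) := by
  set b : Phase d → ℂ := fun ρ => a ρ * (gauss (2 * π) (ρ - phasePt z.1 z.2) : ℂ) with hb
  have hinv : ∀ ρ, b ρ = ∫ ζ : Config d × Config d,
      ex (inner ℝ ρ (phasePt ζ.1 ζ.2)) * 𝓕 b (phasePt ζ.1 ζ.2) := by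
    intro ρ
    have hbc : Continuous b := by fun_prop
    rw [← integral_phase (fun η => ex (inner ℝ ρ η) * 𝓕 b η),
      ← hint.fourierInv_fourier_eq hFint hbc.continuousAt, fourierInv_eq_ex]
    simp_rw [real_inner_comm ρ]
  have hF : Integrable fun ζ : Config d × Config d => 𝓕 b (phasePt ζ.1 ζ.2) :=
    integrable_phase_iff.mpr hFint
  calc _ = ∫ t, ∫ ζ : Config d × Config d, amplitude u v t *
        (gauss (2 * π) (midPt t - phasePt z.1 z.2) : ℂ) * 𝓕 b (phasePt ζ.1 ζ.2) *
          ex (inner ℝ (midPt t) (phasePt ζ.1 ζ.2)) := by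
        refine integral_congr_ae (Filter.Eventually.of_forall fun t => ?_)
        -- The window of width parameter `4 * π` is split in two: one factor localizes the symbol
        -- before Fourier inversion, the other one supplies the Gaussian needed by
        -- `integral_amplitude_packet`.
        have h1 : (gauss (4 * π) (midPt t - phasePt z.1 z.2) : ℂ) =
            gauss (2 * π) (midPt t - phasePt z.1 z.2) *
              gauss (2 * π) (midPt t - phasePt z.1 z.2) := by
          rw [← Complex.ofReal_mul, gauss, gauss, ← Real.exp_add]; ring_nf
        have h2 : amplitude u v t * a (midPt t) *
            (gauss (4 * π) (midPt t - phasePt z.1 z.2) : ℂ) =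
            amplitude u v t * (gauss (2 * π) (midPt t - phasePt z.1 z.2) : ℂ) * b (midPt t) := by
          rw [h1, hb]; ring
        simp only
        rw [h2, hinv, ← integral_const_mul]
        refine integral_congr_ae (Filter.Eventually.of_forall fun ζ => ?_)
        simp only; ring
    _ = ∫ ζ : Config d × Config d, ∫ t, amplitude u v t *
        (gauss (2 * π) (midPt t - phasePt z.1 z.2) : ℂ) * 𝓕 b (phasePt ζ.1 ζ.2) *
          ex (inner ℝ (midPt t) (phasePt ζ.1 ζ.2)) := by
        refine integral_integral_swap ?_
        exact integrable_ex_mul ((integrable_amplitude_gauss u v z).mul_prod hF)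
          (Continuous.measurable (by fun_prop))
    _ = _ := by
        refine integral_congr_ae (Filter.Eventually.of_forall fun ζ => ?_)
        simp only
        rw [← integral_amplitude_packet, ← integral_const_mul]
        refine integral_congr_ae (Filter.Eventually.of_forall fun t => ?_)
        simp only; ring

lemma integral_gauss_sub_phasePt {b : ℝ} (ρ : Phase d) :
    ∫ z : Config d × Config d, gauss b (ρ - phasePt z.1 z.2) = ∫ ρ : Phase d, gauss b ρ := by
  rw [← integral_phase (fun ρ' => gauss b (ρ - ρ')), integral_sub_left_eq_self]

/-- The bilinear form is the integral of its localizations. -/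
lemma integral_amplitude_eq_integral_local (u v : 𝓢(Config d, ℂ)) {a : Phase d → ℂ}
    (hint : Integrable fun t => amplitude u v t * a (midPt t)) :
    ((∫ ρ : Phase d, gauss (4 * π) ρ : ℝ) : ℂ) * ∫ t, amplitude u v t * a (midPt t) =
      ∫ z : Config d × Config d, ∫ t,
        amplitude u v t * a (midPt t) * (gauss (4 * π) (midPt t - phasePt z.1 z.2) : ℂ) := by
  have hg : ∀ ρ : Phase d, Integrable fun z : Config d × Config d =>
      gauss (4 * π) (ρ - phasePt z.1 z.2) := fun ρ =>
    integrable_phase_iff.mpr ((integrable_gauss (by positivity)).comp_sub_left ρ)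
  rw [integral_integral_swap, ← integral_const_mul]
  · refine integral_congr_ae (Filter.Eventually.of_forall fun t => ?_)
    simp only
    rw [integral_const_mul, integral_complex_ofReal, integral_gauss_sub_phasePt]
    ring
  · have hmeas : AEStronglyMeasurable (fun s : ((Config d × Config d) × Config d) ×
        (Config d × Config d) => amplitude u v s.1 * a (midPt s.1) *
          (gauss (4 * π) (midPt s.1 - phasePt s.2.1 s.2.2) : ℂ))
        ((volume : Measure ((Config d × Config d) × Config d)).prod volume) :=
      hint.aestronglyMeasurable.comp_fst.mul (Continuous.aestronglyMeasurable (by fun_prop))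
    have : Integrable (fun s : ((Config d × Config d) × Config d) ×
        (Config d × Config d) => amplitude u v s.1 * a (midPt s.1) *
          (gauss (4 * π) (midPt s.1 - phasePt s.2.1 s.2.2) : ℂ))
        ((volume : Measure ((Config d × Config d) × Config d)).prod volume) := by
      rw [integrable_prod_iff hmeas]
      refine ⟨Filter.Eventually.of_forall fun t => ((hg (midPt t)).ofReal (𝕜 := ℂ)).const_mul
        (amplitude u v t * a (midPt t)), ?_⟩
      refine (hint.norm.mul_const (∫ ρ : Phase d, gauss (4 * π) ρ)).congr
        (Filter.Eventually.of_forall fun t => ?_)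
      simp only
      rw [← integral_gauss_sub_phasePt (midPt t), ← integral_const_mul]
      refine integral_congr_ae (Filter.Eventually.of_forall fun z => ?_)
      simp only
      rw [norm_mul (_ * _), Complex.norm_real, Real.norm_eq_abs, abs_of_pos (gauss_pos _ _)]
    exact this.swap

lemma lintegral_mul_le_sqrt {X : Type*} [MeasurableSpace X] (μ : Measure X) {f g : X → ENNReal}
    (hf : AEMeasurable f μ) (hg : AEMeasurable g μ) :
    ∫⁻ z, f z * g z ∂μ ≤
      (∫⁻ z, f z ^ 2 ∂μ) ^ (1 / 2 : ℝ) * (∫⁻ z, g z ^ 2 ∂μ) ^ (1 / 2 : ℝ) := by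
  have := ENNReal.lintegral_mul_le_Lp_mul_Lq μ (p := 2) (q := 2) ⟨by norm_num, by norm_num, by norm_num⟩ hf hg
  simpa using this

/-- **Calderón–Vaillancourt estimate**, for the bilinear form and symbols which decay in `ξ`. -/
lemma exists_norm_integral_amplitude_le (d : ℕ) :
    ∃ C : ℝ, 0 ≤ C ∧ ∀ (a : Phase d → ℂ) (M : ℝ), ContDiff ℝ (2 * d + 1 : ℕ) a →
      (∀ k ≤ 2 * d + 1, ∀ ρ, ‖iteratedFDeriv ℝ k a ρ‖ ≤ M) →
      ∀ b : Config d → ℝ, Integrable b → (∀ q ξ, ‖a (phasePt q ξ)‖ ≤ b ξ) →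
      ∀ u v : 𝓢(Config d, ℂ),
        ‖∫ t, amplitude u v t * a (midPt t)‖ ≤ C * M * ‖u.toLp 2‖ * ‖v.toLp 2‖ := by
  obtain ⟨C, hC, hF⟩ := exists_fourier_local_decay (gaussSchwartz (Phase d) (2 * π) (by positivity))
    (2 * d + 1)
  set κ : ℝ := ∫ ρ : Phase d, gauss (4 * π) ρ with hκ
  have hκ0 : 0 < κ := by
    rw [hκ, integral_gauss (by positivity)]; positivity
  set c : ℝ := (1 / 2 : ℝ) ^ (d / 2 : ℝ) with hc
  have hc0 : 0 ≤ c := by positivity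
  set J : ℝ := ∫ ζ : Config d × Config d, ((1 + ‖phasePt ζ.1 ζ.2‖) ^ (2 * d + 1))⁻¹ with hJ
  have hJint : Integrable fun ζ : Config d × Config d =>
      ((1 + ‖phasePt ζ.1 ζ.2‖) ^ (2 * d + 1))⁻¹ := integrable_phase_iff.mpr
        (integrable_one_add_norm_pow_inv (by rw [finrank_phase]; omega))
  have hJ0 : 0 ≤ J := integral_nonneg fun ζ => by positivity
  set g : ℝ := ∫ q : Config d, gauss (2 * π) q with hg
  have hg0 : 0 ≤ g := integral_nonneg fun q => (gauss_pos _ _).le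
  -- Here `κ` is the mass of the window, `C` the constant of Fourier decay, `c` the prefactor of the
  -- packet integral and `J` the integral of the decay, finite since `2d + 1 > 2d`. The factor `g`
  -- is the product of two square roots, one from each wave packet transform.
  refine ⟨κ⁻¹ * (C * c * J * g), by positivity, fun a M ha hM b hb hab u v => ?_⟩
  have hM0 : 0 ≤ M := (norm_nonneg _).trans (hM 0 (Nat.zero_le _) 0)
  have hac : Continuous a := ha.continuous
  have hint : Integrable fun t => amplitude u v t * a (midPt t) :=
    integrable_amplitude_mul u v (by fun_prop) hb fun t => hab _ _
  have hloc : ∀ z : Phase d, Integrable fun ρ => a ρ * (gauss (2 * π) (ρ - z) : ℂ) := fun z => by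
    refine (((integrable_gauss (V := Phase d) (b := 2 * π) (by positivity)).comp_sub_right
      z).const_mul M).mono' (Continuous.aestronglyMeasurable (by fun_prop))
      (Filter.Eventually.of_forall fun ρ => ?_)
    rw [norm_mul, Complex.norm_real, Real.norm_eq_abs, abs_of_pos (gauss_pos _ _)]
    have := hM 0 (Nat.zero_le _) ρ
    rw [norm_iteratedFDeriv_zero] at this
    gcongr
    exact (gauss_pos _ _).le
  have hFd : ∀ z w : Phase d, ‖𝓕 (fun ρ => a ρ * (gauss (2 * π) (ρ - z) : ℂ)) w‖ ≤
      C * M * ((1 + ‖w‖) ^ (2 * d + 1))⁻¹ := fun z w => hF a M ha hM z w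
  have hFi : ∀ z : Phase d, Integrable (𝓕 fun ρ => a ρ * (gauss (2 * π) (ρ - z) : ℂ)) := by
    intro z
    refine ((integrable_one_add_norm_pow_inv (V := Phase d) (n := 2 * d + 1)
      (by rw [finrank_phase]; omega)).const_mul (C * M)).mono'
      (continuous_fourier_of_integrable (hloc z)).aestronglyMeasurable
      (Filter.Eventually.of_forall fun w => hFd z w)
  set β : Config d × Config d → ENNReal := fun ζ =>
    ENNReal.ofReal (C * M * ((1 + ‖phasePt ζ.1 ζ.2‖) ^ (2 * d + 1))⁻¹) with hβ
  have hβc : Continuous fun ζ : Config d × Config d =>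
      C * M * ((1 + ‖phasePt ζ.1 ζ.2‖) ^ (2 * d + 1))⁻¹ := by
    refine continuous_const.mul (Continuous.inv₀ (by fun_prop) fun ζ => by positivity)
  have hβm : Measurable β := hβc.measurable.ennreal_ofReal
  have hsh : Continuous (packetShift (d := d)) := by unfold packetShift; fun_prop
  have hFu := (continuous_fbi u).measurable
  have hFv := (continuous_fbi v).measurable
  -- Working in `ENNReal` allows Tonelli and Cauchy–Schwarz without proving integrability in `(z,
  -- ζ)` first.
  have key : ENNReal.ofReal κ * ‖∫ t, amplitude u v t * a (midPt t)‖ₑ ≤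
      ENNReal.ofReal (C * M * J) * (ENNReal.ofReal c * (ENNReal.ofReal g *
        (‖u.toLp 2‖ₑ * ‖v.toLp 2‖ₑ))) := by
    have h1 := integral_amplitude_eq_integral_local u v hint
    have h2 : ENNReal.ofReal κ * ‖∫ t, amplitude u v t * a (midPt t)‖ₑ =
        ‖(κ : ℂ) * ∫ t, amplitude u v t * a (midPt t)‖ₑ := by
      rw [enorm_mul]
      congr 1
      rw [← ofReal_norm, Complex.norm_real, Real.norm_eq_abs, abs_of_pos hκ0]
    rw [h2, h1]
    calc _ ≤ ∫⁻ z : Config d × Config d, ‖∫ t, amplitude u v t * a (midPt t) *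
          (gauss (4 * π) (midPt t - phasePt z.1 z.2) : ℂ)‖ₑ := enorm_integral_le_lintegral_enorm _
      _ ≤ ∫⁻ z : Config d × Config d, ∫⁻ ζ : Config d × Config d,
          β ζ * (ENNReal.ofReal c *
            (‖fbi v (z - packetShift ζ)‖ₑ * ‖fbi u (z + packetShift ζ)‖ₑ)) := by
          refine lintegral_mono fun z => ?_
          simp only
          rw [integral_amplitude_local u v hac z (hloc _) (hFi _)]
          refine (enorm_integral_le_lintegral_enorm _).trans (lintegral_mono fun ζ => ?_)
          rw [enorm_mul, enorm_mul, enorm_mul, enorm_mul]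
          refine mul_le_mul' ?_ (mul_le_mul' (le_of_eq ?_) (mul_le_mul' (le_of_eq ?_) le_rfl))
          · rw [← ofReal_norm]
            exact ENNReal.ofReal_le_ofReal (hFd _ _)
          · rw [← ofReal_norm, ← ofReal_norm, norm_ex, Complex.norm_real, Real.norm_eq_abs,
              abs_of_nonneg hc0]
            simp
          · rw [← ofReal_norm, ← ofReal_norm, RCLike.norm_conj]
      _ = ∫⁻ ζ : Config d × Config d, ∫⁻ z : Config d × Config d,
          β ζ * (ENNReal.ofReal c *
            (‖fbi v (z - packetShift ζ)‖ₑ * ‖fbi u (z + packetShift ζ)‖ₑ)) := by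
          refine lintegral_lintegral_swap (Measurable.aemeasurable ?_)
          refine (hβm.comp measurable_snd).mul (Measurable.const_mul (Measurable.mul
            (hFv.comp ?_).enorm (hFu.comp ?_).enorm) _)
          · exact Continuous.measurable (by fun_prop)
          · exact Continuous.measurable (by fun_prop)
      _ ≤ ∫⁻ ζ : Config d × Config d, β ζ * (ENNReal.ofReal c * (ENNReal.ofReal g *
            (‖u.toLp 2‖ₑ * ‖v.toLp 2‖ₑ))) := by
          refine lintegral_mono fun ζ => ?_
          have m1 : Measurable fun z => ‖fbi v (z - packetShift ζ)‖ₑ :=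
            (hFv.comp (Continuous.measurable (by fun_prop))).enorm
          have m2 : Measurable fun z => ‖fbi u (z + packetShift ζ)‖ₑ :=
            (hFu.comp (Continuous.measurable (by fun_prop))).enorm
          have m3 : Measurable fun z => ‖fbi v (z - packetShift ζ)‖ₑ *
            ‖fbi u (z + packetShift ζ)‖ₑ := m1.mul m2
          simp only
          rw [lintegral_const_mul _ (m3.const_mul _), lintegral_const_mul _ m3]
          gcongr
          -- After Cauchy–Schwarz in `z`, the shifts disappear by translation invariance, so the
          -- bound is uniform in `ζ`.
          refine (lintegral_mul_le_sqrt _ m1.aemeasurable m2.aemeasurable).trans ?_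
          have i1 : ∫⁻ z, ‖fbi v (z - packetShift ζ)‖ₑ ^ 2 = ENNReal.ofReal g * ‖v.toLp 2‖ₑ ^ 2 := by
            rw [lintegral_sub_right_eq_self (fun z => ‖fbi v z‖ₑ ^ 2), lintegral_enorm_sq_fbi,
              lintegral_enorm_sq_schwartz, hg, ofReal_integral_eq_lintegral_ofReal
              (integrable_gauss (by positivity))
              (Filter.Eventually.of_forall fun q => (gauss_pos _ _).le)]
          have i2 : ∫⁻ z, ‖fbi u (z + packetShift ζ)‖ₑ ^ 2 = ENNReal.ofReal g * ‖u.toLp 2‖ₑ ^ 2 := by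
            rw [lintegral_add_right_eq_self (fun z => ‖fbi u z‖ₑ ^ 2), lintegral_enorm_sq_fbi,
              lintegral_enorm_sq_schwartz, hg, ofReal_integral_eq_lintegral_ofReal
              (integrable_gauss (by positivity))
              (Filter.Eventually.of_forall fun q => (gauss_pos _ _).le)]
          have sq : ∀ t : ENNReal, (t ^ 2) ^ (1 / 2 : ℝ) = t := fun t => by
            rw [← ENNReal.rpow_natCast, ← ENNReal.rpow_mul]; norm_num
          have sg : ENNReal.ofReal g ^ (1 / 2 : ℝ) * ENNReal.ofReal g ^ (1 / 2 : ℝ) =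
              ENNReal.ofReal g := by
            rw [← ENNReal.rpow_add_of_nonneg _ _ (by norm_num) (by norm_num)]; norm_num
          rw [i1, i2, ENNReal.mul_rpow_of_nonneg _ _ (by norm_num),
            ENNReal.mul_rpow_of_nonneg _ _ (by norm_num), sq, sq]
          refine le_of_eq ?_
          calc _ = (ENNReal.ofReal g ^ (1 / 2 : ℝ) * ENNReal.ofReal g ^ (1 / 2 : ℝ)) *
                (‖u.toLp 2‖ₑ * ‖v.toLp 2‖ₑ) := by ring
            _ = _ := by rw [sg]
      _ = _ := by
          rw [lintegral_mul_const _ hβm]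
          congr 1
          rw [hJ, ← integral_const_mul, ofReal_integral_eq_lintegral_ofReal (hJint.const_mul _)
            (Filter.Eventually.of_forall fun ζ => by positivity)]
  rw [← ofReal_norm, ← ofReal_norm, ← ofReal_norm, ← ENNReal.ofReal_mul hκ0.le,
    ← ENNReal.ofReal_mul (by positivity), ← ENNReal.ofReal_mul (by positivity),
    ← ENNReal.ofReal_mul (by positivity), ← ENNReal.ofReal_mul (by positivity),
    ENNReal.ofReal_le_ofReal_iff (by positivity)] at key
  have : ‖∫ t, amplitude u v t * a (midPt t)‖ ≤
      κ⁻¹ * (C * M * J * (c * (g * (‖u.toLp 2‖ * ‖v.toLp 2‖)))) := by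
    rw [inv_mul_eq_div, le_div_iff₀ hκ0, mul_comm]
    exact key
  refine this.trans (le_of_eq ?_)
  ring

end WeylBound

/-! ### Derivative bounds under affine maps and products. -/

section DerivativeBounds

variable {E F G : Type*} [NormedAddCommGroup E] [NormedSpace ℝ E] [NormedAddCommGroup F]
  [NormedSpace ℝ F] [NormedAddCommGroup G] [NormedSpace ℝ G]

lemma norm_iteratedFDeriv_comp_affine_le {a : F → G} {n : ℕ} {M : ℝ} (ha : ContDiff ℝ n a)
    (hM : ∀ k ≤ n, ∀ x, ‖iteratedFDeriv ℝ k a x‖ ≤ M) (L : E →L[ℝ] F) (c : F) {k : ℕ} (hk : k ≤ n)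
    (y : E) : ‖iteratedFDeriv ℝ k (fun y => a (L y + c)) y‖ ≤ M * ‖L‖ ^ k := by
  have h1 : (fun y => a (L y + c)) = (fun x => a (x + c)) ∘ L := rfl
  have h2 : ContDiff ℝ n fun x => a (x + c) := ha.comp (contDiff_id.add contDiff_const)
  rw [h1, L.iteratedFDeriv_comp_right h2 y (by exact_mod_cast hk), iteratedFDeriv_comp_add_right]
  refine (ContinuousMultilinearMap.norm_compContinuousLinearMap_le _ _).trans ?_
  rw [Finset.prod_const, Finset.card_univ, Fintype.card_fin]
  gcongr
  exact hM k hk _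

lemma contDiff_comp_affine {a : F → G} {n : WithTop ℕ∞} (ha : ContDiff ℝ n a) (L : E →L[ℝ] F)
    (c : F) : ContDiff ℝ n fun y => a (L y + c) :=
  ha.comp (L.contDiff.add contDiff_const)

lemma norm_iteratedFDeriv_mul_le_of_le {a b : E → ℂ} {n : ℕ} {M N : ℝ} (ha : ContDiff ℝ n a)
    (hM : ∀ k ≤ n, ∀ x, ‖iteratedFDeriv ℝ k a x‖ ≤ M) (hb : ContDiff ℝ n b)
    (hN : ∀ k ≤ n, ∀ x, ‖iteratedFDeriv ℝ k b x‖ ≤ N) {k : ℕ} (hk : k ≤ n) (x : E) :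
    ‖iteratedFDeriv ℝ k (fun x => a x * b x) x‖ ≤ 2 ^ n * (M * N) := by
  have hM0 : 0 ≤ M := (norm_nonneg _).trans (hM 0 (Nat.zero_le _) x)
  have hN0 : 0 ≤ N := (norm_nonneg _).trans (hN 0 (Nat.zero_le _) x)
  refine (norm_iteratedFDeriv_mul_le (N := n) ha hb x (by exact_mod_cast hk)).trans ?_
  calc _ ≤ ∑ i ∈ Finset.range (k + 1), (k.choose i : ℝ) * (M * N) := by
        refine Finset.sum_le_sum fun i hi => ?_
        have := Finset.mem_range.mp hi
        rw [mul_assoc]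
        gcongr
        · exact hM i (by omega) x
        · exact hN _ (by omega) x
    _ = 2 ^ k * (M * N) := by
        rw [← Finset.sum_mul]
        congr 1
        exact_mod_cast Nat.sum_range_choose k
    _ ≤ _ := by gcongr; norm_num

lemma exists_norm_iteratedFDeriv_schwartz_le (φ : 𝓢(E, G)) (n : ℕ) :
    ∃ C : ℝ, 0 ≤ C ∧ ∀ k ≤ n, ∀ x, ‖iteratedFDeriv ℝ k φ x‖ ≤ C := by
  refine ⟨∑ k ∈ Finset.range (n + 1), SchwartzMap.seminorm ℝ 0 k φ,
    Finset.sum_nonneg fun k _ => apply_nonneg _ _, fun k hk x => ?_⟩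
  refine (SchwartzMap.norm_iteratedFDeriv_le_seminorm ℝ φ k x).trans ?_
  exact Finset.single_le_sum (f := fun k => SchwartzMap.seminorm ℝ 0 k φ)
    (fun k _ => apply_nonneg _ _) (Finset.mem_range.mpr (by omega))

end DerivativeBounds

/-! ### Calderón–Vaillancourt for all symbols, by removal of a momentum cutoff. -/

section WeylBound

variable {d : ℕ}

/-- The inner integral of the Weyl quantization. -/
def stdInner (a : Phase d → ℂ) (u : Config d → ℂ) (x ξ : Config d) : ℂ :=
  ∫ y, ex (inner ℝ (x - y) ξ) * a (phasePt ((1 / 2 : ℝ) • (x + y)) ξ) * u y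

lemma stdWeyl_eq (a : Phase d → ℂ) (u : Config d → ℂ) (x : Config d) :
    stdWeyl a u x = ∫ ξ, stdInner a u x ξ := rfl

lemma continuous_stdInner {a : Phase d → ℂ} (ha : Continuous a) {M : ℝ} (hM : ∀ ρ, ‖a ρ‖ ≤ M)
    {u : Config d → ℂ} (hu : Integrable u) :
    Continuous fun p : Config d × Config d => stdInner a u p.1 p.2 := by
  unfold stdInner
  refine continuous_of_dominated (bound := fun y => M * ‖u y‖) (fun p => ?_) (fun p => ?_)
    (hu.norm.const_mul M) ?_
  · exact (Continuous.aestronglyMeasurable (by fun_prop)).mul hu.aestronglyMeasurable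
  · refine Filter.Eventually.of_forall fun y => ?_
    rw [norm_mul, norm_mul, norm_ex, one_mul]
    gcongr
    exact hM _
  · exact Filter.Eventually.of_forall fun y => by fun_prop

variable (d) in
/-- The map `y ↦ (y / 2, 0)`. -/
def halfPos : Config d →L[ℝ] Phase d :=
  (phaseCoord d : Config d × Config d →L[ℝ] Phase d).comp
    ((ContinuousLinearMap.inl ℝ (Config d) (Config d)).comp
      ((1 / 2 : ℝ) • ContinuousLinearMap.id ℝ (Config d)))

lemma halfPos_apply (y : Config d) : halfPos d y = phasePt ((1 / 2 : ℝ) • y) 0 := rfl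

lemma norm_halfPos_le : ‖halfPos d‖ ≤ 1 := by
  refine ContinuousLinearMap.opNorm_le_bound _ zero_le_one fun y => ?_
  rw [halfPos_apply, one_mul]
  refine (sq_le_sq₀ (norm_nonneg _) (norm_nonneg _)).mp ?_
  rw [norm_sq_phasePt, norm_smul, norm_zero]
  norm_num
  nlinarith [norm_nonneg y]

/-- The integral in `y` is, up to a phase, a Fourier transform at `ξ` of the symbol times `u`;
smoothness in `y` therefore becomes decay in `ξ`. This is why the iterated integral converges for
symbols without decay. -/
lemma exists_stdInner_decay (u : 𝓢(Config d, ℂ)) (n : ℕ) :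
    ∃ C : ℝ, 0 ≤ C ∧ ∀ (a : Phase d → ℂ) (M : ℝ), ContDiff ℝ n a →
      (∀ k ≤ n, ∀ ρ, ‖iteratedFDeriv ℝ k a ρ‖ ≤ M) →
      ∀ x ξ, ‖stdInner a u x ξ‖ ≤ C * M * ((1 + ‖ξ‖) ^ n)⁻¹ := by
  obtain ⟨C, hC, h⟩ := exists_fourier_local_decay u n
  refine ⟨C, hC, fun a M ha hM x ξ => ?_⟩
  have hM0 : 0 ≤ M := (norm_nonneg _).trans (hM 0 (Nat.zero_le _) 0)
  have hb : ∀ y, a (phasePt ((1 / 2 : ℝ) • (x + y)) ξ) =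
      a (halfPos d y + phasePt ((1 / 2 : ℝ) • x) ξ) := fun y => by
    rw [halfPos_apply, phasePt_add, zero_add, smul_add, add_comm]
  have h1 := h (fun y => a (halfPos d y + phasePt ((1 / 2 : ℝ) • x) ξ)) M
    (contDiff_comp_affine ha _ _) (fun k hk y => by
      refine (norm_iteratedFDeriv_comp_affine_le ha hM _ _ hk y).trans ?_
      exact mul_le_of_le_one_right hM0 (pow_le_one₀ (norm_nonneg _) norm_halfPos_le)) 0 ξ
  have h2 : stdInner a u x ξ = ex (inner ℝ x ξ) *
      𝓕 (fun y => a (halfPos d y + phasePt ((1 / 2 : ℝ) • x) ξ) * u (y - 0)) ξ := by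
    rw [fourier_eq_ex, stdInner, ← integral_const_mul]
    refine integral_congr_ae (Filter.Eventually.of_forall fun y => ?_)
    simp only
    rw [hb, inner_sub_left, sub_eq_add_neg, ex_add, sub_zero]
    ring
  rw [h2, norm_mul, norm_ex, one_mul]
  exact h1

lemma integrable_decay (d : ℕ) : Integrable fun ξ : Config d => ((1 + ‖ξ‖) ^ (2 * d + 1))⁻¹ :=
  integrable_one_add_norm_pow_inv (by rw [finrank_config]; omega)

lemma integrable_stdInner (u : 𝓢(Config d, ℂ)) {a : Phase d → ℂ} {M : ℝ}
    (ha : ContDiff ℝ (2 * d + 1 : ℕ) a)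
    (hM : ∀ k ≤ 2 * d + 1, ∀ ρ, ‖iteratedFDeriv ℝ k a ρ‖ ≤ M) (x : Config d) :
    Integrable (stdInner a u x) := by
  obtain ⟨C, hC, h⟩ := exists_stdInner_decay u (2 * d + 1)
  have hM' : ∀ ρ, ‖a ρ‖ ≤ M := fun ρ => by simpa using hM 0 (Nat.zero_le _) ρ
  exact ((integrable_decay d).const_mul (C * M)).mono'
    ((continuous_stdInner ha.continuous hM' u.integrable).comp
      (Continuous.prodMk_right x)).aestronglyMeasurable
    (Filter.Eventually.of_forall fun ξ => h a M ha hM x ξ)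

lemma continuous_stdWeyl (u : 𝓢(Config d, ℂ)) {a : Phase d → ℂ} {M : ℝ}
    (ha : ContDiff ℝ (2 * d + 1 : ℕ) a)
    (hM : ∀ k ≤ 2 * d + 1, ∀ ρ, ‖iteratedFDeriv ℝ k a ρ‖ ≤ M) :
    Continuous (stdWeyl a u) := by
  obtain ⟨C, hC, h⟩ := exists_stdInner_decay u (2 * d + 1)
  have hM' : ∀ ρ, ‖a ρ‖ ≤ M := fun ρ => by simpa using hM 0 (Nat.zero_le _) ρ
  have hc := continuous_stdInner ha.continuous hM' u.integrable
  have h1 : ∀ x, AEStronglyMeasurable (stdInner a u x) volume := fun x =>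
    (integrable_stdInner u ha hM x).aestronglyMeasurable
  have h2 : ∀ ξ, Continuous fun x => stdInner a u x ξ := fun ξ =>
    hc.comp (g := fun p : Config d × Config d => stdInner a u p.1 p.2) (f := fun x => (x, ξ))
      (by fun_prop)
  have h3 : stdWeyl a u = fun x => ∫ ξ, stdInner a u x ξ := funext fun x => stdWeyl_eq a u x
  rw [h3]
  exact continuous_of_dominated h1 (fun x => Filter.Eventually.of_forall fun ξ => h a M ha hM x ξ)
    ((integrable_decay d).const_mul (C * M)) (Filter.Eventually.of_forall h2)

/-- With enough decay the triple integral may be iterated with `ξ` outermost. This form still makes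
sense when the cutoff in `ξ` is removed. -/
lemma integral_amplitude_eq (u v : 𝓢(Config d, ℂ)) {a : Phase d → ℂ} (ha : Continuous a) {M : ℝ}
    (hM : ∀ ρ, ‖a ρ‖ ≤ M) {b : Config d → ℝ} (hb : Integrable b)
    (hab : ∀ q ξ, ‖a (phasePt q ξ)‖ ≤ b ξ) :
    ∫ t, amplitude u v t * a (midPt t) = ∫ ξ, ∫ x, conj (v x) * stdInner a u x ξ := by
  have hint : Integrable fun t => amplitude u v t * a (midPt t) :=
    integrable_amplitude_mul u v (by fun_prop) hb fun t => hab _ _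
  refine (integral_prod_symm (μ := (volume : Measure (Config d × Config d)))
    (ν := (volume : Measure (Config d))) _ hint).trans ?_
  refine integral_congr_ae (Filter.Eventually.of_forall fun ξ => ?_)
  have huv : Integrable fun p : Config d × Config d => ‖v p.1‖ * ‖u p.2‖ :=
    Integrable.mul_prod v.integrable.norm u.integrable.norm
  have h1 : Integrable fun p : Config d × Config d =>
      amplitude u v (p, ξ) * a (midPt (p, ξ)) := by
    refine (huv.mul_const M).mono' ?_ (Filter.Eventually.of_forall fun p => ?_)
    · have := continuous_amplitude u v
      exact Continuous.aestronglyMeasurable (by fun_prop)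
    · rw [norm_mul, norm_amplitude]
      gcongr
      exact hM _
  refine (integral_prod (μ := (volume : Measure (Config d)))
    (ν := (volume : Measure (Config d))) _ h1).trans ?_
  refine integral_congr_ae (Filter.Eventually.of_forall fun x => ?_)
  simp only [stdInner, amplitude, midPt]
  rw [← integral_const_mul]
  refine integral_congr_ae (Filter.Eventually.of_forall fun y => ?_)
  simp only; ring

variable (d) in
/-- The momentum `ξ` of a point `(x, ξ)` of phase space. -/
def momL : Phase d →L[ℝ] Config d :=
  (ContinuousLinearMap.snd ℝ (Config d) (Config d)).comp
    ((phaseCoord d).symm : Phase d →L[ℝ] Config d × Config d)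

@[simp] lemma momL_phasePt (x ξ : Config d) : momL d (phasePt x ξ) = ξ := by
  change ((phaseCoord d).symm (phaseCoord d (x, ξ))).2 = ξ
  rw [ContinuousLinearEquiv.symm_apply_apply]

lemma norm_momL_le : ‖momL d‖ ≤ 1 := by
  refine ContinuousLinearMap.opNorm_le_bound _ zero_le_one fun ρ => ?_
  obtain ⟨x, ξ, rfl⟩ := exists_phasePt_eq ρ
  rw [momL_phasePt, one_mul]
  refine (sq_le_sq₀ (norm_nonneg _) (norm_nonneg _)).mp ?_
  rw [norm_sq_phasePt]
  nlinarith [sq_nonneg ‖x‖]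

/-- A Gaussian cutoff of a symbol in the momentum. -/
def cutoff (s : ℝ) (a : Phase d → ℂ) (ρ : Phase d) : ℂ :=
  a ρ * gaussSchwartz (Config d) 1 one_pos ((s • momL d) ρ + 0)

lemma cutoff_phasePt (s : ℝ) (a : Phase d → ℂ) (x ξ : Config d) :
    cutoff s a (phasePt x ξ) = a (phasePt x ξ) * (gauss 1 (s • ξ) : ℂ) := by
  simp [cutoff]

/-- For `|s| ≤ 1` the dilation in the cutoff does not increase derivatives, so the constant survives
the limit `s → 0`. -/
lemma exists_cutoff_bound (d n : ℕ) : ∃ C : ℝ, 0 ≤ C ∧ ∀ s : ℝ, |s| ≤ 1 →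
    ∀ (a : Phase d → ℂ) (M : ℝ), ContDiff ℝ n a →
      (∀ k ≤ n, ∀ ρ, ‖iteratedFDeriv ℝ k a ρ‖ ≤ M) →
      ContDiff ℝ n (cutoff s a) ∧ ∀ k ≤ n, ∀ ρ, ‖iteratedFDeriv ℝ k (cutoff s a) ρ‖ ≤ C * M := by
  obtain ⟨G, hG0, hG⟩ := exists_norm_iteratedFDeriv_schwartz_le
    (gaussSchwartz (Config d) 1 one_pos) n
  refine ⟨2 ^ n * G, by positivity, fun s hs a M ha hM => ?_⟩
  have hg := (gaussSchwartz (Config d) 1 one_pos).smooth n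
  have h1 := contDiff_comp_affine hg (s • momL d) 0
  refine ⟨ha.mul h1, fun k hk ρ => ?_⟩
  refine (norm_iteratedFDeriv_mul_le_of_le ha hM h1 (N := G) (fun k hk ρ => ?_) hk ρ).trans
    (le_of_eq (by ring))
  refine (norm_iteratedFDeriv_comp_affine_le hg hG _ _ hk ρ).trans ?_
  refine mul_le_of_le_one_right hG0 (pow_le_one₀ (norm_nonneg _) ?_)
  refine (ContinuousLinearMap.opNorm_smul_le _ _).trans ?_
  rw [Real.norm_eq_abs]
  exact mul_le_one₀ hs (norm_nonneg _) norm_momL_le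

lemma stdInner_cutoff (s : ℝ) (a : Phase d → ℂ) (u : Config d → ℂ) (x ξ : Config d) :
    stdInner (cutoff s a) u x ξ = (gauss 1 (s • ξ) : ℂ) * stdInner a u x ξ := by
  rw [stdInner, stdInner, ← integral_const_mul]
  refine integral_congr_ae (Filter.Eventually.of_forall fun y => ?_)
  simp only [cutoff_phasePt]
  ring

/-- **Calderón–Vaillancourt estimate** for the bilinear form of `stdWeyl a`. -/
lemma exists_norm_integral_stdWeyl_le (d : ℕ) :
    ∃ C : ℝ, 0 ≤ C ∧ ∀ (a : Phase d → ℂ) (M : ℝ), ContDiff ℝ (2 * d + 1 : ℕ) a →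
      (∀ k ≤ 2 * d + 1, ∀ ρ, ‖iteratedFDeriv ℝ k a ρ‖ ≤ M) →
      ∀ u v : 𝓢(Config d, ℂ),
        ‖∫ x, conj (v x) * stdWeyl a u x‖ ≤ C * M * ‖u.toLp 2‖ * ‖v.toLp 2‖ := by
  obtain ⟨C, hC, hcore⟩ := exists_norm_integral_amplitude_le d
  obtain ⟨K, hK, hcut⟩ := exists_cutoff_bound d (2 * d + 1)
  refine ⟨C * K, by positivity, fun a M ha hM u v => ?_⟩
  obtain ⟨D, hD, hdec⟩ := exists_stdInner_decay u (2 * d + 1)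
  have hM' : ∀ ρ, ‖a ρ‖ ≤ M := fun ρ => by simpa using hM 0 (Nat.zero_le _) ρ
  have hM0 : 0 ≤ M := (norm_nonneg _).trans (hM' 0)
  have hcI := continuous_stdInner ha.continuous hM' u.integrable
  have hv : Continuous fun x => conj (v x) := Complex.continuous_conj.comp v.continuous
  -- A majorant independent of `s`: the decay in `ξ` is already produced by the integration in `y`,
  -- and `v` gives integrability in `x`.
  set dom : Config d × Config d → ℝ := fun p =>
    (D * M * ((1 + ‖p.1‖) ^ (2 * d + 1))⁻¹) * ‖v p.2‖ with hdom
  have hdomi : Integrable dom :=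
    Integrable.mul_prod ((integrable_decay d).const_mul (D * M)) v.integrable.norm
  set F : ℝ → Config d × Config d → ℂ := fun s p =>
    conj (v p.2) * ((gauss 1 (s • p.1) : ℂ) * stdInner a u p.2 p.1) with hF
  have hFc : Continuous fun q : ℝ × (Config d × Config d) => F q.1 q.2 := by
    have h1 : Continuous fun q : ℝ × (Config d × Config d) => stdInner a u q.2.2 q.2.1 :=
      hcI.comp (g := fun p : Config d × Config d => stdInner a u p.1 p.2)
        (f := fun q : ℝ × (Config d × Config d) => (q.2.2, q.2.1)) (by fun_prop)
    have h2 : Continuous fun q : ℝ × (Config d × Config d) => conj (v q.2.2) :=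
      hv.comp (by fun_prop)
    exact h2.mul (Continuous.mul (by fun_prop) h1)
  have hFle : ∀ s p, ‖F s p‖ ≤ dom p := fun s p => by
    rw [hF, hdom]
    simp only
    rw [norm_mul, norm_mul, RCLike.norm_conj, Complex.norm_real, Real.norm_eq_abs,
      abs_of_pos (gauss_pos _ _), mul_comm]
    refine mul_le_mul_of_nonneg_right ?_ (norm_nonneg _)
    calc _ ≤ 1 * ‖stdInner a u p.2 p.1‖ := by gcongr; exact gauss_le_one zero_le_one _
      _ ≤ _ := by rw [one_mul]; exact hdec a M ha hM _ _
  have hFi : ∀ s, Integrable (F s) := fun s =>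
    hdomi.mono' (hFc.comp (Continuous.prodMk_right s)).aestronglyMeasurable
      (Filter.Eventually.of_forall (hFle s))
  have hpos : ∀ s : ℝ, 0 < s → s ≤ 1 → ‖∫ p, F s p‖ ≤ C * (K * M) * ‖u.toLp 2‖ * ‖v.toLp 2‖ := by
    intro s hs0 hs1
    obtain ⟨h1, h2⟩ := hcut s (by rwa [abs_of_pos hs0]) a M ha hM
    have hb : Integrable fun ξ : Config d => M * gauss 1 (s • ξ) :=
      ((integrable_gauss one_pos).comp_smul hs0.ne').const_mul M
    have hab : ∀ q ξ, ‖cutoff s a (phasePt q ξ)‖ ≤ M * gauss 1 (s • ξ) := fun q ξ => by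
      rw [cutoff_phasePt, norm_mul, Complex.norm_real, Real.norm_eq_abs,
        abs_of_pos (gauss_pos _ _)]
      gcongr
      · exact (gauss_pos _ _).le
      · exact hM' _
    have h3 := hcore (cutoff s a) (K * M) h1 h2 _ hb hab u v
    rw [integral_amplitude_eq u v h1.continuous
      (fun ρ => by simpa using h2 0 (Nat.zero_le _) ρ) hb hab] at h3
    have h4 := integral_prod (μ := (volume : Measure (Config d)))
      (ν := (volume : Measure (Config d))) _ (hFi s)
    have h5 : ∫ p, F s p = ∫ ξ, ∫ x, conj (v x) * stdInner (cutoff s a) u x ξ := by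
      refine h4.trans ?_
      simp only [hF, stdInner_cutoff]
    rw [h5]
    exact h3
  -- Along `s = 1 / (n + 1)` the cutoff tends to one pointwise, and at `s = 0` it equals one, so the
  -- estimate passes to the form without cutoff.
  have hlim : Filter.Tendsto (fun n : ℕ => ∫ p, F (1 / ((n : ℝ) + 1)) p) Filter.atTop
      (nhds (∫ p, F 0 p)) := by
    refine tendsto_integral_of_dominated_convergence dom
      (fun n => (hFi _).aestronglyMeasurable) hdomi
      (fun n => Filter.Eventually.of_forall (hFle _)) (Filter.Eventually.of_forall fun p => ?_)
    exact ((hFc.comp (Continuous.prodMk_left p)).tendsto 0).comp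
      tendsto_one_div_add_atTop_nhds_zero_nat
  have h0 : ∫ p, F 0 p = ∫ x, conj (v x) * stdWeyl a u x := by
    refine (integral_prod_symm (μ := (volume : Measure (Config d)))
      (ν := (volume : Measure (Config d))) _ (hFi 0)).trans ?_
    refine integral_congr_ae (Filter.Eventually.of_forall fun x => ?_)
    simp only [hF]
    rw [integral_const_mul, stdWeyl_eq]
    simp [gauss]
  rw [← h0]
  refine le_of_tendsto hlim.norm (Filter.Eventually.of_forall fun n => ?_)
  refine (hpos _ (by positivity) ?_).trans (le_of_eq (by ring))
  rw [div_le_one (by positivity)]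
  linarith [(Nat.cast_nonneg n : (0 : ℝ) ≤ n)]

end WeylBound

/-! ### From bounded bilinear forms to bounded operators on `L²`; dilations. -/

section Duality

variable {V : Type*} [NormedAddCommGroup V] [InnerProductSpace ℝ V] [FiniteDimensional ℝ V]
  [MeasurableSpace V] [BorelSpace V]

/-- A bounded continuous function which pairs boundedly with Schwartz functions, with respect to the
`L²` norm, is in `L²`. -/
lemma exists_Lp_ae_eq {w : V → ℂ} (hw : Continuous w) {B : ℝ} (hB : ∀ x, ‖w x‖ ≤ B) {K : ℝ}
    (hK : 0 ≤ K) (h : ∀ v : 𝓢(V, ℂ), ‖∫ x, conj (v x) * w x‖ ≤ K * ‖v.toLp 2‖) :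
    ∃ f : Lp ℂ 2 (volume : Measure V), f =ᵐ[volume] w ∧ ‖f‖ ≤ K := by
  have hcw : Continuous fun x => conj (w x) := Complex.continuous_conj.comp hw
  have hint : ∀ v : 𝓢(V, ℂ), Integrable fun x => conj (w x) * v x := fun v => by
    refine (v.integrable.norm.const_mul B).mono' (hcw.mul v.continuous).aestronglyMeasurable
      (Filter.Eventually.of_forall fun x => ?_)
    rw [norm_mul, RCLike.norm_conj]
    gcongr
    exact hB x
  let ℓ : 𝓢(V, ℂ) →ₗ[ℂ] ℂ :=
    { toFun := fun v => ∫ x, conj (w x) * v x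
      map_add' := fun v v' => by
        rw [← integral_add (hint v) (hint v')]
        simp [mul_add]
      map_smul' := fun c v => by
        simp only [smul_apply, smul_eq_mul, RingHom.id_apply]
        rw [← integral_const_mul]
        refine integral_congr_ae (Filter.Eventually.of_forall fun x => ?_)
        simp only; ring }
  have hℓ : ∀ v, ‖ℓ v‖ ≤ K * ‖SchwartzMap.toLpCLM ℂ ℂ 2 volume v‖ := fun v => by
    have h1 : ℓ v = conj (∫ x, conj (v x) * w x) := by
      rw [← integral_conj]
      refine integral_congr_ae (Filter.Eventually.of_forall fun x => ?_)
      simp [mul_comm]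
    rw [h1, RCLike.norm_conj]
    exact h v
  have hdense : DenseRange (SchwartzMap.toLpCLM ℂ ℂ 2 (volume : Measure V)) :=
    SchwartzMap.denseRange_toLpCLM (by norm_num)
  let e : 𝓢(V, ℂ) →ₗ[ℂ] Lp ℂ 2 (volume : Measure V) :=
    (SchwartzMap.toLpCLM ℂ ℂ 2 (volume : Measure V)).toLinearMap
  let L : Lp ℂ 2 (volume : Measure V) →L[ℂ] ℂ := ℓ.extendOfNorm e
  have hL : ∀ v, L (v.toLp 2) = ℓ v := fun v =>
    LinearMap.extendOfNorm_eq (e := e) hdense ⟨K, hℓ⟩ v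
  have hLn : ‖L‖ ≤ K := LinearMap.opNorm_extendOfNorm_le (e := e) hdense hK hℓ
  -- The extended functional is represented by Riesz; testing against smooth compactly supported
  -- functions identifies its representative with `w` almost everywhere.
  refine ⟨(InnerProductSpace.toDual ℂ _).symm L, ?_, by simpa using hLn⟩
  set f := (InnerProductSpace.toDual ℂ (Lp ℂ 2 (volume : Measure V))).symm L with hf
  have hfl : LocallyIntegrable (fun x => conj (f x)) (volume : Measure V) := by
    have h1 : MemLp (fun x => conj (f x)) 2 (volume : Measure V) := (Lp.memLp f).star
    exact h1.locallyIntegrable (by norm_num)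
  have hae : ∀ᵐ x, conj (f x) = conj (w x) := by
    refine ae_eq_of_integral_contDiff_smul_eq hfl hcw.locallyIntegrable fun g hg hgc => ?_
    have hg' : ContDiff ℝ ∞ fun x => (g x : ℂ) := Complex.ofRealCLM.contDiff.comp hg
    have hgc' : HasCompactSupport fun x => (g x : ℂ) :=
      hgc.comp_left (g := fun t : ℝ => (t : ℂ)) (by simp)
    have h1 := hL (hgc'.toSchwartzMap hg')
    rw [← InnerProductSpace.toDual_symm_apply (𝕜 := ℂ), ← hf, L2.inner_def] at h1
    have h2 : ∀ x, (hgc'.toSchwartzMap hg') x = (g x : ℂ) := fun x => rfl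
    calc ∫ x, g x • conj (f x) =
        ∫ x, inner ℂ (f x) ((hgc'.toSchwartzMap hg').toLp 2 volume x) := by
          refine integral_congr_ae ?_
          filter_upwards [(hgc'.toSchwartzMap hg').coeFn_toLp 2 volume] with x hx
          rw [hx, h2, RCLike.inner_apply, Complex.real_smul]
      _ = ℓ (hgc'.toSchwartzMap hg') := h1
      _ = _ := by
          refine integral_congr_ae (Filter.Eventually.of_forall fun x => ?_)
          simp only [h2, Complex.real_smul]
          ring
  filter_upwards [hae] with x hx
  exact (starRingEnd ℂ).injective hx

/-- A family of functions which depends linearly on a Schwartz function `u`, with an `L²` bound,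
extends to a bounded operator on `L²`. -/
lemma exists_clm_of_forall_ae_eq {W : 𝓢(V, ℂ) → V → ℂ}
    (hadd : ∀ u v x, W (u + v) x = W u x + W v x) (hsmul : ∀ (c : ℂ) u x, W (c • u) x = c * W u x)
    {K : ℝ} (hK : 0 ≤ K)
    (h : ∀ u : 𝓢(V, ℂ), ∃ f : Lp ℂ 2 (volume : Measure V), f =ᵐ[volume] W u ∧
      ‖f‖ ≤ K * ‖u.toLp 2‖) :
    ∃ T : Lp ℂ 2 (volume : Measure V) →L[ℂ] Lp ℂ 2 (volume : Measure V),
      (∀ u : 𝓢(V, ℂ), T (u.toLp 2) =ᵐ[volume] W u) ∧ ‖T‖ ≤ K := by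
  -- Although `F u` is picked arbitrarily, it is determined as an element of `L²` by its almost
  -- everywhere values, so it depends linearly on `u`.
  choose F hF hFn using h
  let ℓ : 𝓢(V, ℂ) →ₗ[ℂ] Lp ℂ 2 (volume : Measure V) :=
    { toFun := F
      map_add' := fun u v => by
        refine Lp.ext ?_
        filter_upwards [hF (u + v), hF u, hF v, Lp.coeFn_add (F u) (F v)] with x h1 h2 h3 h4
        rw [h1, h4, Pi.add_apply, h2, h3, hadd]
      map_smul' := fun c u => by
        refine Lp.ext ?_
        filter_upwards [hF (c • u), hF u, Lp.coeFn_smul c (F u)] with x h1 h2 h3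
        rw [h1, RingHom.id_apply, h3, Pi.smul_apply, h2, hsmul, smul_eq_mul] }
  have hdense : DenseRange (SchwartzMap.toLpCLM ℂ ℂ 2 (volume : Measure V)) :=
    SchwartzMap.denseRange_toLpCLM (by norm_num)
  let e : 𝓢(V, ℂ) →ₗ[ℂ] Lp ℂ 2 (volume : Measure V) :=
    (SchwartzMap.toLpCLM ℂ ℂ 2 (volume : Measure V)).toLinearMap
  refine ⟨ℓ.extendOfNorm e, fun u => ?_, LinearMap.opNorm_extendOfNorm_le (e := e) hdense hK hFn⟩
  have h1 : ℓ.extendOfNorm e (u.toLp 2) = F u :=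
    LinearMap.extendOfNorm_eq (e := e) hdense ⟨K, hFn⟩ u
  rw [h1]
  exact hF u

/-- Dilation of Schwartz functions. -/
def dilate (s : ℝ) (hs : s ≠ 0) (u : 𝓢(V, ℂ)) : 𝓢(V, ℂ) :=
  SchwartzMap.compCLMOfContinuousLinearEquiv ℝ
    (LinearEquiv.smulOfNeZero ℝ V s hs).toContinuousLinearEquiv u

@[simp] lemma dilate_apply (s : ℝ) (hs : s ≠ 0) (u : 𝓢(V, ℂ)) (x : V) :
    dilate s hs u x = u (s • x) := rfl

lemma norm_toLp_sq (u : 𝓢(V, ℂ)) : ‖u.toLp 2‖ ^ 2 = ∫ x, ‖u x‖ ^ 2 := by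
  have h := lintegral_enorm_sq_schwartz u
  have hint : Integrable fun x => ‖u x‖ ^ 2 :=
    (memLp_two_iff_integrable_sq_norm (u.continuous.aestronglyMeasurable)).mp (u.memLp 2)
  simp_rw [enorm_sq_eq_ofReal] at h
  rw [← ofReal_integral_eq_lintegral_ofReal hint
      (Filter.Eventually.of_forall fun x => by positivity), ← ofReal_norm,
    ← ENNReal.ofReal_pow (norm_nonneg _)] at h
  exact ((ENNReal.ofReal_eq_ofReal_iff (integral_nonneg fun x => by positivity)
    (by positivity)).mp h).symm

lemma norm_toLp_dilate_sq (s : ℝ) (hs : 0 < s) (u : 𝓢(V, ℂ)) :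
    ‖(dilate s hs.ne' u).toLp 2‖ ^ 2 = (s ^ Module.finrank ℝ V)⁻¹ * ‖u.toLp 2‖ ^ 2 := by
  rw [norm_toLp_sq, norm_toLp_sq]
  simp_rw [dilate_apply]
  rw [Measure.integral_comp_smul volume (fun x => ‖u x‖ ^ 2) s, abs_of_pos (by positivity),
    smul_eq_mul]

end Duality

/-! ### Reduction of the semiclassical quantization to `ħ = (2π)⁻¹`. -/

section Scaling

variable {d : ℕ}

/-- The inner integral of the Weyl quantization. -/
def weylInner (h : ℝ) (a : Phase d → ℂ) (u : Config d → ℂ) (x ξ : Config d) : ℂ :=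
  ∫ y, weylIntegrand h a u x ξ y

lemma weylApply_def (h : ℝ) (a : Phase d → ℂ) (u : Config d → ℂ) (x : Config d) :
    weylApply h a u x = (((2 * π * h) ^ d : ℝ) : ℂ)⁻¹ * ∫ ξ, weylInner h a u x ξ := rfl

/-- The length scale `√(2πħ)`. -/
def scale (h : ℝ) : ℝ := √(2 * π * h)

lemma scale_pos {h : ℝ} (hh : 0 < h) : 0 < scale h := Real.sqrt_pos.mpr (by positivity)

lemma scale_sq {h : ℝ} (hh : 0 < h) : scale h * scale h = 2 * π * h :=
  Real.mul_self_sqrt (by positivity)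

/-- Positions and momenta are both dilated by `scale h`, whose square is `2 * π * h`; the phase `⟨x
- y, ξ⟩ / h` becomes the standard `2π⟨x - y, ξ⟩`. -/
lemma weylIntegrand_smul {h : ℝ} (hh : 0 < h) (a : Phase d → ℂ) (u : Config d → ℂ)
    (x ξ y : Config d) :
    weylIntegrand h a u (scale h • x) (scale h • ξ) (scale h • y) =
      ex (inner ℝ (x - y) ξ) * a (scale h • phasePt ((1 / 2 : ℝ) • (x + y)) ξ) *
        u (scale h • y) := by
  have h1 : inner ℝ (scale h • x - scale h • y) (scale h • ξ) / h = 2 * π * inner ℝ (x - y) ξ := by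
    rw [← smul_sub, real_inner_smul_left, real_inner_smul_right, ← mul_assoc, scale_sq hh]
    field_simp
  rw [weylIntegrand, h1, ex, mul_comm Complex.I, smul_phasePt, ← smul_add, smul_comm (1 / 2 : ℝ)]

lemma weylInner_smul {h : ℝ} (hh : 0 < h) (a : Phase d → ℂ) (u : Config d → ℂ) (x ξ : Config d) :
    weylInner h a u (scale h • x) (scale h • ξ) =
      (scale h ^ d : ℝ) *
        stdInner (fun ρ => a (scale h • ρ)) (fun y => u (scale h • y)) x ξ := by
  have hs := scale_pos hh
  have h1 := Measure.integral_comp_smul volume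
    (fun y => weylIntegrand h a u (scale h • x) (scale h • ξ) y) (scale h)
  simp_rw [weylIntegrand_smul hh] at h1
  rw [stdInner, h1, abs_of_pos (by positivity), finrank_config, Complex.real_smul, weylInner,
    ← mul_assoc, ← Complex.ofReal_mul, mul_inv_cancel₀ (by positivity)]
  simp

lemma weylApply_smul {h : ℝ} (hh : 0 < h) (a : Phase d → ℂ) (u : Config d → ℂ) (x : Config d) :
    weylApply h a u (scale h • x) =
      stdWeyl (fun ρ => a (scale h • ρ)) (fun y => u (scale h • y)) x := by
  have hs := scale_pos hh
  have h1 := Measure.integral_comp_smul volume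
    (fun ξ => weylInner h a u (scale h • x) ξ) (scale h)
  simp_rw [weylInner_smul hh] at h1
  rw [integral_const_mul, abs_of_pos (by positivity), finrank_config, Complex.real_smul] at h1
  rw [weylApply_def, stdWeyl_eq, ← scale_sq hh, mul_pow]
  have h3 : ((scale h ^ d : ℝ) : ℂ) ≠ 0 := by
    exact_mod_cast (pow_pos hs d).ne'
  rw [Complex.ofReal_inv, eq_inv_mul_iff_mul_eq₀ h3] at h1
  rw [← h1, Complex.ofReal_mul]
  field_simp

lemma weylApply_eq {h : ℝ} (hh : 0 < h) (a : Phase d → ℂ) (u : Config d → ℂ) (x : Config d) :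
    weylApply h a u x =
      stdWeyl (fun ρ => a (scale h • ρ)) (fun y => u (scale h • y)) ((scale h)⁻¹ • x) := by
  rw [← weylApply_smul hh, smul_inv_smul₀ (scale_pos hh).ne']

lemma contDiff_comp_smul {a : Phase d → ℂ} {n : WithTop ℕ∞} (ha : ContDiff ℝ n a) (s : ℝ) :
    ContDiff ℝ n fun ρ => a (s • ρ) := ha.comp (contDiff_const_smul s)

lemma norm_iteratedFDeriv_comp_smul_le {a : Phase d → ℂ} {n : ℕ} {M : ℝ} (ha : ContDiff ℝ n a)
    (hM : ∀ k ≤ n, ∀ ρ, ‖iteratedFDeriv ℝ k a ρ‖ ≤ M) {s R : ℝ} (hs : |s| ≤ R) (hR : 1 ≤ R)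
    {k : ℕ} (hk : k ≤ n) (ρ : Phase d) :
    ‖iteratedFDeriv ℝ k (fun ρ => a (s • ρ)) ρ‖ ≤ M * R ^ n := by
  have hM0 : 0 ≤ M := (norm_nonneg _).trans (hM 0 (Nat.zero_le _) 0)
  have h1 := norm_iteratedFDeriv_comp_affine_le ha hM
    (s • ContinuousLinearMap.id ℝ (Phase d)) 0 hk ρ
  simp only [smul_apply, ContinuousLinearMap.id_apply, add_zero] at h1
  refine h1.trans ?_
  gcongr
  have h2 : ‖s • ContinuousLinearMap.id ℝ (Phase d)‖ ≤ R := by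
    refine (ContinuousLinearMap.opNorm_smul_le _ _).trans ?_
    rw [Real.norm_eq_abs]
    exact (mul_le_of_le_one_right (abs_nonneg _) ContinuousLinearMap.norm_id_le).trans hs
  exact (pow_le_pow_left₀ (norm_nonneg _) h2 k).trans (pow_le_pow_right₀ hR hk)

lemma integrable_weylIntegrand {h : ℝ} {a : Phase d → ℂ} (ha : Continuous a) {M : ℝ}
    (hM : ∀ ρ, ‖a ρ‖ ≤ M) {u : Config d → ℂ} (hu : Integrable u) (x ξ : Config d) :
    Integrable fun y => weylIntegrand h a u x ξ y := by
  unfold weylIntegrand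
  refine (hu.norm.const_mul M).mono' ((Continuous.aestronglyMeasurable (by fun_prop)).mul
    hu.aestronglyMeasurable) (Filter.Eventually.of_forall fun y => ?_)
  rw [norm_mul, norm_mul, mul_comm Complex.I, Complex.norm_exp_ofReal_mul_I, one_mul]
  gcongr
  exact hM _

/-- **Calderón–Vaillancourt theorem** for the Weyl quantization. -/
theorem exists_isWeylOp (d : ℕ) :
    ∃ C : ℝ, 0 ≤ C ∧ ∀ h ∈ Set.Ioc (0 : ℝ) 1, ∀ (a : Phase d → ℂ) (M : ℝ),
      ContDiff ℝ (2 * d + 1 : ℕ) a →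
      (∀ k ≤ 2 * d + 1, ∀ ρ, ‖iteratedFDeriv ℝ k a ρ‖ ≤ M) →
      ∃ T, IsWeylOp h a T ∧ ‖T‖ ≤ C * M := by
  obtain ⟨C, hC, hCV⟩ := exists_norm_integral_stdWeyl_le d
  -- For `h ≤ 1` the dilation factor is at most `2 * π`, and `2 * π ≥ 1`, so rescaling costs at most
  -- this power for all derivatives of order at most `2 * d + 1`.
  refine ⟨C * (2 * π) ^ (2 * d + 1), by positivity, fun h hh a M ha hM => ?_⟩
  have hh0 : 0 < h := hh.1
  set s := scale h with hs
  have hs0 : 0 < s := scale_pos hh0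
  have hM' : ∀ ρ, ‖a ρ‖ ≤ M := fun ρ => by simpa using hM 0 (Nat.zero_le _) ρ
  have hM0 : 0 ≤ M := (norm_nonneg _).trans (hM' 0)
  have hpi : 1 ≤ 2 * π := by linarith [pi_gt_three]
  have hsle : |s| ≤ 2 * π := by
    rw [abs_of_pos hs0, hs, scale, Real.sqrt_le_left (by positivity)]
    nlinarith [hh.2, pi_pos]
  set a' : Phase d → ℂ := fun ρ => a (s • ρ) with ha'
  have ha'c : ContDiff ℝ (2 * d + 1 : ℕ) a' := contDiff_comp_smul ha s
  have ha'M : ∀ k ≤ 2 * d + 1, ∀ ρ, ‖iteratedFDeriv ℝ k a' ρ‖ ≤ M * (2 * π) ^ (2 * d + 1) :=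
    fun k hk ρ => norm_iteratedFDeriv_comp_smul_le ha hM hsle hpi hk ρ
  have hInner : ∀ (u : 𝓢(Config d, ℂ)) x ξ, weylInner h a u x ξ =
      (s ^ d : ℝ) * stdInner a' (dilate s hs0.ne' u) (s⁻¹ • x) (s⁻¹ • ξ) := fun u x ξ => by
    have := weylInner_smul hh0 a u (s⁻¹ • x) (s⁻¹ • ξ)
    rw [smul_inv_smul₀ hs0.ne', smul_inv_smul₀ hs0.ne'] at this
    exact this
  have hI1 : ∀ (u : 𝓢(Config d, ℂ)) x ξ, Integrable fun y => weylIntegrand h a u x ξ y :=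
    fun u x ξ => integrable_weylIntegrand ha.continuous hM' u.integrable x ξ
  have hI2 : ∀ (u : 𝓢(Config d, ℂ)) x, Integrable fun ξ => weylInner h a u x ξ := fun u x => by
    simp_rw [hInner]
    exact ((integrable_stdInner (dilate s hs0.ne' u) ha'c ha'M _).comp_smul
      (inv_ne_zero hs0.ne')).const_mul _
  have hW : ∀ (u : 𝓢(Config d, ℂ)) x, weylApply h a u x =
      stdWeyl a' (dilate s hs0.ne' u) (s⁻¹ • x) := fun u x => weylApply_eq hh0 a u x
  have hbdd : ∀ u : 𝓢(Config d, ℂ), ∃ B, ∀ x, ‖weylApply h a u x‖ ≤ B := fun u => by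
    obtain ⟨D, hD, hdec⟩ := exists_stdInner_decay (dilate s hs0.ne' u) (2 * d + 1)
    refine ⟨∫ ξ : Config d, D * (M * (2 * π) ^ (2 * d + 1)) * ((1 + ‖ξ‖) ^ (2 * d + 1))⁻¹,
      fun x => ?_⟩
    rw [hW, stdWeyl_eq]
    exact norm_integral_le_of_norm_le ((integrable_decay d).const_mul _)
      (Filter.Eventually.of_forall fun ξ => hdec a' _ ha'c ha'M _ ξ)
  have hcont : ∀ u : 𝓢(Config d, ℂ), Continuous (weylApply h a u) := fun u => by
    have h1 : weylApply h a u = fun x => stdWeyl a' (dilate s hs0.ne' u) (s⁻¹ • x) :=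
      funext (hW u)
    rw [h1]
    exact (continuous_stdWeyl (dilate s hs0.ne' u) ha'c ha'M).comp (continuous_const_smul _)
  have hform : ∀ u v : 𝓢(Config d, ℂ), ‖∫ x, conj (v x) * weylApply h a u x‖ ≤
      C * (2 * π) ^ (2 * d + 1) * M * ‖u.toLp 2‖ * ‖v.toLp 2‖ := fun u v => by
    have h1 := hCV a' _ ha'c ha'M (dilate s hs0.ne' u) (dilate s hs0.ne' v)
    have h2 := Measure.integral_comp_smul volume (fun x => conj (v x) * weylApply h a u x) s
    have h3 : ∫ x, conj (dilate s hs0.ne' v x) * stdWeyl a' (dilate s hs0.ne' u) x =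
        ∫ x, conj (v (s • x)) * weylApply h a u (s • x) := by
      refine integral_congr_ae (Filter.Eventually.of_forall fun x => ?_)
      simp only [dilate_apply]
      rw [hW, inv_smul_smul₀ hs0.ne']
    rw [h3, h2, norm_smul, Real.norm_eq_abs, abs_abs, abs_of_pos (by positivity)] at h1
    have hd : ∀ w : 𝓢(Config d, ℂ), ‖(dilate s hs0.ne' w).toLp 2‖ =
        √((s ^ d)⁻¹) * ‖w.toLp 2‖ := fun w => by
      have := norm_toLp_dilate_sq s hs0 w
      rw [finrank_config] at this
      rw [← Real.sqrt_sq (norm_nonneg ((dilate s hs0.ne' w).toLp 2 volume)), this,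
        Real.sqrt_mul (by positivity), Real.sqrt_sq (norm_nonneg _)]
    rw [hd, hd, finrank_config] at h1
    -- The norms of the two dilated functions together produce exactly the Jacobian of the pairing,
    -- which then cancels.
    have h4 : √((s ^ d)⁻¹) * √((s ^ d)⁻¹) = (s ^ d)⁻¹ := Real.mul_self_sqrt (by positivity)
    have h5 : 0 < (s ^ d)⁻¹ := by positivity
    refine le_of_mul_le_mul_left (h1.trans (le_of_eq ?_)) h5
    linear_combination (C * (M * (2 * π) ^ (2 * d + 1)) * ‖u.toLp 2‖ * ‖v.toLp 2‖) * h4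
  obtain ⟨T, hT, hTn⟩ := exists_clm_of_forall_ae_eq (W := fun u => weylApply h a u)
    (K := C * (2 * π) ^ (2 * d + 1) * M) (fun u v x => by
      have h1 : ∀ ξ, weylInner h a (u + v : 𝓢(Config d, ℂ)) x ξ =
          weylInner h a u x ξ + weylInner h a v x ξ := fun ξ => by
        rw [weylInner, weylInner, weylInner, ← integral_add (hI1 u x ξ) (hI1 v x ξ)]
        refine integral_congr_ae (Filter.Eventually.of_forall fun y => ?_)
        simp only [weylIntegrand, add_apply]
        ring
      rw [weylApply_def, weylApply_def, weylApply_def]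
      simp_rw [h1]
      rw [integral_add (hI2 u x) (hI2 v x), mul_add])
    (fun c u x => by
      have h1 : ∀ ξ, weylInner h a (c • u : 𝓢(Config d, ℂ)) x ξ = c * weylInner h a u x ξ :=
        fun ξ => by
          rw [weylInner, weylInner, ← integral_const_mul]
          refine integral_congr_ae (Filter.Eventually.of_forall fun y => ?_)
          simp only [weylIntegrand, smul_apply, smul_eq_mul]
          ring
      rw [weylApply_def, weylApply_def]
      simp_rw [h1]
      rw [integral_const_mul, mul_left_comm]) (by positivity) (fun u => by
      obtain ⟨B, hB⟩ := hbdd u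
      exact exists_Lp_ae_eq (hcont u) hB (by positivity) (hform u))
  exact ⟨T, fun u => ⟨hI1 u, hI2 u, hT u⟩, hTn⟩

end Scaling

lemma isWeylOp_sub {d : ℕ} {h : ℝ} {a b : Phase d → ℂ}
    {T S : Lp ℂ 2 (volume : Measure (Config d)) →L[ℂ] Lp ℂ 2 (volume : Measure (Config d))}
    (hT : IsWeylOp h a T) (hS : IsWeylOp h b S) : IsWeylOp h (fun ρ => a ρ - b ρ) (T - S) := by
  intro u
  obtain ⟨a1, a2, a3⟩ := hT u
  obtain ⟨b1, b2, b3⟩ := hS u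
  have e1 : ∀ x ξ y, weylIntegrand h (fun ρ => a ρ - b ρ) u x ξ y =
      weylIntegrand h a u x ξ y - weylIntegrand h b u x ξ y := fun x ξ y => by
    simp only [weylIntegrand]; ring
  have e2 : ∀ x ξ, weylInner h (fun ρ => a ρ - b ρ) u x ξ =
      weylInner h a u x ξ - weylInner h b u x ξ := fun x ξ => by
    simp only [weylInner, e1]
    exact integral_sub (a1 x ξ) (b1 x ξ)
  have a2' : ∀ x, Integrable fun ξ => weylInner h a u x ξ := a2
  have b2' : ∀ x, Integrable fun ξ => weylInner h b u x ξ := b2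
  refine ⟨fun x ξ => ?_, fun x => ?_, ?_⟩
  · simp_rw [e1]
    exact (a1 x ξ).sub (b1 x ξ)
  · change Integrable fun ξ => weylInner h (fun ρ => a ρ - b ρ) u x ξ
    simp_rw [e2]
    exact (a2' x).sub (b2' x)
  · rw [sub_apply]
    filter_upwards [a3, b3, Lp.coeFn_sub (T (u.toLp 2)) (S (u.toLp 2))] with x h1 h2 h3
    rw [h3, Pi.sub_apply, h1, h2, weylApply_def, weylApply_def, weylApply_def]
    simp_rw [e2]
    rw [integral_sub (a2' x) (b2' x), mul_sub]

/-! ### The error made when a symbol is averaged by a kernel. -/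

section Smoothing

variable {E : Type} [NormedAddCommGroup E] [InnerProductSpace ℝ E] [FiniteDimensional ℝ E]
  [MeasurableSpace E] [BorelSpace E]

/-- The error `∫ K(t) (f(x) - f(x - t)) dt` of the smoothing of `f` by the kernel `K`. -/
def smoothErr {F : Type} [NormedAddCommGroup F] [NormedSpace ℝ F] (K : E → ℝ) (f : E → F) (x : E) :
    F :=
  ∫ t, K t • (f x - f (x - t))

variable {F : Type} [NormedAddCommGroup F] [NormedSpace ℝ F]

/-- The mean value inequality gives `‖f x - f (x - t)‖ ≤ M ‖t‖`; this is where one derivative is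
exchanged for the first moment of `K`. -/
lemma norm_smoothErr_le {K : E → ℝ} (hK : Integrable fun t => |K t| * ‖t‖) {f : E → F} {M : ℝ}
    (hf : Differentiable ℝ f) (hM : ∀ x, ‖fderiv ℝ f x‖ ≤ M) (x : E) :
    ‖smoothErr K f x‖ ≤ M * ∫ t, |K t| * ‖t‖ := by
  rw [← integral_const_mul]
  refine norm_integral_le_of_norm_le (hK.const_mul M) (Filter.Eventually.of_forall fun t => ?_)
  rw [norm_smul, Real.norm_eq_abs]
  have h := Convex.norm_image_sub_le_of_norm_fderiv_le (𝕜 := ℝ) (f := f) (s := Set.univ)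
    (fun y _ => hf y) (fun y _ => hM y) convex_univ (Set.mem_univ (x - t)) (Set.mem_univ x)
  rw [sub_sub_cancel] at h
  calc |K t| * ‖f x - f (x - t)‖ ≤ |K t| * (M * ‖t‖) := by gcongr
    _ = _ := by ring

/-- Differentiation under the integral sign: the derivative of the error is again an error, that of
`fderiv ℝ f`, which makes induction on the order possible. -/
lemma hasFDerivAt_smoothErr {K : E → ℝ} (hK : Integrable K) {f : E → F} {M : ℝ}
    (hf : ContDiff ℝ 1 f) (hM0 : ∀ x, ‖f x‖ ≤ M) (hM : ∀ x, ‖fderiv ℝ f x‖ ≤ M) (x : E) :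
    HasFDerivAt (smoothErr K f) (smoothErr K (fderiv ℝ f) x) x := by
  have hfc : Continuous f := hf.continuous
  have hfd : Continuous (fderiv ℝ f) := hf.continuous_fderiv one_ne_zero
  have hm : ∀ x, AEStronglyMeasurable (fun t => K t • (f x - f (x - t))) volume := fun x =>
    hK.aestronglyMeasurable.smul (Continuous.aestronglyMeasurable (by fun_prop))
  change HasFDerivAt (fun x => ∫ t, K t • (f x - f (x - t)))
    (∫ t, K t • (fderiv ℝ f x - fderiv ℝ f (x - t))) x
  refine hasFDerivAt_integral_of_dominated_of_fderiv_le (𝕜 := ℝ) (s := Set.univ)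
    (F' := fun x t => K t • (fderiv ℝ f x - fderiv ℝ f (x - t)))
    (bound := fun t => |K t| * (M + M)) Filter.univ_mem
    (Filter.Eventually.of_forall hm) ?_ ?_ ?_ ?_ ?_
  · refine (hK.norm.mul_const (M + M)).mono' (hm x) (Filter.Eventually.of_forall fun t => ?_)
    rw [norm_smul]
    gcongr
    exact (norm_sub_le _ _).trans (add_le_add (hM0 _) (hM0 _))
  · exact hK.aestronglyMeasurable.smul (Continuous.aestronglyMeasurable (by fun_prop))
  · refine Filter.Eventually.of_forall fun t y _ => ?_
    rw [norm_smul, Real.norm_eq_abs]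
    gcongr
    exact (norm_sub_le _ _).trans (add_le_add (hM _) (hM _))
  · exact hK.norm.mul_const (M + M)
  · refine Filter.Eventually.of_forall fun t y _ => ?_
    have h1 : HasFDerivAt f (fderiv ℝ f y) y := (hf.differentiable one_ne_zero y).hasFDerivAt
    have h2 : HasFDerivAt (fun y => f (y - t)) (fderiv ℝ f (y - t)) y := by
      have := (hf.differentiable one_ne_zero (y - t)).hasFDerivAt
      simpa [Function.comp_def] using this.comp y ((hasFDerivAt_id y).sub_const t)
    exact (h1.sub h2).const_smul (K t)

/-- The smoothing error is small, with its derivatives, when `K` has a small first moment. -/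
lemma contDiff_smoothErr {K : E → ℝ} (hK : Integrable K) (hK1 : Integrable fun t => |K t| * ‖t‖)
    {M : ℝ} (n : ℕ) : ∀ {F : Type} [NormedAddCommGroup F] [NormedSpace ℝ F] {f : E → F},
      ContDiff ℝ (n + 1 : ℕ) f → (∀ k ≤ n + 1, ∀ x, ‖iteratedFDeriv ℝ k f x‖ ≤ M) →
      ContDiff ℝ n (smoothErr K f) ∧
        ∀ k ≤ n, ∀ x, ‖iteratedFDeriv ℝ k (smoothErr K f) x‖ ≤ M * ∫ t, |K t| * ‖t‖ := by
  have main : ∀ {F : Type} [NormedAddCommGroup F] [NormedSpace ℝ F] {f : E → F} {n : ℕ},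
      ContDiff ℝ (n + 1 : ℕ) f → (∀ k ≤ n + 1, ∀ x, ‖iteratedFDeriv ℝ k f x‖ ≤ M) →
      (∀ x, HasFDerivAt (smoothErr K f) (smoothErr K (fderiv ℝ f) x) x) ∧
        ∀ x, ‖smoothErr K f x‖ ≤ M * ∫ t, |K t| * ‖t‖ := by
    intro F _ _ f n hf hM
    have hf1 : ContDiff ℝ 1 f := hf.of_le (by exact_mod_cast Nat.le_add_left 1 n)
    have h0 : ∀ x, ‖f x‖ ≤ M := fun x => by simpa using hM 0 (Nat.zero_le _) x
    have h1 : ∀ x, ‖fderiv ℝ f x‖ ≤ M := fun x => by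
      rw [← norm_iteratedFDeriv_zero (𝕜 := ℝ) (f := fderiv ℝ f), norm_iteratedFDeriv_fderiv]
      exact hM 1 (by omega) x
    exact ⟨fun x => hasFDerivAt_smoothErr hK hf1 h0 h1 x,
      fun x => norm_smoothErr_le hK1 (hf1.differentiable one_ne_zero) h1 x⟩
  -- The target space stays universally quantified because the inductive hypothesis is applied to
  -- `fderiv ℝ f`, whose values lie in a space of linear maps.
  induction n with
  | zero =>
    intro F _ _ f hf hM
    obtain ⟨h1, h2⟩ := main hf hM
    refine ⟨?_, fun k hk x => ?_⟩
    · have : Continuous (smoothErr K f) :=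
        continuous_iff_continuousAt.mpr fun x => (h1 x).continuousAt
      simpa using (contDiff_zero (𝕜 := ℝ)).mpr this
    · obtain rfl : k = 0 := by omega
      rw [norm_iteratedFDeriv_zero]
      exact h2 x
  | succ n ih =>
    intro F _ _ f hf hM
    obtain ⟨h1, h2⟩ := main hf hM
    have h3 : fderiv ℝ (smoothErr K f) = smoothErr K (fderiv ℝ f) := funext fun x => (h1 x).fderiv
    have hf' : ContDiff ℝ (n + 1 : ℕ) (fderiv ℝ f) :=
      hf.fderiv_right (by push_cast; exact le_rfl)
    obtain ⟨i1, i2⟩ := ih hf' (fun k hk x => by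
      rw [norm_iteratedFDeriv_fderiv]
      exact hM (k + 1) (by omega) x)
    refine ⟨?_, fun k hk x => ?_⟩
    · push_cast
      exact contDiff_succ_iff_hasFDerivAt.mpr ⟨_, i1, h1⟩
    · rcases k with _ | k
      · rw [norm_iteratedFDeriv_zero]
        exact h2 x
      · rw [← norm_iteratedFDeriv_fderiv, h3]
        exact i2 k (by omega) x

/-- Total mass one allows `a ρ` itself to be written as its average against `K`. -/
lemma sub_conv_eq_smoothErr {d : ℕ} {a : Phase d → ℂ} {K : Phase d → ℝ} (hK : Integrable K)
    (hK1 : ∫ t, K t = 1) (ha : Continuous a) {M : ℝ} (hM : ∀ ρ, ‖a ρ‖ ≤ M) (ρ : Phase d) :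
    a ρ - conv a (fun t => (K t : ℂ)) ρ = smoothErr K a ρ := by
  have h1 : conv a (fun t => (K t : ℂ)) ρ = ∫ t, K t • a (ρ - t) := by
    rw [conv, convolution_def, ← integral_sub_left_eq_self _ _ ρ]
    refine integral_congr_ae (Filter.Eventually.of_forall fun t => ?_)
    simp [mul_comm]
  have h2 : Integrable fun t => K t • a (ρ - t) := by
    refine (hK.norm.mul_const M).mono' (hK.aestronglyMeasurable.smul
      (Continuous.aestronglyMeasurable (by fun_prop))) (Filter.Eventually.of_forall fun t => ?_)
    rw [norm_smul]
    gcongr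
    exact hM _
  have h3 : ∫ t, K t • a ρ = a ρ := by
    rw [integral_smul_const, hK1, one_smul]
  rw [h1, smoothErr]
  simp_rw [smul_sub]
  rw [integral_sub (hK.smul_const _) h2, h3]

end Smoothing

/-! ### Integral kernels, and composition as the Moyal product at `ħ = (2π)⁻¹`. -/

section Composition

variable {d : ℕ}

/-- The partial Fourier transform in the momentum, which gives the integral kernel of the Weyl
quantization. -/
def momFourier (a : Phase d → ℂ) (t q : Config d) : ℂ :=
  ∫ p, ex (-inner ℝ t p) * a (phasePt q p)

/-- The Moyal product for the value `(2π)⁻¹` of the semiclassical parameter. -/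
def stdMoyal (a b : Phase d → ℂ) (ρ : Phase d) : ℂ :=
  (4 : ℂ) ^ d * ∫ w : Phase d × Phase d, ex (-(2 * sympForm w.1 w.2)) * a (ρ + w.1) * b (ρ + w.2)

variable {a b : Phase d → ℂ} {C c : ℝ}

lemma integrable_gauss_affine (hc : 0 < c) (x : Config d) :
    Integrable fun y : Config d => gauss c ((1 / 2 : ℝ) • (x + y)) :=
  ((integrable_gauss hc).comp_smul (R := (1 / 2 : ℝ)) (by norm_num)).comp_add_left x

lemma norm_phasePt_le_of_gauss (ha : ∀ ρ, ‖a ρ‖ ≤ C * gauss c ρ) (q p : Config d) :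
    ‖a (phasePt q p)‖ ≤ C * (gauss c q * gauss c p) := by
  rw [← gauss_phasePt]; exact ha _

lemma nonneg_of_gauss (ha : ∀ ρ : Phase d, ‖a ρ‖ ≤ C * gauss c ρ) : 0 ≤ C :=
  nonneg_of_mul_nonneg_left ((norm_nonneg _).trans (ha 0)) (gauss_pos _ _)

lemma norm_phasePt_le_right (hc : 0 < c) (ha : ∀ ρ, ‖a ρ‖ ≤ C * gauss c ρ) (q p : Config d) :
    ‖a (phasePt q p)‖ ≤ C * gauss c p := by
  refine (norm_phasePt_le_of_gauss ha q p).trans ?_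
  have := nonneg_of_gauss ha
  gcongr
  exact mul_le_of_le_one_left (gauss_pos _ _).le (gauss_le_one hc.le _)

lemma continuous_momFourier (hc : 0 < c) (hac : Continuous a) (ha : ∀ ρ, ‖a ρ‖ ≤ C * gauss c ρ) :
    Continuous fun s : Config d × Config d => momFourier a s.1 s.2 := by
  unfold momFourier
  refine continuous_of_dominated (bound := fun p => C * gauss c p)
    (fun s => Continuous.aestronglyMeasurable (by fun_prop)) (fun s => ?_)
    ((integrable_gauss hc).const_mul C) (Filter.Eventually.of_forall fun p => by fun_prop)
  refine Filter.Eventually.of_forall fun p => ?_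
  rw [norm_mul, norm_ex, one_mul]
  exact norm_phasePt_le_right hc ha _ _

lemma norm_momFourier_le (hc : 0 < c) (ha : ∀ ρ, ‖a ρ‖ ≤ C * gauss c ρ) (t q : Config d) :
    ‖momFourier a t q‖ ≤ (C * ∫ p : Config d, gauss c p) * gauss c q := by
  have h1 : (C * ∫ p : Config d, gauss c p) * gauss c q =
      ∫ p : Config d, C * (gauss c q * gauss c p) := by
    rw [integral_const_mul, integral_const_mul]; ring
  rw [h1]
  refine norm_integral_le_of_norm_le (((integrable_gauss hc).const_mul _).const_mul C)
    (Filter.Eventually.of_forall fun p => ?_)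
  rw [norm_mul, norm_ex, one_mul]
  exact norm_phasePt_le_of_gauss ha q p

/-- The Weyl quantization as an integral operator. -/
lemma stdWeyl_eq_integral_kernel (hc : 0 < c) (hac : Continuous a)
    (ha : ∀ ρ, ‖a ρ‖ ≤ C * gauss c ρ) {w : Config d → ℂ}
    (hw : AEStronglyMeasurable w volume) {B : ℝ} (hB : ∀ y, ‖w y‖ ≤ B) (x : Config d) :
    stdWeyl a w x = ∫ y, momFourier a (y - x) ((1 / 2 : ℝ) • (x + y)) * w y := by
  have hC := nonneg_of_gauss ha
  have hB0 : 0 ≤ B := (norm_nonneg _).trans (hB 0)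
  have hint : Integrable (Function.uncurry fun ξ y : Config d =>
      ex (inner ℝ (x - y) ξ) * a (phasePt ((1 / 2 : ℝ) • (x + y)) ξ) * w y)
      (volume.prod volume) := by
    have h1 : Integrable (fun s : Config d × Config d =>
        (C * gauss c s.1) * (gauss c ((1 / 2 : ℝ) • (x + s.2)) * B)) (volume.prod volume) :=
      Integrable.mul_prod ((integrable_gauss hc).const_mul C)
        ((integrable_gauss_affine hc x).mul_const B)
    refine h1.mono' ?_ (Filter.Eventually.of_forall fun s => ?_)
    · exact AEStronglyMeasurable.mul (Continuous.aestronglyMeasurable (by fun_prop))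
        hw.comp_snd
    · simp only [Function.uncurry]
      rw [norm_mul, norm_mul, norm_ex, one_mul]
      calc _ ≤ C * (gauss c ((1 / 2 : ℝ) • (x + s.2)) * gauss c s.1) * B :=
            mul_le_mul (norm_phasePt_le_of_gauss ha _ _) (hB _) (norm_nonneg _)
              (mul_nonneg hC (mul_nonneg (gauss_pos _ _).le (gauss_pos _ _).le))
        _ = _ := by ring
  rw [stdWeyl, integral_integral_swap hint]
  refine integral_congr_ae (Filter.Eventually.of_forall fun y => ?_)
  simp only [momFourier]
  rw [← integral_mul_const]
  refine integral_congr_ae (Filter.Eventually.of_forall fun ξ => ?_)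
  simp only
  rw [← inner_neg_left, neg_sub]

/-- The integral kernel of a composition, as a function of the difference of the arguments. -/
def kernelDiff (a b : Phase d → ℂ) (m s : Config d) : ℂ :=
  (2 : ℂ) ^ d * ∫ q, momFourier a ((2 : ℝ) • (q - m)) (q + (1 / 2 : ℝ) • s) *
    momFourier b (-((2 : ℝ) • (q - m)) - s) q

lemma norm_kernelDiff_integrand_le (hc : 0 < c) (ha : ∀ ρ, ‖a ρ‖ ≤ C * gauss c ρ)
    (hb : ∀ ρ, ‖b ρ‖ ≤ C * gauss c ρ) (t t' q q' : Config d) :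
    ‖momFourier a t q * momFourier b t' q'‖ ≤
      (C * ∫ p : Config d, gauss c p) ^ 2 * (gauss c q * gauss c q') := by
  rw [norm_mul]
  have hC := nonneg_of_gauss ha
  have hI : 0 ≤ ∫ p : Config d, gauss c p := integral_nonneg fun p => (gauss_pos _ _).le
  calc _ ≤ ((C * ∫ p : Config d, gauss c p) * gauss c q) *
        ((C * ∫ p : Config d, gauss c p) * gauss c q') :=
        mul_le_mul (norm_momFourier_le hc ha _ _) (norm_momFourier_le hc hb _ _) (norm_nonneg _)
          (mul_nonneg (mul_nonneg hC hI) (gauss_pos _ _).le)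
    _ = _ := by ring

lemma integrable_kernelDiff_integrand (hc : 0 < c) (hac : Continuous a) (hbc : Continuous b)
    (ha : ∀ ρ, ‖a ρ‖ ≤ C * gauss c ρ) (hb : ∀ ρ, ‖b ρ‖ ≤ C * gauss c ρ) (m : Config d) :
    Integrable (fun z : Config d × Config d =>
      momFourier a ((2 : ℝ) • (z.1 - m)) (z.1 + (1 / 2 : ℝ) • z.2) *
        momFourier b (-((2 : ℝ) • (z.1 - m)) - z.2) z.1) (volume.prod volume) := by
  have hA := continuous_momFourier hc hac ha
  have hB := continuous_momFourier hc hbc hb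
  have hA' : Continuous fun z : Config d × Config d =>
      momFourier a ((2 : ℝ) • (z.1 - m)) (z.1 + (1 / 2 : ℝ) • z.2) :=
    hA.comp (g := fun s : Config d × Config d => momFourier a s.1 s.2)
      (f := fun z : Config d × Config d => ((2 : ℝ) • (z.1 - m), z.1 + (1 / 2 : ℝ) • z.2))
      (by fun_prop)
  have hB' : Continuous fun z : Config d × Config d =>
      momFourier b (-((2 : ℝ) • (z.1 - m)) - z.2) z.1 :=
    hB.comp (g := fun s : Config d × Config d => momFourier b s.1 s.2)
      (f := fun z : Config d × Config d => (-((2 : ℝ) • (z.1 - m)) - z.2, z.1)) (by fun_prop)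
  have hg : Integrable (fun z : Config d × Config d =>
      (C * ∫ p : Config d, gauss c p) ^ 2 * (gauss c (z.1 + (1 / 2 : ℝ) • z.2) * gauss c z.1))
      (volume.prod volume) := by
    refine Integrable.const_mul ?_ _
    rw [integrable_prod_iff (Continuous.aestronglyMeasurable (by fun_prop))]
    have h1 : ∀ q : Config d, Integrable fun s : Config d => gauss c (q + (1 / 2 : ℝ) • s) :=
      fun q => ((integrable_gauss hc).comp_add_left q).comp_smul (by norm_num)
    refine ⟨Filter.Eventually.of_forall fun q => (h1 q).mul_const (gauss c q), ?_⟩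
    have h2 : ∀ q : Config d, ∫ s : Config d, ‖gauss c (q + (1 / 2 : ℝ) • s) * gauss c q‖ =
        (|((1 / 2 : ℝ) ^ Module.finrank ℝ (Config d))⁻¹| • ∫ s : Config d, gauss c s) *
          gauss c q := fun q => by
      simp_rw [Real.norm_eq_abs, abs_of_pos (mul_pos (gauss_pos _ _) (gauss_pos _ _))]
      rw [integral_mul_const, Measure.integral_comp_smul volume (fun s => gauss c (q + s)),
        integral_add_left_eq_self (fun s : Config d => gauss c s) q]
    simp_rw [h2]
    exact (integrable_gauss hc).const_mul _
  exact hg.mono' (hA'.mul hB').aestronglyMeasurable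
    (Filter.Eventually.of_forall fun z => norm_kernelDiff_integrand_le hc ha hb _ _ _ _)

lemma integrable_kernelDiff (hc : 0 < c) (hac : Continuous a) (hbc : Continuous b)
    (ha : ∀ ρ, ‖a ρ‖ ≤ C * gauss c ρ) (hb : ∀ ρ, ‖b ρ‖ ≤ C * gauss c ρ) (m : Config d) :
    Integrable (kernelDiff a b m) :=
  (integrable_kernelDiff_integrand hc hac hbc ha hb m).integral_prod_right.const_mul _

lemma continuous_kernelDiff (hc : 0 < c) (hac : Continuous a) (hbc : Continuous b)
    (ha : ∀ ρ, ‖a ρ‖ ≤ C * gauss c ρ) (hb : ∀ ρ, ‖b ρ‖ ≤ C * gauss c ρ) (m : Config d) :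
    Continuous (kernelDiff a b m) := by
  have hA := continuous_momFourier hc hac ha
  have hB := continuous_momFourier hc hbc hb
  have hA' : Continuous fun z : Config d × Config d =>
      momFourier a ((2 : ℝ) • (z.1 - m)) (z.1 + (1 / 2 : ℝ) • z.2) :=
    hA.comp (g := fun s : Config d × Config d => momFourier a s.1 s.2)
      (f := fun z : Config d × Config d => ((2 : ℝ) • (z.1 - m), z.1 + (1 / 2 : ℝ) • z.2))
      (by fun_prop)
  have hB' : Continuous fun z : Config d × Config d =>
      momFourier b (-((2 : ℝ) • (z.1 - m)) - z.2) z.1 :=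
    hB.comp (g := fun s : Config d × Config d => momFourier b s.1 s.2)
      (f := fun z : Config d × Config d => (-((2 : ℝ) • (z.1 - m)) - z.2, z.1)) (by fun_prop)
  have hC := nonneg_of_gauss ha
  have hAB := hA'.mul hB'
  have h1 : ∀ s : Config d, AEStronglyMeasurable (fun q : Config d =>
      momFourier a ((2 : ℝ) • (q - m)) (q + (1 / 2 : ℝ) • s) *
        momFourier b (-((2 : ℝ) • (q - m)) - s) q) volume := fun s =>
    (hAB.comp (f := fun q : Config d => (q, s)) (by fun_prop)).aestronglyMeasurable
  have h2 : ∀ s : Config d, ∀ᵐ q : Config d, ‖momFourier a ((2 : ℝ) • (q - m))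
      (q + (1 / 2 : ℝ) • s) * momFourier b (-((2 : ℝ) • (q - m)) - s) q‖ ≤
      (C * ∫ p : Config d, gauss c p) ^ 2 * gauss c q := fun s => by
    refine Filter.Eventually.of_forall fun q =>
      (norm_kernelDiff_integrand_le hc ha hb _ _ _ _).trans ?_
    gcongr
    exact mul_le_of_le_one_left (gauss_pos _ _).le (gauss_le_one hc.le _)
  have h3 : ∀ᵐ q : Config d, Continuous fun s : Config d => momFourier a ((2 : ℝ) • (q - m))
      (q + (1 / 2 : ℝ) • s) * momFourier b (-((2 : ℝ) • (q - m)) - s) q :=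
    Filter.Eventually.of_forall fun q => hAB.comp (f := fun s : Config d => (q, s)) (by fun_prop)
  have h4 := continuous_of_dominated h1 h2 ((integrable_gauss hc).const_mul _) h3
  exact continuous_const.mul h4

/-- The form is bilinear and pairs positions with momenta only, so the phase is a product of
characters in `p₁`, in `p₂` and in `ξ`: the two momentum integrals become partial Fourier transforms
and `ξ` is left as a dual variable. -/
lemma ex_sympForm (m ξ q₁ p₁ q₂ p₂ : Config d) :
    ex (-(2 * sympForm (phasePt q₁ p₁ - phasePt m ξ) (phasePt q₂ p₂ - phasePt m ξ))) =
      ex (-inner ℝ ((2 : ℝ) • (q₂ - m)) p₁) * ex (-inner ℝ (-((2 : ℝ) • (q₁ - m))) p₂) *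
        ex (-inner ℝ ((2 : ℝ) • (q₁ - q₂)) ξ) := by
  rw [phasePt_sub, phasePt_sub, sympForm_phasePt, ← ex_add, ← ex_add]
  congr 1
  simp only [real_inner_smul_left, inner_sub_left, inner_sub_right, inner_neg_left]
  rw [real_inner_comm q₂ p₁, real_inner_comm m p₁, real_inner_comm q₂ ξ, real_inner_comm m ξ]
  ring

/-- The Moyal product is, in the momentum, a Fourier transform of the kernel of the composition. -/
lemma stdMoyal_eq_fourier (hc : 0 < c) (hac : Continuous a) (hbc : Continuous b)
    (ha : ∀ ρ, ‖a ρ‖ ≤ C * gauss c ρ) (hb : ∀ ρ, ‖b ρ‖ ≤ C * gauss c ρ) (m ξ : Config d) :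
    stdMoyal a b (phasePt m ξ) = 𝓕 (kernelDiff a b m) ξ := by
  have hC := nonneg_of_gauss ha
  set F : Phase d → Phase d → ℂ := fun ρ₁ ρ₂ =>
    ex (-(2 * sympForm (ρ₁ - phasePt m ξ) (ρ₂ - phasePt m ξ))) * a ρ₁ * b ρ₂ with hF
  have hsymp : Continuous fun w : Phase d × Phase d =>
      sympForm (w.1 - phasePt m ξ) (w.2 - phasePt m ξ) := by
    have : Continuous fun w : Phase d × Phase d =>
        matL (Matrix.J (Fin d) ℝ) (w.2 - phasePt m ξ) := by fun_prop
    exact Continuous.inner (by fun_prop) this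
  have hFc : Continuous fun w : Phase d × Phase d => F w.1 w.2 := by
    simp only [hF]; fun_prop
  have hFle : ∀ ρ₁ ρ₂, ‖F ρ₁ ρ₂‖ ≤ (C * gauss c ρ₁) * (C * gauss c ρ₂) := fun ρ₁ ρ₂ => by
    simp only [hF]
    rw [norm_mul, norm_mul, norm_ex, one_mul]
    exact mul_le_mul (ha _) (hb _) (norm_nonneg _) (mul_nonneg hC (gauss_pos _ _).le)
  have hgP : Integrable fun ρ : Phase d => C * gauss c ρ := (integrable_gauss hc).const_mul C
  have hFi : Integrable (fun w : Phase d × Phase d => F w.1 w.2) (volume.prod volume) :=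
    (hgP.mul_prod hgP).mono' hFc.aestronglyMeasurable
      (Filter.Eventually.of_forall fun w => hFle _ _)
  have hFi1 : ∀ ρ₂, Integrable fun ρ₁ => F ρ₁ ρ₂ := fun ρ₂ =>
    (hgP.mul_const (C * gauss c ρ₂)).mono' (hFc.comp (Continuous.prodMk_left ρ₂)).aestronglyMeasurable
      (Filter.Eventually.of_forall fun ρ₁ => hFle _ _)
  have hFi2 : Integrable fun ρ₂ => ∫ ρ₁, F ρ₁ ρ₂ := hFi.integral_prod_right
  have hA := continuous_momFourier hc hac ha
  have hB := continuous_momFourier hc hbc hb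
  set g : ℝ := ∫ p : Config d, gauss c p with hg
  -- shift of variables
  have h1 : ∫ w : Phase d × Phase d, ex (-(2 * sympForm w.1 w.2)) * a (phasePt m ξ + w.1) *
      b (phasePt m ξ + w.2) = ∫ w : Phase d × Phase d, F w.1 w.2 := by
    rw [← integral_add_right_eq_self (fun w : Phase d × Phase d => F w.1 w.2)
      (phasePt m ξ, phasePt m ξ)]
    refine integral_congr_ae (Filter.Eventually.of_forall fun w => ?_)
    simp only [hF, Prod.fst_add, Prod.snd_add, add_sub_cancel_right]
    rw [add_comm w.1, add_comm w.2]
  -- integration in the first momentum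
  have h2 : ∀ q₂ p₂ q₁ : Config d, ∫ p₁, F (phasePt q₁ p₁) (phasePt q₂ p₂) =
      momFourier a ((2 : ℝ) • (q₂ - m)) q₁ * (ex (-inner ℝ (-((2 : ℝ) • (q₁ - m))) p₂) *
        b (phasePt q₂ p₂)) * ex (-inner ℝ ((2 : ℝ) • (q₁ - q₂)) ξ) := by
    intro q₂ p₂ q₁
    rw [momFourier, ← integral_mul_const, ← integral_mul_const]
    refine integral_congr_ae (Filter.Eventually.of_forall fun p₁ => ?_)
    simp only [hF]
    rw [ex_sympForm]
    ring
  -- integration in the second momentum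
  have h3 : ∀ q₂ : Config d, ∫ p₂, ∫ q₁, ∫ p₁, F (phasePt q₁ p₁) (phasePt q₂ p₂) =
      ∫ q₁, momFourier a ((2 : ℝ) • (q₂ - m)) q₁ * momFourier b (-((2 : ℝ) • (q₁ - m))) q₂ *
        ex (-inner ℝ ((2 : ℝ) • (q₁ - q₂)) ξ) := by
    intro q₂
    simp_rw [h2]
    rw [integral_integral_swap]
    · refine integral_congr_ae (Filter.Eventually.of_forall fun q₁ => ?_)
      simp only [momFourier]
      rw [integral_mul_const, integral_const_mul]
    · have hi : Integrable (fun z : Config d × Config d => (C * gauss c z.1) *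
          (C * g * gauss c z.2)) (volume.prod volume) :=
        Integrable.mul_prod ((integrable_gauss hc).const_mul C)
          ((integrable_gauss hc).const_mul (C * g))
      refine hi.mono' (Continuous.aestronglyMeasurable ?_)
        (Filter.Eventually.of_forall fun z => ?_)
      · have hA' : Continuous fun z : Config d × Config d =>
            momFourier a ((2 : ℝ) • (q₂ - m)) z.2 :=
          hA.comp (g := fun s : Config d × Config d => momFourier a s.1 s.2)
            (f := fun z : Config d × Config d => ((2 : ℝ) • (q₂ - m), z.2)) (by fun_prop)
        unfold Function.uncurry
        fun_prop
      · simp only [Function.uncurry]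
        rw [norm_mul, norm_mul, norm_mul, norm_ex, norm_ex, one_mul, mul_one, mul_comm]
        exact mul_le_mul (norm_phasePt_le_right hc hb _ _) (norm_momFourier_le hc ha _ _)
          (norm_nonneg _) (mul_nonneg hC (gauss_pos _ _).le)
  -- dilation
  have h4 : ∀ q₂ : Config d, ∫ q₁, momFourier a ((2 : ℝ) • (q₂ - m)) q₁ *
      momFourier b (-((2 : ℝ) • (q₁ - m))) q₂ * ex (-inner ℝ ((2 : ℝ) • (q₁ - q₂)) ξ) =
      ((2 : ℂ) ^ d)⁻¹ * ∫ s, momFourier a ((2 : ℝ) • (q₂ - m)) (q₂ + (1 / 2 : ℝ) • s) *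
        momFourier b (-((2 : ℝ) • (q₂ - m)) - s) q₂ * ex (-inner ℝ s ξ) := by
    intro q₂
    have e1 := Measure.integral_comp_smul (volume : Measure (Config d))
      (fun q => momFourier a ((2 : ℝ) • (q₂ - m)) (q₂ + q) *
      momFourier b (-((2 : ℝ) • (q₂ + q - m))) q₂ * ex (-inner ℝ ((2 : ℝ) • (q₂ + q - q₂)) ξ))
      (1 / 2 : ℝ)
    rw [integral_add_left_eq_self (fun q => momFourier a ((2 : ℝ) • (q₂ - m)) q *
      momFourier b (-((2 : ℝ) • (q - m))) q₂ * ex (-inner ℝ ((2 : ℝ) • (q - q₂)) ξ)) q₂] at e1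
    have e2 : ∀ s : Config d, momFourier a ((2 : ℝ) • (q₂ - m)) (q₂ + (1 / 2 : ℝ) • s) *
        momFourier b (-((2 : ℝ) • (q₂ - m)) - s) q₂ * ex (-inner ℝ s ξ) =
        momFourier a ((2 : ℝ) • (q₂ - m)) (q₂ + (1 / 2 : ℝ) • s) *
      momFourier b (-((2 : ℝ) • (q₂ + (1 / 2 : ℝ) • s - m))) q₂ *
        ex (-inner ℝ ((2 : ℝ) • (q₂ + (1 / 2 : ℝ) • s - q₂)) ξ) := by
      intro s
      have f1 : -((2 : ℝ) • (q₂ - m)) - s = -((2 : ℝ) • (q₂ + (1 / 2 : ℝ) • s - m)) := by module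
      have f2 : (2 : ℝ) • (q₂ + (1 / 2 : ℝ) • s - q₂) = s := by module
      rw [f1, f2]
    simp_rw [e2]
    rw [e1, finrank_config, abs_of_pos (by positivity), Complex.real_smul, ← mul_assoc]
    have f3 : ((2 : ℂ) ^ d)⁻¹ * (((1 / 2 : ℝ) ^ d)⁻¹ : ℝ) = 1 := by
      push_cast
      rw [one_div, inv_pow, inv_inv, inv_mul_cancel₀ (pow_ne_zero _ two_ne_zero)]
    rw [f3, one_mul]
  have hkd := integrable_kernelDiff_integrand hc hac hbc ha hb m
  calc stdMoyal a b (phasePt m ξ) = (4 : ℂ) ^ d * ∫ w : Phase d × Phase d, F w.1 w.2 := by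
        rw [stdMoyal, h1]
    _ = (4 : ℂ) ^ d * ∫ ρ₂, ∫ ρ₁, F ρ₁ ρ₂ := by
        congr 1
        exact integral_prod_symm (μ := (volume : Measure (Phase d)))
          (ν := (volume : Measure (Phase d))) _ hFi
    _ = (4 : ℂ) ^ d * ∫ q₂, ∫ p₂, ∫ q₁, ∫ p₁, F (phasePt q₁ p₁) (phasePt q₂ p₂) := by
        rw [integral_phase_prod hFi2]
        congr 1
        refine integral_congr_ae (Filter.Eventually.of_forall fun q₂ => ?_)
        refine integral_congr_ae (Filter.Eventually.of_forall fun p₂ => ?_)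
        exact integral_phase_prod (hFi1 _)
    _ = (4 : ℂ) ^ d * ∫ q₂, ((2 : ℂ) ^ d)⁻¹ *
          ∫ s, momFourier a ((2 : ℝ) • (q₂ - m)) (q₂ + (1 / 2 : ℝ) • s) *
            momFourier b (-((2 : ℝ) • (q₂ - m)) - s) q₂ * ex (-inner ℝ s ξ) := by
        simp_rw [h3, h4]
    _ = (4 : ℂ) ^ d * (((2 : ℂ) ^ d)⁻¹ *
          ∫ s, ∫ q, momFourier a ((2 : ℝ) • (q - m)) (q + (1 / 2 : ℝ) • s) *
            momFourier b (-((2 : ℝ) • (q - m)) - s) q * ex (-inner ℝ s ξ)) := by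
        rw [integral_const_mul, integral_integral_swap]
        exact integrable_ex_mul hkd (Continuous.measurable (by fun_prop))
    _ = 𝓕 (kernelDiff a b m) ξ := by
        rw [fourier_eq_ex, ← mul_assoc]
        have f4 : (4 : ℂ) ^ d * ((2 : ℂ) ^ d)⁻¹ = 2 ^ d := by
          rw [show (4 : ℂ) = 2 * 2 by norm_num, mul_pow, mul_assoc,
            mul_inv_cancel₀ (pow_ne_zero _ two_ne_zero), mul_one]
        rw [f4, ← integral_const_mul]
        refine integral_congr_ae (Filter.Eventually.of_forall fun s => ?_)
        simp only [kernelDiff]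
        rw [integral_mul_const]
        ring

/-- The integral kernel of the composition of two Weyl quantizations. -/
lemma momFourier_stdMoyal (hc : 0 < c) (hac : Continuous a) (hbc : Continuous b)
    (ha : ∀ ρ, ‖a ρ‖ ≤ C * gauss c ρ) (hb : ∀ ρ, ‖b ρ‖ ≤ C * gauss c ρ)
    (hK : ∀ m, Integrable fun ξ => stdMoyal a b (phasePt m ξ)) (x t : Config d) :
    momFourier (stdMoyal a b) (t - x) ((1 / 2 : ℝ) • (x + t)) =
      ∫ y, momFourier a (y - x) ((1 / 2 : ℝ) • (x + y)) *
        momFourier b (t - y) ((1 / 2 : ℝ) • (y + t)) := by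
  set m : Config d := (1 / 2 : ℝ) • (x + t) with hm
  have h1 : momFourier (stdMoyal a b) (t - x) m = kernelDiff a b m (x - t) := by
    have hF : (fun ξ => stdMoyal a b (phasePt m ξ)) = 𝓕 (kernelDiff a b m) :=
      funext fun ξ => stdMoyal_eq_fourier hc hac hbc ha hb m ξ
    -- Fourier inversion recovers the composed kernel from the Moyal product, evaluated at the
    -- difference `x - t`.
    have hi := (integrable_kernelDiff hc hac hbc ha hb m).fourierInv_fourier_eq
      (hF ▸ hK m) (continuous_kernelDiff hc hac hbc ha hb m).continuousAt (v := x - t)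
    rw [← hi, fourierInv_eq_ex, ← hF, momFourier]
    refine integral_congr_ae (Filter.Eventually.of_forall fun ξ => ?_)
    simp only
    rw [← inner_neg_left, neg_sub, real_inner_comm]
  -- In `kernelDiff` the integration variable is the midpoint of `y` and `t`; returning to `y`
  -- absorbs its factor `2 ^ d`.
  have e1 := Measure.integral_comp_smul (volume : Measure (Config d))
    (fun q => momFourier a ((2 : ℝ) • ((1 / 2 : ℝ) • t + q - m))
      ((1 / 2 : ℝ) • t + q + (1 / 2 : ℝ) • (x - t)) *
      momFourier b (-((2 : ℝ) • ((1 / 2 : ℝ) • t + q - m)) - (x - t)) ((1 / 2 : ℝ) • t + q))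
    (1 / 2 : ℝ)
  rw [integral_add_left_eq_self (fun q => momFourier a ((2 : ℝ) • (q - m))
      (q + (1 / 2 : ℝ) • (x - t)) *
      momFourier b (-((2 : ℝ) • (q - m)) - (x - t)) q) ((1 / 2 : ℝ) • t), finrank_config,
    abs_of_pos (by positivity), Complex.real_smul] at e1
  have f3 : ((((1 / 2 : ℝ) ^ d)⁻¹ : ℝ) : ℂ) = 2 ^ d := by
    push_cast
    rw [one_div, inv_pow, inv_inv]
  rw [h1, kernelDiff, ← f3, ← e1]
  refine integral_congr_ae (Filter.Eventually.of_forall fun y => ?_)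
  have f4 : (2 : ℝ) • ((1 / 2 : ℝ) • t + (1 / 2 : ℝ) • y - m) = y - x := by rw [hm]; module
  have f5 : (1 / 2 : ℝ) • t + (1 / 2 : ℝ) • y + (1 / 2 : ℝ) • (x - t) = (1 / 2 : ℝ) • (x + y) := by
    module
  have f6 : -(y - x) - (x - t) = t - y := by module
  have f7 : (1 / 2 : ℝ) • t + (1 / 2 : ℝ) • y = (1 / 2 : ℝ) • (y + t) := by module
  simp only
  rw [f4, f5, f6, f7]

/-- The Weyl quantization of the Moyal product is the composition. -/
lemma stdWeyl_stdWeyl (hc : 0 < c) (hac : Continuous a) (hbc : Continuous b)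
    (ha : ∀ ρ, ‖a ρ‖ ≤ C * gauss c ρ) (hb : ∀ ρ, ‖b ρ‖ ≤ C * gauss c ρ) {C' c' : ℝ} (hc' : 0 < c')
    (hKc : Continuous (stdMoyal a b)) (hK : ∀ ρ, ‖stdMoyal a b ρ‖ ≤ C' * gauss c' ρ)
    (u : 𝓢(Config d, ℂ)) (x : Config d) :
    stdWeyl a (stdWeyl b u) x = stdWeyl (stdMoyal a b) u x := by
  have hC := nonneg_of_gauss ha
  obtain ⟨U, hU0, hU⟩ := exists_norm_iteratedFDeriv_schwartz_le u 0
  have hU' : ∀ y, ‖u y‖ ≤ U := fun y => by simpa using hU 0 le_rfl y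
  have hum := u.continuous.aestronglyMeasurable (μ := (volume : Measure (Config d)))
  have hA := continuous_momFourier hc hac ha
  have hB := continuous_momFourier hc hbc hb
  set g : ℝ := ∫ p : Config d, gauss c p with hg
  have hg0 : 0 ≤ g := integral_nonneg fun p => (gauss_pos _ _).le
  have hble : ∀ t q, ‖momFourier b t q‖ ≤ C * g := fun t q =>
    (norm_momFourier_le hc hb t q).trans
      (mul_le_of_le_one_right (mul_nonneg hC hg0) (gauss_le_one hc.le _))
  have hWb : stdWeyl b u = fun y => ∫ t, momFourier b (t - y) ((1 / 2 : ℝ) • (y + t)) * u t :=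
    funext fun y => stdWeyl_eq_integral_kernel hc hbc hb hum hU' y
  have hBc : Continuous fun z : Config d × Config d =>
      momFourier b (z.2 - z.1) ((1 / 2 : ℝ) • (z.1 + z.2)) :=
    hB.comp (g := fun s : Config d × Config d => momFourier b s.1 s.2)
      (f := fun z : Config d × Config d => (z.2 - z.1, (1 / 2 : ℝ) • (z.1 + z.2))) (by fun_prop)
  have hAc : Continuous fun y : Config d => momFourier a (y - x) ((1 / 2 : ℝ) • (x + y)) :=
    hA.comp (g := fun s : Config d × Config d => momFourier a s.1 s.2)
      (f := fun y : Config d => (y - x, (1 / 2 : ℝ) • (x + y))) (by fun_prop)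
  have hWbc : Continuous (stdWeyl b u) := by
    rw [hWb]
    refine continuous_of_dominated (bound := fun t => C * g * ‖u t‖) (fun y => ?_) (fun y => ?_)
      (u.integrable.norm.const_mul _) (Filter.Eventually.of_forall fun t => ?_)
    · exact ((hBc.comp (Continuous.prodMk_right y)).mul u.continuous).aestronglyMeasurable
    · refine Filter.Eventually.of_forall fun t => ?_
      rw [norm_mul]
      gcongr
      exact hble _ _
    · exact (hBc.comp (Continuous.prodMk_left t)).mul continuous_const
  have hWbB : ∀ y, ‖stdWeyl b u y‖ ≤ ∫ t, C * g * ‖u t‖ := fun y => by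
    rw [hWb]
    refine norm_integral_le_of_norm_le (u.integrable.norm.const_mul _)
      (Filter.Eventually.of_forall fun t => ?_)
    rw [norm_mul]
    gcongr
    exact hble _ _
  have hKi : ∀ m, Integrable fun ξ => stdMoyal a b (phasePt m ξ) := fun m =>
    ((integrable_gauss hc').const_mul C').mono' (Continuous.aestronglyMeasurable (by fun_prop))
      (Filter.Eventually.of_forall fun ξ => norm_phasePt_le_right hc' hK m ξ)
  rw [stdWeyl_eq_integral_kernel hc hac ha hWbc.aestronglyMeasurable hWbB x,
    stdWeyl_eq_integral_kernel hc' hKc hK hum hU' x, hWb]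
  simp_rw [← integral_const_mul]
  rw [integral_integral_swap]
  · refine integral_congr_ae (Filter.Eventually.of_forall fun t => ?_)
    simp only
    rw [momFourier_stdMoyal hc hac hbc ha hb hKi, ← integral_mul_const]
    refine integral_congr_ae (Filter.Eventually.of_forall fun y => ?_)
    simp only; ring
  · have hi : Integrable (fun z : Config d × Config d =>
        (C * g * gauss c ((1 / 2 : ℝ) • (x + z.1))) * (C * g * ‖u z.2‖)) (volume.prod volume) :=
      Integrable.mul_prod ((integrable_gauss_affine hc x).const_mul _)
        (u.integrable.norm.const_mul _)
    refine hi.mono' ?_ (Filter.Eventually.of_forall fun z => ?_)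
    · exact ((hAc.comp continuous_fst).mul
        (hBc.mul (u.continuous.comp continuous_snd))).aestronglyMeasurable
    · simp only [Function.uncurry]
      rw [norm_mul, norm_mul]
      gcongr
      · exact mul_nonneg (mul_nonneg hC hg0) (gauss_pos _ _).le
      · exact norm_momFourier_le hc ha _ _
      · exact hble _ _

end Composition

/-! ### Composition for general `ħ`, as operators on `L²`. -/

section SemiclassicalComposition

variable {d : ℕ} {h : ℝ} {a : Phase d → ℂ} {C c : ℝ}

/-- Dilating the `4d` integration variables gives the Jacobian `(2πħ) ^ (2d)`, and against the
normalization `(πħ) ^ (-2d)` this leaves the factor `4 ^ d` of `stdMoyal`. -/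
lemma moyal_smul (hh : 0 < h) (a b : Phase d → ℂ) (ρ : Phase d) :
    moyal h a b (scale h • ρ) =
      stdMoyal (fun ρ => a (scale h • ρ)) (fun ρ => b (scale h • ρ)) ρ := by
  have hs := scale_pos hh
  have e := Measure.integral_comp_smul (volume : Measure (Phase d × Phase d))
    (fun w => Complex.exp (-(2 * Complex.I) * ((sympForm w.1 w.2 / h : ℝ) : ℂ)) *
      a (scale h • ρ + w.1) * b (scale h • ρ + w.2)) (scale h)
  have hfr : Module.finrank ℝ (Phase d × Phase d) = 4 * d := by
    rw [Module.finrank_prod, finrank_phase]; ring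
  rw [hfr, abs_of_pos (by positivity), Complex.real_smul] at e
  have e2 : ∀ w : Phase d × Phase d,
      Complex.exp (-(2 * Complex.I) *
        ((sympForm (scale h • w).1 (scale h • w).2 / h : ℝ) : ℂ)) *
      a (scale h • ρ + (scale h • w).1) * b (scale h • ρ + (scale h • w).2) =
      ex (-(2 * sympForm w.1 w.2)) * a (scale h • (ρ + w.1)) * b (scale h • (ρ + w.2)) := by
    intro w
    have e3 : sympForm (scale h • w.1) (scale h • w.2) / h = 2 * π * sympForm w.1 w.2 := by
      rw [sympForm_smul_left, sympForm_smul_right, ← mul_assoc, scale_sq hh]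
      field_simp
    rw [Prod.smul_fst, Prod.smul_snd, e3, smul_add, smul_add, ex]
    congr 3
    push_cast; ring
  simp_rw [e2] at e
  rw [stdMoyal, e, moyal, ← mul_assoc]
  congr 1
  have e4 : scale h ^ (4 * d) = (2 * π * h) ^ (2 * d) := by
    rw [← scale_sq hh, ← sq, ← pow_mul]; congr 1; ring
  rw [e4]
  have hp : (π : ℂ) ≠ 0 := by exact_mod_cast pi_ne_zero
  have hhc : (h : ℂ) ≠ 0 := by exact_mod_cast hh.ne'
  push_cast
  rw [show (4 : ℂ) = 2 ^ 2 by norm_num, ← pow_mul, mul_assoc 2, mul_pow 2 ((π : ℂ) * h), mul_inv,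
    ← mul_assoc, mul_inv_cancel₀ (pow_ne_zero _ two_ne_zero), one_mul]

lemma gauss_smul {V : Type*} [NormedAddCommGroup V] [NormedSpace ℝ V] (c s : ℝ) (x : V) :
    gauss c (s • x) = gauss (c * s ^ 2) x := by
  rw [gauss, gauss, norm_smul, mul_pow, Real.norm_eq_abs, sq_abs]; ring_nf

/-- The Weyl quantization of the Moyal product is the composition. -/
lemma weylApply_weylApply (hh : 0 < h) (hc : 0 < c) (hac : Continuous a)
    (ha : ∀ ρ, ‖a ρ‖ ≤ C * gauss c ρ) {C' c' : ℝ} (hc' : 0 < c')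
    (hKc : Continuous (moyal h a a)) (hK : ∀ ρ, ‖moyal h a a ρ‖ ≤ C' * gauss c' ρ)
    (u : 𝓢(Config d, ℂ)) (x : Config d) :
    weylApply h a (weylApply h a u) x = weylApply h (moyal h a a) u x := by
  have hs := scale_pos hh
  have hs2 : 0 < scale h ^ 2 := by positivity
  obtain ⟨x, rfl⟩ : ∃ x', x = scale h • x' := ⟨(scale h)⁻¹ • x, (smul_inv_smul₀ hs.ne' x).symm⟩
  have hm : (fun ρ => moyal h a a (scale h • ρ)) =
      stdMoyal (fun ρ => a (scale h • ρ)) (fun ρ => a (scale h • ρ)) :=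
    funext (moyal_smul hh a a)
  rw [weylApply_smul hh, weylApply_smul hh, hm]
  have e : (fun y => weylApply h a u (scale h • y)) =
      stdWeyl (fun ρ => a (scale h • ρ)) (dilate (scale h) hs.ne' u) :=
    funext fun y => weylApply_smul hh a u y
  have hac' : Continuous fun ρ => a (scale h • ρ) := by fun_prop
  have ha' : ∀ ρ, ‖a (scale h • ρ)‖ ≤ C * gauss (c * scale h ^ 2) ρ := fun ρ =>
    gauss_smul c (scale h) ρ ▸ ha _
  rw [e, stdWeyl_stdWeyl (mul_pos hc hs2) hac' hac' ha' ha' (C' := C') (mul_pos hc' hs2)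
    (hm ▸ (by fun_prop)) (hm ▸ fun ρ => gauss_smul c' (scale h) ρ ▸ hK _)]
  rfl

/-- The integral kernel of the Weyl quantization of a symbol with Gaussian decay. -/
lemma exists_kernel (hh : 0 < h) (hc : 0 < c) (hac : Continuous a)
    (ha : ∀ ρ, ‖a ρ‖ ≤ C * gauss c ρ) (x : Config d) :
    ∃ k : Config d → ℂ, MemLp k 2 ∧ ∀ w : Config d → ℂ, AEStronglyMeasurable w →
      ∀ B : ℝ, (∀ y, ‖w y‖ ≤ B) → weylApply h a w x = ∫ y, k y * w y := by
  have hs := scale_pos hh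
  have hs2 : 0 < scale h ^ 2 := by positivity
  set s := scale h with hsdef
  set c₁ := c * s ^ 2 with hc₁def
  have hc₁ : 0 < c₁ := mul_pos hc hs2
  have hac' : Continuous fun ρ => a (s • ρ) := by fun_prop
  have ha' : ∀ ρ, ‖a (s • ρ)‖ ≤ C * gauss c₁ ρ := fun ρ => gauss_smul c s ρ ▸ ha _
  set x' := s⁻¹ • x with hx'
  set k₀ : Config d → ℂ := fun y =>
    momFourier (fun ρ => a (s • ρ)) (y - x') ((1 / 2 : ℝ) • (x' + y)) with hk₀
  have hk₀c : Continuous k₀ :=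
    (continuous_momFourier hc₁ hac' ha').comp
      (g := fun s : Config d × Config d => momFourier _ s.1 s.2)
      (f := fun y : Config d => (y - x', (1 / 2 : ℝ) • (x' + y))) (by fun_prop)
  have hk₀i : Integrable fun y => ‖k₀ y‖ ^ 2 := by
    refine (((integrable_gauss_affine hc₁ x').const_mul
      ((C * ∫ p : Config d, gauss c₁ p) ^ 2))).mono'
      (Continuous.aestronglyMeasurable (by fun_prop)) (Filter.Eventually.of_forall fun y => ?_)
    rw [norm_pow, norm_norm]
    calc ‖k₀ y‖ ^ 2 ≤ ((C * ∫ p : Config d, gauss c₁ p) * gauss c₁ ((1 / 2 : ℝ) • (x' + y))) ^ 2 :=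
          pow_le_pow_left₀ (norm_nonneg _) (norm_momFourier_le hc₁ ha' _ _) 2
      _ = (C * ∫ p : Config d, gauss c₁ p) ^ 2 * gauss c₁ ((1 / 2 : ℝ) • (x' + y)) ^ 2 := by ring
      _ ≤ _ := by
          gcongr
          exact pow_le_of_le_one (gauss_pos _ _).le (gauss_le_one hc₁.le _) two_ne_zero
  refine ⟨fun y => (((s ^ d)⁻¹ : ℝ) : ℂ) * k₀ (s⁻¹ • y), ?_, fun w hw B hB => ?_⟩
  · rw [memLp_two_iff_integrable_sq_norm (Continuous.aestronglyMeasurable (by fun_prop))]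
    have := (hk₀i.comp_smul (R := s⁻¹) (inv_ne_zero hs.ne')).const_mul
      (‖(((s ^ d)⁻¹ : ℝ) : ℂ)‖ ^ 2)
    refine this.congr (Filter.Eventually.of_forall fun y => ?_)
    simp only
    rw [norm_mul, mul_pow]
  · have hx : x = s • x' := (smul_inv_smul₀ hs.ne' x).symm
    have hws : AEStronglyMeasurable (fun y => w (s • y)) volume :=
      hw.comp_quasiMeasurePreserving (Measure.quasiMeasurePreserving_smul volume hs.ne')
    rw [hx, weylApply_smul hh, stdWeyl_eq_integral_kernel hc₁ hac' ha' hws (fun y => hB _)]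
    have e := Measure.integral_comp_smul (volume : Measure (Config d))
      (fun y => k₀ (s⁻¹ • y) * w y) s
    simp_rw [inv_smul_smul₀ hs.ne'] at e
    rw [finrank_config, abs_of_pos (by positivity), Complex.real_smul] at e
    rw [e, ← integral_const_mul]
    refine integral_congr_ae (Filter.Eventually.of_forall fun y => ?_)
    simp only
    ring

/-- An operator with Gaussian Weyl symbol is given by the defining integral on all bounded
elements of `L²`. -/
lemma ae_eq_weylApply (hh : 0 < h) (hc : 0 < c) (hac : Continuous a)
    (ha : ∀ ρ, ‖a ρ‖ ≤ C * gauss c ρ)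
    {S : Lp ℂ 2 (volume : Measure (Config d)) →L[ℂ] Lp ℂ 2 (volume : Measure (Config d))}
    (hS : IsWeylOp h a S) {f : Lp ℂ 2 (volume : Measure (Config d))} {w : Config d → ℂ}
    (hfw : f =ᵐ[volume] w) {B : ℝ} (hB : ∀ y, ‖w y‖ ≤ B) :
    S f =ᵐ[volume] weylApply h a w := by
  -- Schwartz functions approximate `f` in `L²`. Their images under `S` converge almost everywhere
  -- along a subsequence, while the defining integrals converge at every point because the kernel at
  -- a fixed `x` is in `L²`; the two limits must agree.
  have hmem : f ∈ closure (Set.range (SchwartzMap.toLpCLM ℂ (E := Config d) ℂ 2 volume)) :=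
    SchwartzMap.denseRange_toLpCLM ENNReal.ofNat_ne_top f
  obtain ⟨v, hv, hvf⟩ := mem_closure_iff_seq_limit.mp hmem
  choose u hu using hv
  have hSv : Filter.Tendsto (fun n => S (v n)) Filter.atTop (nhds (S f)) :=
    (S.continuous.tendsto f).comp hvf
  obtain ⟨ns, hns, hae⟩ := (tendstoInMeasure_of_tendsto_Lp hSv).exists_seq_tendsto_ae
  have hall : ∀ᵐ x : Config d, ∀ n, S (v n) x = weylApply h a (u n) x := by
    rw [ae_all_iff]
    intro n
    rw [← hu n]
    exact (hS (u n)).2.2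
  filter_upwards [hae, hall] with x hx hx2
  obtain ⟨k, hk2, hk⟩ := exists_kernel hh hc hac ha x
  have hkc : MemLp (fun y => conj (k y)) 2 (volume : Measure (Config d)) := hk2.star
  have hin : ∀ (g : Lp ℂ 2 (volume : Measure (Config d))) (w' : Config d → ℂ),
      g =ᵐ[volume] w' → inner ℂ (hkc.toLp _) g = ∫ y, k y * w' y := by
    intro g w' hg
    rw [L2.inner_def]
    refine integral_congr_ae ?_
    filter_upwards [hg, hkc.coeFn_toLp] with y h1 h2
    rw [h1, h2, RCLike.inner_apply, RCLike.conj_conj, mul_comm]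
  have hlim : Filter.Tendsto (fun n => weylApply h a (u n) x) Filter.atTop
      (nhds (weylApply h a w x)) := by
    rw [hk w ((Lp.aestronglyMeasurable f).congr hfw) B hB, ← hin f w hfw]
    have e : ∀ n, weylApply h a (u n) x = inner ℂ (hkc.toLp _) (v n) := fun n => by
      obtain ⟨U, hU0, hU⟩ := exists_norm_iteratedFDeriv_schwartz_le (u n) 0
      rw [hk (u n) (u n).continuous.aestronglyMeasurable U (fun y => by simpa using hU 0 le_rfl y),
        hin (v n) (u n)]
      rw [← hu n]
      exact (u n).coeFn_toLp 2 volume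
    simp_rw [e]
    exact (continuous_const.inner continuous_id).tendsto f |>.comp hvf
  refine tendsto_nhds_unique ?_ (hlim.comp hns.tendsto_atTop)
  refine hx.congr fun i => ?_
  exact hx2 _

lemma exists_norm_weylApply_le (hh : 0 < h) (hc : 0 < c) (hac : Continuous a)
    (ha : ∀ ρ, ‖a ρ‖ ≤ C * gauss c ρ) (u : 𝓢(Config d, ℂ)) :
    ∃ B, ∀ x, ‖weylApply h a u x‖ ≤ B := by
  have hs := scale_pos hh
  have hs2 : 0 < scale h ^ 2 := by positivity
  have hac' : Continuous fun ρ => a (scale h • ρ) := by fun_prop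
  have ha' : ∀ ρ, ‖a (scale h • ρ)‖ ≤ C * gauss (c * scale h ^ 2) ρ := fun ρ =>
    gauss_smul c (scale h) ρ ▸ ha _
  have hc₁ := mul_pos hc hs2
  set v := dilate (scale h) hs.ne' u with hv
  obtain ⟨U, hU0, hU⟩ := exists_norm_iteratedFDeriv_schwartz_le v 0
  refine ⟨∫ y, (C * ∫ p : Config d, gauss (c * scale h ^ 2) p) * ‖v y‖, fun x => ?_⟩
  have hC := nonneg_of_gauss ha
  have hg0 : 0 ≤ ∫ p : Config d, gauss (c * scale h ^ 2) p :=
    integral_nonneg fun p => (gauss_pos _ _).le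
  have e : weylApply h a u x = stdWeyl (fun ρ => a (scale h • ρ)) v ((scale h)⁻¹ • x) :=
    weylApply_eq hh a u x
  rw [e, stdWeyl_eq_integral_kernel hc₁ hac' ha' v.continuous.aestronglyMeasurable
    (fun y => by simpa using hU 0 le_rfl y)]
  refine norm_integral_le_of_norm_le (v.integrable.norm.const_mul _)
    (Filter.Eventually.of_forall fun y => ?_)
  rw [norm_mul]
  gcongr
  exact (norm_momFourier_le hc₁ ha' _ _).trans
    (mul_le_of_le_one_right (mul_nonneg hC hg0) (gauss_le_one hc₁.le _))

lemma integrable_integral_weylIntegrand (hc : 0 < c) (hac : Continuous a)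
    (ha : ∀ ρ, ‖a ρ‖ ≤ C * gauss c ρ) (u : 𝓢(Config d, ℂ)) (x : Config d) :
    Integrable fun ξ => ∫ y, weylIntegrand h a u x ξ y := by
  have hi : Integrable (fun z : Config d × Config d => weylIntegrand h a u x z.1 z.2)
      (volume.prod volume) := by
    have h1 : Integrable (fun z : Config d × Config d => (C * gauss c z.1) * ‖u z.2‖)
      (volume.prod volume) := ((integrable_gauss hc).const_mul C).mul_prod u.integrable.norm
    refine h1.mono' ?_ (Filter.Eventually.of_forall fun z => ?_)
    · have := u.continuous
      unfold weylIntegrand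
      exact Continuous.aestronglyMeasurable (by fun_prop)
    · rw [weylIntegrand, norm_mul, norm_mul, mul_comm Complex.I, Complex.norm_exp_ofReal_mul_I,
        one_mul]
      gcongr
      exact norm_phasePt_le_right hc ha _ _
  exact hi.integral_prod_left

/-- The Weyl quantization of the Moyal product is the composition of operators on `L²`. -/
theorem isWeylOp_comp_self (hh : 0 < h) (hc : 0 < c) (hac : Continuous a)
    (ha : ∀ ρ, ‖a ρ‖ ≤ C * gauss c ρ) {C' c' : ℝ} (hc' : 0 < c')
    (hKc : Continuous (moyal h a a)) (hK : ∀ ρ, ‖moyal h a a ρ‖ ≤ C' * gauss c' ρ)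
    {S : Lp ℂ 2 (volume : Measure (Config d)) →L[ℂ] Lp ℂ 2 (volume : Measure (Config d))}
    (hS : IsWeylOp h a S) : IsWeylOp h (moyal h a a) (S ∘L S) := by
  intro u
  have hC' := nonneg_of_gauss hK
  refine ⟨fun x ξ => integrable_weylIntegrand hKc (M := C') (fun ρ => (hK ρ).trans ?_)
    u.integrable x ξ, fun x => integrable_integral_weylIntegrand hc' hKc hK u x, ?_⟩
  · exact mul_le_of_le_one_right hC' (gauss_le_one hc'.le _)
  -- The function `S u` is only known to be bounded, not Schwartz, so the second application of `S`
  -- has to go through `ae_eq_weylApply`.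
  · obtain ⟨B, hB⟩ := exists_norm_weylApply_le hh hc hac ha u
    have := ae_eq_weylApply hh hc hac ha hS (hS u).2.2 hB
    refine this.trans (Filter.Eventually.of_forall fun x => ?_)
    exact weylApply_weylApply hh hc hac ha hc' hKc hK u x

end SemiclassicalComposition

/-! ### Shears of a product space and the parallelogram identity for Gaussians. -/

section LinearChange

variable {V E : Type*} [NormedAddCommGroup V] [InnerProductSpace ℝ V] [FiniteDimensional ℝ V]
  [MeasurableSpace V] [BorelSpace V] [NormedAddCommGroup E]

/-- A shear translates one variable by an amount that depends on the other, hence is a skew product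
of translations; conjugation with the swap puts it in the first variable. -/
lemma measurePreserving_shear (R : V →L[ℝ] V) :
    MeasurePreserving (fun z : V × V => (z.1 + R z.2, z.2))
      ((volume : Measure V).prod volume) ((volume : Measure V).prod volume) := by
  have h1 : MeasurePreserving (fun p : V × V => (p.1, p.2 + R p.1))
      ((volume : Measure V).prod volume) ((volume : Measure V).prod volume) :=
    (MeasurePreserving.id (volume : Measure V)).skew_product (g := fun y ρ => ρ + R y)
      (Continuous.measurable (by unfold Function.uncurry; fun_prop))
      (Filter.Eventually.of_forall fun y => map_add_right_eq_self volume (R y))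
  exact (Measure.measurePreserving_swap.comp h1).comp Measure.measurePreserving_swap

lemma integrable_comp_shear {F : V × V → E} (hF : Integrable F (volume.prod volume))
    (R : V →L[ℝ] V) : Integrable (fun z : V × V => F (z.1 + R z.2, z.2)) (volume.prod volume) :=
  ((measurePreserving_shear R).integrable_comp hF.aestronglyMeasurable).mpr hF

lemma integrable_shear_mul {P Q : V → ℝ} (hP : Integrable P) (hQ : Integrable Q) (R : V →L[ℝ] V) :
    Integrable (fun z : V × V => P (z.1 + R z.2) * Q z.2) (volume.prod volume) :=
  integrable_comp_shear (hP.mul_prod hQ) R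

lemma integral_shear_mul {P Q : V → ℝ} (hP : Integrable P) (hQ : Integrable Q) (R : V →L[ℝ] V) :
    ∫ x, ∫ y, P (x + R y) * Q y = (∫ x, P x) * ∫ y, Q y := by
  rw [integral_integral_swap (integrable_shear_mul hP hQ R), ← integral_const_mul]
  refine integral_congr_ae (Filter.Eventually.of_forall fun y => ?_)
  simp only
  rw [integral_mul_const, integral_add_right_eq_self]

lemma gauss_add_mul_gauss_sub (b : ℝ) (x y : V) :
    gauss b (x + y) * gauss b (x - y) = gauss (2 * b) x * gauss (2 * b) y := by
  simp only [gauss]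
  rw [← Real.exp_add, ← Real.exp_add]
  congr 1
  have := parallelogram_law_with_norm ℝ x y
  linear_combination (-b) * this

end LinearChange

/-! ### The Moyal square of a Gaussian in closed form. -/

section GaussianKernel

variable {d : ℕ} {h : ℝ} {M : Matrix (Fin d ⊕ Fin d) (Fin d ⊕ Fin d) ℝ}

lemma measurableEmbedding_matAct (hM : M.det ≠ 0) :
    MeasurableEmbedding (matAct M : Phase d → Phase d) := by
  have hinj : Function.Injective (matAct M : Phase d → Phase d) :=
    Function.LeftInverse.injective (g := matAct M⁻¹) fun ρ => by
      rw [← matAct_mul, Matrix.nonsing_inv_mul _ hM.isUnit, matAct_one]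
  exact (matL M).continuous.measurableEmbedding hinj

lemma map_matAct (hM : M.det ≠ 0) :
    Measure.map (matAct M) (volume : Measure (Phase d)) =
      ENNReal.ofReal |M.det|⁻¹ • (volume : Measure (Phase d)) := by
  have := Measure.map_linearMap_addHaar_eq_smul_addHaar (volume : Measure (Phase d))
    (f := (matL M : Phase d →ₗ[ℝ] Phase d)) (by rwa [det_matL])
  rw [det_matL, abs_inv] at this
  exact this

lemma integral_comp_matAct {E : Type*} [NormedAddCommGroup E] [NormedSpace ℝ E] (hM : M.det ≠ 0)
    (f : Phase d → E) : ∫ ρ, f (matAct M ρ) = |M.det|⁻¹ • ∫ ρ, f ρ := by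
  rw [← (measurableEmbedding_matAct hM).integral_map, map_matAct hM, integral_smul_measure,
    ENNReal.toReal_ofReal (by positivity)]

lemma integrable_comp_matAct {E : Type*} [NormedAddCommGroup E] (hM : M.det ≠ 0) {f : Phase d → E}
    (hf : Integrable f) : Integrable fun ρ => f (matAct M ρ) := by
  have := (measurableEmbedding_matAct hM).integrable_map_iff (μ := volume) (g := f)
  rw [map_matAct hM] at this
  exact this.mp (hf.smul_measure ENNReal.ofReal_ne_top)

@[fun_prop] lemma _root_.Continuous.matAct {X : Type*} [TopologicalSpace X] {f : X → Phase d}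
    (hf : Continuous f) : Continuous fun x => matAct M (f x) := (matL M).continuous.comp hf

lemma matAct_add (ρ ρ' : Phase d) : matAct M (ρ + ρ') = matAct M ρ + matAct M ρ' :=
  map_add (matL M) ρ ρ'

lemma matAct_sub (ρ ρ' : Phase d) : matAct M (ρ - ρ') = matAct M ρ - matAct M ρ' :=
  map_sub (matL M) ρ ρ'

lemma integrable_gauss_matAct (hM : M.det ≠ 0) {b : ℝ} (hb : 0 < b) :
    Integrable fun ρ : Phase d => gauss b (matAct M ρ) :=
  integrable_comp_matAct hM (integrable_gauss hb)

lemma integral_gauss_phase {b : ℝ} (hb : 0 < b) : ∫ ρ : Phase d, gauss b ρ = (π / b) ^ d := by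
  rw [integral_gauss hb, finrank_phase]
  push_cast
  rw [mul_div_cancel_left₀ _ two_ne_zero, Real.rpow_natCast]

lemma integral_gauss_matAct (hM : M.det ≠ 0) {b : ℝ} (hb : 0 < b) :
    ∫ ρ : Phase d, gauss b (matAct M ρ) = |M.det|⁻¹ * (π / b) ^ d := by
  rw [integral_comp_matAct hM, integral_gauss_phase hb, smul_eq_mul]

lemma sympForm_add_sub (s t : Phase d) : sympForm (s + t) (s - t) = -2 * sympForm s t := by
  obtain ⟨x, ξ, rfl⟩ := exists_phasePt_eq s
  obtain ⟨y, η, rfl⟩ := exists_phasePt_eq t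
  rw [phasePt_add, phasePt_sub, sympForm_phasePt, sympForm_phasePt]
  simp only [inner_add_left, inner_sub_right]
  rw [real_inner_comm ξ x, real_inner_comm ξ y, real_inner_comm η x, real_inner_comm η y]
  ring

@[fun_prop] lemma _root_.Continuous.sympForm {X : Type*} [TopologicalSpace X] {f g : X → Phase d}
    (hf : Continuous f) (hg : Continuous g) : Continuous fun x => sympForm (f x) (g x) :=
  Continuous.inner hf (hg.matAct (M := Matrix.J (Fin d) ℝ))

/-- The matrix `h J Mᵀ`. -/
def sympDual (h : ℝ) (M : Matrix (Fin d ⊕ Fin d) (Fin d ⊕ Fin d) ℝ) :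
    Matrix (Fin d ⊕ Fin d) (Fin d ⊕ Fin d) ℝ :=
  h • (Matrix.J (Fin d) ℝ * M.transpose)

/-- Since `J ^ 2 = -1`, the substitution `s = h J Mᵀ y` turns the symplectic phase into a Euclidean
pairing with `M t`, the very variable in which the Gaussian is standard. -/
lemma sympForm_sympDual (y t : Phase d) :
    sympForm (matAct (sympDual h M) y) t = h * inner ℝ y (matAct M t) := by
  have h1 : sympDual h M = (h • (M * (Matrix.J (Fin d) ℝ).transpose)).transpose := by
    rw [sympDual, Matrix.transpose_smul, Matrix.transpose_mul, Matrix.transpose_transpose]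
  have h2 : h • (M * (Matrix.J (Fin d) ℝ).transpose) * Matrix.J (Fin d) ℝ = h • M := by
    rw [Matrix.smul_mul, Matrix.mul_assoc, Matrix.J_transpose, Matrix.neg_mul, Matrix.J_squared,
      neg_neg, Matrix.mul_one]
  have h3 : matAct (h • M) t = h • matAct M t := by
    ext i; simp [matAct, Matrix.smul_mulVec]
  rw [sympForm, h1, inner_matAct_transpose, ← matAct_mul, h2, h3, real_inner_smul_right]

lemma abs_det_sympDual (hh : 0 < h) : |(sympDual h M).det| = h ^ (2 * d) * |M.det| := by
  have hJ : |(Matrix.J (Fin d) ℝ).det| = 1 := by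
    have := Matrix.J_det_mul_J_det (Fin d) ℝ
    rw [← abs_mul_self, abs_mul] at this
    nlinarith [abs_nonneg (Matrix.J (Fin d) ℝ).det]
  rw [sympDual, Matrix.det_smul, Matrix.det_mul, Matrix.det_transpose, abs_mul, abs_mul, hJ,
    one_mul, abs_of_pos (by positivity)]
  simp [two_mul]

/-- The Gaussian with quadratic form `‖M ρ‖²`, normalized in `L²`. -/
def normGaussian (M : Matrix (Fin d ⊕ Fin d) (Fin d ⊕ Fin d) ℝ) (ρ : Phase d) : ℂ :=
  (((2 : ℝ) ^ ((d : ℝ) / 2) * |M.det| ^ ((1 : ℝ) / 2) * gauss π (matAct M ρ) : ℝ) : ℂ)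

/-- The Moyal square of `normGaussian M`. -/
def moyalKernel (h : ℝ) (M : Matrix (Fin d ⊕ Fin d) (Fin d ⊕ Fin d) ℝ) (ρ : Phase d) : ℝ :=
  (4 / π ^ 2) ^ d * |M.det| *
    ∫ y, gauss (2 * π) (matAct M (ρ + matAct (sympDual h M) y)) * gauss (2 / π) y

lemma normGaussian_mul (ρ ρ' : Phase d) : normGaussian M ρ * normGaussian M ρ' =
    ((2 ^ d * |M.det| * (gauss π (matAct M ρ) * gauss π (matAct M ρ')) : ℝ) : ℂ) := by
  have h1 : (2 : ℝ) ^ ((d : ℝ) / 2) * 2 ^ ((d : ℝ) / 2) = 2 ^ d := by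
    rw [← Real.rpow_add two_pos, add_halves, Real.rpow_natCast]
  have h2 : |M.det| ^ ((1 : ℝ) / 2) * |M.det| ^ ((1 : ℝ) / 2) = |M.det| := by
    rw [← Real.sqrt_eq_rpow, Real.mul_self_sqrt (abs_nonneg _)]
  rw [normGaussian, normGaussian, ← Complex.ofReal_mul]
  congr 1
  calc _ = ((2 : ℝ) ^ ((d : ℝ) / 2) * 2 ^ ((d : ℝ) / 2)) *
        (|M.det| ^ ((1 : ℝ) / 2) * |M.det| ^ ((1 : ℝ) / 2)) *
        (gauss π (matAct M ρ) * gauss π (matAct M ρ')) := by ring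
    _ = _ := by rw [h1, h2]

lemma integral_ex_mul_gauss_matAct (hM : M.det ≠ 0) (y : Phase d) :
    ∫ t : Phase d, ex (inner ℝ ((2 / π) • y) (matAct M t)) * (gauss (2 * π) (matAct M t) : ℂ) =
      ((|M.det|⁻¹ * ((1 / 2) ^ d * gauss (2 / π) y) : ℝ) : ℂ) := by
  rw [integral_comp_matAct hM (fun z => ex (inner ℝ ((2 / π) • y) z) * (gauss (2 * π) z : ℂ)),
    integral_ex_mul_gauss (by positivity), finrank_phase, gauss_smul, Complex.real_smul]
  have h1 : π ^ 2 / (2 * π) * (2 / π) ^ 2 = 2 / π := by field_simp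
  have h2 : (π / (2 * π)) ^ (((2 * d : ℕ) : ℝ) / 2) = (1 / 2) ^ d := by
    push_cast
    rw [mul_div_cancel_left₀ _ two_ne_zero, Real.rpow_natCast]
    congr 1
    field_simp
  rw [h1, h2]
  push_cast
  ring

/-- The Moyal square of a Gaussian is a Gaussian average, hence nonnegative. -/
lemma moyal_normGaussian (hh : 0 < h) (hM : M.det ≠ 0) (ρ : Phase d) :
    moyal h (normGaussian M) (normGaussian M) ρ = (moyalKernel h M ρ : ℂ) := by
  have hD : 0 < |M.det| := abs_pos.mpr hM
  set κ : ℝ := 2 ^ d * |M.det| with hκ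
  set I : Phase d × Phase d → ℂ := fun w =>
    Complex.exp (-(2 * Complex.I) * ((sympForm w.1 w.2 / h : ℝ) : ℂ)) *
      normGaussian M (ρ + w.1) * normGaussian M (ρ + w.2) with hI
  set H : Phase d × Phase d → ℂ := fun z =>
    ex (2 / π * (sympForm z.1 z.2 / h)) *
      ((κ * (gauss (2 * π) (matAct M (ρ + z.1)) * gauss (2 * π) (matAct M z.2)) : ℝ) : ℂ) with hH
  have hnexp : ∀ r : ℝ, ‖Complex.exp (-(2 * Complex.I) * (r : ℂ))‖ = 1 := fun r => by
    rw [show -(2 * Complex.I) * (r : ℂ) = ((-2 * r : ℝ) : ℂ) * Complex.I by push_cast; ring,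
      Complex.norm_exp_ofReal_mul_I]
  have hIi : Integrable I (volume.prod volume) := by
    have h1 : Integrable (fun w : Phase d × Phase d => κ *
        (gauss π (matAct M (ρ + w.1)) * gauss π (matAct M (ρ + w.2)))) (volume.prod volume) :=
      (((integrable_gauss_matAct hM pi_pos).comp_add_left ρ).mul_prod
        ((integrable_gauss_matAct hM pi_pos).comp_add_left ρ)).const_mul κ
    refine h1.mono' (Continuous.aestronglyMeasurable ?_) (Filter.Eventually.of_forall fun w => ?_)
    · simp only [hI, normGaussian]; fun_prop
    · simp only [hI]
      rw [mul_assoc, norm_mul, hnexp, one_mul, normGaussian_mul, Complex.norm_real,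
        Real.norm_of_nonneg (mul_nonneg (by positivity)
          (mul_pos (gauss_pos _ _) (gauss_pos _ _)).le)]
  have hHi : Integrable H (volume.prod volume) := by
    have h1 : Integrable (fun w : Phase d × Phase d => κ *
        (gauss (2 * π) (matAct M (ρ + w.1)) * gauss (2 * π) (matAct M w.2)))
        (volume.prod volume) :=
      (((integrable_gauss_matAct hM (by positivity)).comp_add_left ρ).mul_prod
        (integrable_gauss_matAct hM (by positivity))).const_mul κ
    refine (integrable_ex_mul (g := fun z => 2 / π * (sympForm z.1 z.2 / h)) h1.ofReal
      (Continuous.measurable (by fun_prop))).congr (Filter.Eventually.of_forall fun z => ?_)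
    simp only [hH]
    rw [mul_comm]
    rfl
  -- With first variable `w + 2t` and second variable `w`, the half sum is `w + t` and the half
  -- difference `t`. The product of Gaussians decouples in these, and the bilinear phase becomes `4
  -- σ(w + t, t) / h`, that is `2π` times `(2 / π) σ / h`.
  have hIH : ∀ w t : Phase d, I (w + (2 : ℝ) • t, w) = H (w + t, t) := by
    intro w t
    have e1 : w + (2 : ℝ) • t = (w + t) + t := by module
    have e2 : w = (w + t) - t := by abel
    have e3 : sympForm (w + (2 : ℝ) • t) w = -2 * sympForm (w + t) t := by
      rw [← sympForm_add_sub, ← e1, ← e2]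
    have e4 : ρ + (w + (2 : ℝ) • t) = (ρ + (w + t)) + t := by module
    have e5 : ρ + w = (ρ + (w + t)) - t := by abel
    simp only [hI, hH]
    rw [mul_assoc, normGaussian_mul, e3, e4, e5, matAct_add (M := M) (ρ + (w + t)) t, matAct_sub,
      gauss_add_mul_gauss_sub, ex]
    congr 2
    have := pi_ne_zero
    push_cast
    have hp : (π : ℂ) ≠ 0 := by exact_mod_cast this
    field_simp
  have h1 : ∀ w : Phase d, ∫ w₁, I (w₁, w) = (4 : ℂ) ^ d * ∫ t, H (w + t, t) := by
    intro w
    have e := Measure.integral_comp_smul (volume : Measure (Phase d)) (fun v => I (w + v, w)) 2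
    simp_rw [hIH] at e
    rw [e, integral_add_left_eq_self (fun v => I (v, w)), finrank_phase, abs_of_pos (by positivity),
      Complex.real_smul, ← mul_assoc]
    have : (4 : ℂ) ^ d * (((2 ^ (2 * d))⁻¹ : ℝ) : ℂ) = 1 := by
      push_cast
      rw [pow_mul, show (2 : ℂ) ^ 2 = 4 by norm_num, mul_inv_cancel₀ (by simp)]
    rw [this, one_mul]
  have h2 : ∫ w, I w = (4 : ℂ) ^ d * ∫ s, ∫ t, H (s, t) := by
    calc ∫ w, I w = ∫ w₂, ∫ w₁, I (w₁, w₂) :=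
          integral_prod_symm (μ := (volume : Measure (Phase d)))
            (ν := (volume : Measure (Phase d))) _ hIi
      _ = (4 : ℂ) ^ d * ∫ w, ∫ t, H (w + t, t) := by
          simp_rw [h1]; rw [integral_const_mul]
      _ = (4 : ℂ) ^ d * ∫ t, ∫ w, H (w + t, t) := by
          rw [integral_integral_swap]
          exact integrable_comp_shear hHi (ContinuousLinearMap.id ℝ (Phase d))
      _ = (4 : ℂ) ^ d * ∫ t, ∫ s, H (s, t) := by
          congr 1
          refine integral_congr_ae (Filter.Eventually.of_forall fun t => ?_)
          exact integral_add_right_eq_self (fun s => H (s, t)) t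
      _ = _ := by
          rw [integral_integral_swap]
          exact hHi.swap
  have hdet : (sympDual h M).det ≠ 0 := by
    rw [← abs_pos, abs_det_sympDual hh]; positivity
  -- The substitution by `sympDual h M` prepares the integral in `t` for
  -- `integral_ex_mul_gauss_matAct`; its Jacobian will cancel the powers of `h`.
  have h3 : ∫ s, ∫ t, H (s, t) = ((h ^ (2 * d) * |M.det| : ℝ) : ℂ) *
      ∫ y, ∫ t, H (matAct (sympDual h M) y, t) := by
    rw [integral_comp_matAct hdet (fun s => ∫ t, H (s, t)), abs_det_sympDual hh, Complex.real_smul,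
      ← mul_assoc, ← Complex.ofReal_mul, mul_inv_cancel₀ (by positivity), Complex.ofReal_one,
      one_mul]
  have h4 : ∀ y : Phase d, ∫ t, H (matAct (sympDual h M) y, t) =
      ((gauss (2 * π) (matAct M (ρ + matAct (sympDual h M) y)) * gauss (2 / π) y : ℝ) : ℂ) := by
    intro y
    have e := integral_ex_mul_gauss_matAct hM y
    have e2 : ∀ t, H (matAct (sympDual h M) y, t) =
        ((κ * gauss (2 * π) (matAct M (ρ + matAct (sympDual h M) y)) : ℝ) : ℂ) *
        (ex (inner ℝ ((2 / π) • y) (matAct M t)) * (gauss (2 * π) (matAct M t) : ℂ)) := by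
      intro t
      simp only [hH]
      rw [sympForm_sympDual, mul_div_cancel_left₀ _ hh.ne', real_inner_smul_left]
      push_cast; ring
    simp_rw [e2]
    rw [integral_const_mul, e, ← Complex.ofReal_mul]
    congr 1
    rw [hκ]
    have : (2 : ℝ) ^ d * (1 / 2) ^ d = 1 := by rw [← mul_pow]; norm_num
    calc _ = ((2 : ℝ) ^ d * (1 / 2) ^ d) * (|M.det| * |M.det|⁻¹) * (gauss (2 * π)
          (matAct M (ρ + matAct (sympDual h M) y)) * gauss (2 / π) y) := by ring
      _ = _ := by rw [this, mul_inv_cancel₀ hD.ne', one_mul, one_mul]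
  change (((π * h) ^ (2 * d) : ℝ) : ℂ)⁻¹ * ∫ w, I w = _
  rw [h2, h3]
  simp_rw [h4]
  have key : ((π * h) ^ (2 * d))⁻¹ * (4 ^ d * (h ^ (2 * d) * |M.det|)) =
      (4 / π ^ 2) ^ d * |M.det| := by
    rw [mul_pow, pow_mul π, div_pow]
    field_simp
  rw [integral_complex_ofReal, moyalKernel, ← key]
  push_cast
  ring

end GaussianKernel

/-! ### Mass, decay and first moment of the kernel; comparison of the two quantizations. -/

section KernelBounds

lemma integrable_norm_mul_gauss {V : Type*} [NormedAddCommGroup V] [InnerProductSpace ℝ V]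
    [FiniteDimensional ℝ V] [MeasurableSpace V] [BorelSpace V] {b : ℝ} (hb : 0 < b) :
    Integrable fun x : V => ‖x‖ * gauss b x := by
  have := (gaussSchwartz V b hb).integrable_pow_mul volume 1
  refine this.congr (Filter.Eventually.of_forall fun x => ?_)
  simp only
  rw [pow_one, gaussSchwartz_apply, Complex.norm_real, Real.norm_of_nonneg (gauss_pos _ _).le]

variable {d : ℕ} {h : ℝ} {M : Matrix (Fin d ⊕ Fin d) (Fin d ⊕ Fin d) ℝ}

lemma moyalKernel_integrand_le (ρ y : Phase d) :
    gauss (2 * π) (matAct M (ρ + matAct (sympDual h M) y)) * gauss (2 / π) y ≤ gauss (2 / π) y :=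
  mul_le_of_le_one_left (gauss_pos _ _).le (gauss_le_one (by positivity) _)

lemma moyalKernel_nonneg (ρ : Phase d) : 0 ≤ moyalKernel h M ρ :=
  mul_nonneg (by positivity)
    (integral_nonneg fun y => (mul_pos (gauss_pos _ _) (gauss_pos _ _)).le)

lemma continuous_moyalKernel : Continuous (moyalKernel h M) := by
  have h1 : Continuous fun ρ : Phase d =>
      ∫ y, gauss (2 * π) (matAct M (ρ + matAct (sympDual h M) y)) * gauss (2 / π) y := by
    refine continuous_of_dominated (bound := gauss (2 / π))
      (fun ρ => Continuous.aestronglyMeasurable (by fun_prop)) (fun ρ => ?_)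
      (integrable_gauss (by positivity)) (Filter.Eventually.of_forall fun y => by fun_prop)
    refine Filter.Eventually.of_forall fun y => ?_
    rw [Real.norm_of_nonneg (mul_pos (gauss_pos _ _) (gauss_pos _ _)).le]
    exact moyalKernel_integrand_le ρ y
  exact continuous_const.mul h1

lemma integrable_moyalKernel (hM : M.det ≠ 0) : Integrable (moyalKernel h M) :=
  (integrable_shear_mul (P := fun ρ : Phase d => gauss (2 * π) (matAct M ρ)) (Q := gauss (2 / π))
    (integrable_gauss_matAct hM (by positivity)) (integrable_gauss (by positivity))
    (matL (sympDual h M))).integral_prod_left.const_mul _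

/-- The shear removes the coupling between `ρ` and `y`, so the mass is a product of two explicit
Gaussian integrals that the prefactor cancels. -/
lemma integral_moyalKernel (hM : M.det ≠ 0) : ∫ ρ, moyalKernel h M ρ = 1 := by
  have hD : 0 < |M.det| := abs_pos.mpr hM
  have e := integral_shear_mul (P := fun ρ : Phase d => gauss (2 * π) (matAct M ρ))
    (Q := gauss (2 / π)) (integrable_gauss_matAct hM (by positivity))
    (integrable_gauss (by positivity)) (matL (sympDual h M))
  simp only [moyalKernel]
  rw [integral_const_mul]
  simp only [matL_apply] at e
  rw [e, integral_gauss_matAct hM (by positivity), integral_gauss_phase (by positivity)]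
  have h1 : (4 / π ^ 2) ^ d * ((π / (2 * π)) ^ d * (π / (2 / π)) ^ d) = 1 := by
    rw [← mul_pow, ← mul_pow]
    have : 4 / π ^ 2 * (π / (2 * π) * (π / (2 / π))) = 1 := by field_simp; norm_num
    rw [this, one_pow]
  calc _ = (|M.det| * |M.det|⁻¹) *
        ((4 / π ^ 2) ^ d * ((π / (2 * π)) ^ d * (π / (2 / π)) ^ d)) := by ring
    _ = 1 := by rw [h1, mul_inv_cancel₀ hD.ne', one_mul]

variable {Λ : ℝ}

/-- A point is split into its sheared position and the shear, each controlled by one of the two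
Gaussian variables; a single `Λ` handles both. -/
lemma norm_le_of_matAct (hM : ∀ ρ, ‖ρ‖ ≤ Λ * ‖matAct M ρ‖)
    (hR : ∀ y, ‖matAct (sympDual h M) y‖ ≤ Λ * ‖y‖) (ρ y : Phase d) :
    ‖ρ‖ ≤ Λ * (‖matAct M (ρ + matAct (sympDual h M) y)‖ + ‖y‖) :=
  calc ‖ρ‖ = ‖(ρ + matAct (sympDual h M) y) - matAct (sympDual h M) y‖ := by
        rw [add_sub_cancel_right]
    _ ≤ ‖ρ + matAct (sympDual h M) y‖ + ‖matAct (sympDual h M) y‖ := norm_sub_le _ _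
    _ ≤ Λ * ‖matAct M (ρ + matAct (sympDual h M) y)‖ + Λ * ‖y‖ := add_le_add (hM _) (hR _)
    _ = _ := by ring

/-- The Moyal square of a Gaussian has Gaussian decay. -/
lemma exists_moyalKernel_le (hM : ∀ ρ, ‖ρ‖ ≤ Λ * ‖matAct M ρ‖)
    (hR : ∀ y, ‖matAct (sympDual h M) y‖ ≤ Λ * ‖y‖) :
    ∃ C c : ℝ, 0 < c ∧ ∀ ρ, moyalKernel h M ρ ≤ C * gauss c ρ := by
  -- The exponent is chosen so that `c ‖ρ‖ ^ 2` costs at most `1 / π` of each Gaussian variable;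
  -- since `2 / π = 1 / π + 1 / π`, half of the weight in `y` remains and is integrable.
  refine ⟨(4 / π ^ 2) ^ d * |M.det| * ∫ y : Phase d, gauss (1 / π) y, 1 / (2 * π * (1 + Λ ^ 2)),
    by positivity, fun ρ => ?_⟩
  set c := 1 / (2 * π * (1 + Λ ^ 2)) with hc
  have hpt : ∀ y, gauss (2 * π) (matAct M (ρ + matAct (sympDual h M) y)) * gauss (2 / π) y ≤
      gauss (1 / π) y * gauss c ρ := by
    intro y
    simp only [gauss]
    rw [← Real.exp_add, ← Real.exp_add]
    refine Real.exp_le_exp.mpr ?_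
    have h1 := norm_le_of_matAct hM hR ρ y
    set A := ‖matAct M (ρ + matAct (sympDual h M) y)‖ with hA
    set Y := ‖y‖ with hY
    have h2 : ‖ρ‖ ^ 2 ≤ 2 * (1 + Λ ^ 2) * (A ^ 2 + Y ^ 2) := by
      have h3 : ‖ρ‖ ^ 2 ≤ (Λ * (A + Y)) ^ 2 := pow_le_pow_left₀ (norm_nonneg _) h1 2
      have h4 : (A + Y) ^ 2 ≤ 2 * (A ^ 2 + Y ^ 2) := by nlinarith [sq_nonneg (A - Y)]
      nlinarith [mul_le_mul_of_nonneg_left h4 (sq_nonneg Λ), sq_nonneg A, sq_nonneg Y]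
    have h5 : c * ‖ρ‖ ^ 2 ≤ 1 / π * (A ^ 2 + Y ^ 2) := by
      calc c * ‖ρ‖ ^ 2 ≤ c * (2 * (1 + Λ ^ 2) * (A ^ 2 + Y ^ 2)) := by gcongr
        _ = _ := by rw [hc]; field_simp
    have h6 : 1 / π ≤ 2 * π := by
      rw [div_le_iff₀ pi_pos]; nlinarith [pi_gt_three]
    have h7 : 2 / π = 1 / π + 1 / π := by ring
    rw [h7]
    nlinarith [mul_le_mul_of_nonneg_right h6 (sq_nonneg A)]
  rw [moyalKernel, mul_assoc _ (∫ y : Phase d, gauss (1 / π) y), ← integral_mul_const]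
  refine mul_le_mul_of_nonneg_left ?_ (by positivity)
  refine integral_mono_of_nonneg
    (Filter.Eventually.of_forall fun y => (mul_pos (gauss_pos _ _) (gauss_pos _ _)).le)
    ((integrable_gauss (by positivity)).mul_const _) (Filter.Eventually.of_forall hpt)

variable (d) in
/-- The first moment of the Moyal square of a Gaussian. -/
lemma exists_moment_moyalKernel_le : ∃ C : ℝ, 0 ≤ C ∧ ∀ (h : ℝ)
    (M : Matrix (Fin d ⊕ Fin d) (Fin d ⊕ Fin d) ℝ) (Λ : ℝ), M.det ≠ 0 →
      (∀ ρ, ‖ρ‖ ≤ Λ * ‖matAct M ρ‖) → (∀ y, ‖matAct (sympDual h M) y‖ ≤ Λ * ‖y‖) →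
      Integrable (fun ρ => |moyalKernel h M ρ| * ‖ρ‖) ∧
        ∫ ρ, |moyalKernel h M ρ| * ‖ρ‖ ≤ C * Λ := by
  set m : ℝ := ∫ v : Phase d, ‖v‖ * gauss (2 * π) v with hm
  set m' : ℝ := ∫ v : Phase d, ‖v‖ * gauss (2 / π) v with hm'
  have hm0 : 0 ≤ m := integral_nonneg fun v => mul_nonneg (norm_nonneg _) (gauss_pos _ _).le
  have hm'0 : 0 ≤ m' := integral_nonneg fun v => mul_nonneg (norm_nonneg _) (gauss_pos _ _).le
  refine ⟨(4 / π ^ 2) ^ d * (m * (π / (2 / π)) ^ d + (π / (2 * π)) ^ d * m'), by positivity,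
    fun h M Λ hM hΛ hR => ?_⟩
  have hD : 0 < |M.det| := abs_pos.mpr hM
  set R := matL (sympDual h M) with hRdef
  set P : Phase d → ℝ := fun ρ => gauss (2 * π) (matAct M ρ) with hP
  set P₁ : Phase d → ℝ := fun ρ => ‖matAct M ρ‖ * gauss (2 * π) (matAct M ρ) with hP₁
  set Q : Phase d → ℝ := gauss (2 / π) with hQ
  set Q₁ : Phase d → ℝ := fun y => ‖y‖ * gauss (2 / π) y with hQ₁
  have iP : Integrable P := integrable_gauss_matAct hM (by positivity)
  have iP₁ : Integrable P₁ := integrable_comp_matAct (f := fun v => ‖v‖ * gauss (2 * π) v) hM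
    (integrable_norm_mul_gauss (by positivity))
  have iQ : Integrable Q := integrable_gauss (by positivity)
  have iQ₁ : Integrable Q₁ := integrable_norm_mul_gauss (by positivity)
  have i1 := integrable_shear_mul iP₁ iQ R
  have i2 := integrable_shear_mul iP iQ₁ R
  -- The weight `‖ρ‖` is exchanged for `Λ` times moments of the two Gaussian variables, whose
  -- integrals factor after the shear and, after cancellation of `|M.det|`, depend on `d` alone.
  have hpt : ∀ ρ y : Phase d, P (ρ + R y) * Q y * ‖ρ‖ ≤
      Λ * (P₁ (ρ + R y) * Q y + P (ρ + R y) * Q₁ y) := by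
    intro ρ y
    calc P (ρ + R y) * Q y * ‖ρ‖ ≤ P (ρ + R y) * Q y * (Λ * (‖matAct M (ρ + R y)‖ + ‖y‖)) :=
          mul_le_mul_of_nonneg_left (norm_le_of_matAct hΛ hR ρ y)
            (mul_pos (gauss_pos _ _) (gauss_pos _ _)).le
      _ = _ := by simp only [hP, hP₁, hQ, hQ₁]; ring
  have hnn : ∀ ρ y : Phase d, 0 ≤ P (ρ + R y) * Q y * ‖ρ‖ := fun ρ y =>
    mul_nonneg (mul_pos (gauss_pos _ _) (gauss_pos _ _)).le (norm_nonneg _)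
  have i3 : Integrable (fun z : Phase d × Phase d => Λ * (P₁ (z.1 + R z.2) * Q z.2 +
      P (z.1 + R z.2) * Q₁ z.2)) (volume.prod volume) := (i1.add i2).const_mul Λ
  have i4 : Integrable (fun z : Phase d × Phase d => P (z.1 + R z.2) * Q z.2 * ‖z.1‖)
      (volume.prod volume) := by
    refine i3.mono' (Continuous.aestronglyMeasurable ?_) (Filter.Eventually.of_forall fun z => ?_)
    · simp only [hP, hQ]; fun_prop
    · rw [Real.norm_of_nonneg (hnn _ _)]; exact hpt _ _
  have hK : ∀ ρ, |moyalKernel h M ρ| * ‖ρ‖ =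
      (4 / π ^ 2) ^ d * |M.det| * ∫ y, P (ρ + R y) * Q y * ‖ρ‖ := by
    intro ρ
    rw [abs_of_nonneg (moyalKernel_nonneg ρ), moyalKernel, mul_assoc, ← integral_mul_const]
    rfl
  have hle : ∫ ρ, ∫ y, P (ρ + R y) * Q y * ‖ρ‖ ≤ Λ * ((∫ ρ, P₁ ρ) * (∫ y, Q y) +
      (∫ ρ, P ρ) * ∫ y, Q₁ y) := by
    calc ∫ ρ, ∫ y, P (ρ + R y) * Q y * ‖ρ‖
        = ∫ z, P (z.1 + R z.2) * Q z.2 * ‖z.1‖ ∂(volume.prod volume) := (integral_prod _ i4).symm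
      _ ≤ ∫ z, Λ * (P₁ (z.1 + R z.2) * Q z.2 + P (z.1 + R z.2) * Q₁ z.2) ∂(volume.prod volume) :=
          integral_mono i4 i3 fun z => hpt _ _
      _ = _ := by
          rw [integral_const_mul, integral_add i1 i2, integral_prod _ i1, integral_prod _ i2,
            integral_shear_mul iP₁ iQ R, integral_shear_mul iP iQ₁ R]
  have eP : ∫ ρ, P ρ = |M.det|⁻¹ * (π / (2 * π)) ^ d := integral_gauss_matAct hM (by positivity)
  have eP₁ : ∫ ρ, P₁ ρ = |M.det|⁻¹ * m := by
    have := integral_comp_matAct hM fun v => ‖v‖ * gauss (2 * π) v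
    rw [smul_eq_mul] at this
    exact this
  have eQ : ∫ y, Q y = (π / (2 / π)) ^ d := integral_gauss_phase (by positivity)
  rw [eP, eP₁, eQ] at hle
  simp_rw [hK]
  refine ⟨i4.integral_prod_left.const_mul _, ?_⟩
  rw [integral_const_mul]
  calc _ ≤ (4 / π ^ 2) ^ d * |M.det| * (Λ * ((|M.det|⁻¹ * m) * (π / (2 / π)) ^ d +
        (|M.det|⁻¹ * (π / (2 * π)) ^ d) * m')) := mul_le_mul_of_nonneg_left hle (by positivity)
    _ = (|M.det| * |M.det|⁻¹) * ((4 / π ^ 2) ^ d *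
        (m * (π / (2 / π)) ^ d + (π / (2 * π)) ^ d * m') * Λ) := by ring
    _ = _ := by rw [mul_inv_cancel₀ hD.ne', one_mul]

lemma continuous_normGaussian : Continuous (normGaussian M) := by
  unfold normGaussian; fun_prop

lemma exists_norm_normGaussian_le (hM : ∀ ρ, ‖ρ‖ ≤ Λ * ‖matAct M ρ‖) :
    ∃ C c : ℝ, 0 < c ∧ ∀ ρ, ‖normGaussian M ρ‖ ≤ C * gauss c ρ := by
  refine ⟨(2 : ℝ) ^ ((d : ℝ) / 2) * |M.det| ^ ((1 : ℝ) / 2), π / (1 + Λ ^ 2), by positivity,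
    fun ρ => ?_⟩
  rw [normGaussian, Complex.norm_real, Real.norm_of_nonneg
    (mul_nonneg (by positivity) (gauss_pos _ _).le)]
  gcongr
  rw [gauss, gauss]
  refine Real.exp_le_exp.mpr (neg_le_neg ?_)
  have h1 : ‖ρ‖ ^ 2 ≤ (1 + Λ ^ 2) * ‖matAct M ρ‖ ^ 2 := by
    have := pow_le_pow_left₀ (norm_nonneg _) (hM ρ) 2
    nlinarith [sq_nonneg ‖matAct M ρ‖]
  rw [div_mul_eq_mul_div, div_le_iff₀ (by positivity)]
  nlinarith [mul_le_mul_of_nonneg_left h1 pi_pos.le]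

/-- A linear change of variables in a fixed Schwartz function. The bound may depend on `M`, since it
serves only to produce a bounded operator and enters no estimate. -/
lemma normGaussian_bounds (n : ℕ) : ContDiff ℝ n (normGaussian M) ∧
    ∃ B : ℝ, ∀ k ≤ n, ∀ ρ, ‖iteratedFDeriv ℝ k (normGaussian M) ρ‖ ≤ B := by
  set κ : ℝ := (2 : ℝ) ^ ((d : ℝ) / 2) * |M.det| ^ ((1 : ℝ) / 2) with hκ
  set φ : 𝓢(Phase d, ℂ) := (κ : ℂ) • gaussSchwartz (Phase d) π pi_pos with hφ
  have e : normGaussian M = fun ρ => φ (matL M ρ + 0) := funext fun ρ => by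
    rw [normGaussian, add_zero, hφ, smul_apply, gaussSchwartz_apply, Complex.ofReal_mul]
    rfl
  obtain ⟨B, hB0, hB⟩ := exists_norm_iteratedFDeriv_schwartz_le φ n
  rw [e]
  refine ⟨contDiff_comp_affine (φ.smooth n) _ _, B * (1 + ‖matL M‖) ^ n, fun k hk ρ => ?_⟩
  refine (norm_iteratedFDeriv_comp_affine_le (φ.smooth n) hB (matL M) 0 hk ρ).trans ?_
  gcongr
  calc ‖matL M‖ ^ k ≤ (1 + ‖matL M‖) ^ k :=
        pow_le_pow_left₀ (norm_nonneg _) (by linarith) k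
    _ ≤ _ := pow_le_pow_right₀ (by linarith [norm_nonneg (matL M)]) hk

variable (d) in
/-- Weyl quantization and the positive quantization that is built on a Gaussian differ little if
the Gaussian and its Moyal square are concentrated near the origin. -/
theorem exists_norm_weyl_sub_plus_le : ∃ C : ℝ, 0 ≤ C ∧ ∀ h ∈ Set.Ioc (0 : ℝ) 1,
    ∀ (M : Matrix (Fin d ⊕ Fin d) (Fin d ⊕ Fin d) ℝ) (Λ : ℝ), M.det ≠ 0 →
      (∀ ρ, ‖ρ‖ ≤ Λ * ‖matAct M ρ‖) → (∀ y, ‖matAct (sympDual h M) y‖ ≤ Λ * ‖y‖) →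
      ∀ (a : Phase d → ℂ) (N : ℝ), ContDiff ℝ (2 * d + 2 : ℕ) a →
        (∀ k ≤ 2 * d + 2, ∀ ρ, ‖iteratedFDeriv ℝ k a ρ‖ ≤ N) →
        ∃ S T Tplus : Lp ℂ 2 (volume : Measure (Config d)) →L[ℂ]
            Lp ℂ 2 (volume : Measure (Config d)),
          IsWeylOp h (normGaussian M) S ∧
          IsWeylOp h (moyal h (normGaussian M) (normGaussian M)) (S ∘L S) ∧
          IsWeylOp h a T ∧
          IsWeylOp h (conv a (moyal h (normGaussian M) (normGaussian M))) Tplus ∧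
          ‖T - Tplus‖ ≤ C * N * Λ := by
  obtain ⟨C₁, hC₁, hCV⟩ := exists_isWeylOp d
  obtain ⟨C₂, hC₂, hmom⟩ := exists_moment_moyalKernel_le d
  refine ⟨C₁ * C₂, by positivity, fun h hh M Λ hM hΛ hR a N ha hN => ?_⟩
  obtain ⟨hi, hle⟩ := hmom h M Λ hM hΛ hR
  have hN0 : 0 ≤ N := (norm_nonneg _).trans (hN 0 (Nat.zero_le _) 0)
  have hmoy : moyal h (normGaussian M) (normGaussian M) = fun ρ => (moyalKernel h M ρ : ℂ) :=
    funext fun ρ => moyal_normGaussian hh.1 hM ρ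
  obtain ⟨hG, B, hB⟩ := normGaussian_bounds (M := M) (2 * d + 1)
  obtain ⟨S, hS, -⟩ := hCV h hh _ B hG hB
  obtain ⟨T, hT, -⟩ := hCV h hh a N (ha.of_le (by exact_mod_cast (by omega)))
    fun k hk => hN k (by omega)
  -- The smoothing error costs one derivative: `2 * d + 2` for the symbol leave the `2 * d + 1` that
  -- Calderón–Vaillancourt requires.
  obtain ⟨hs1, hs2⟩ := contDiff_smoothErr (integrable_moyalKernel (h := h) hM) hi (2 * d + 1) ha hN
  obtain ⟨T₀, hT₀, hT₀n⟩ := hCV h hh _ _ hs1 hs2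
  -- The positive quantization is obtained by difference, its symbol being `a` minus the smoothing
  -- error; the norm to be estimated is then that of `T₀`.
  refine ⟨S, T, T - T₀, hS, ?_, hT, ?_, ?_⟩
  · obtain ⟨C, c, hc, hGle⟩ := exists_norm_normGaussian_le hΛ
    obtain ⟨C', c', hc', hKle⟩ := exists_moyalKernel_le hΛ hR
    refine isWeylOp_comp_self (C' := C') (c' := c') hh.1 hc continuous_normGaussian hGle hc' ?_ ?_ hS
    · rw [hmoy]; exact Complex.continuous_ofReal.comp continuous_moyalKernel
    · intro ρ
      rw [hmoy, Complex.norm_real, Real.norm_of_nonneg (moyalKernel_nonneg ρ)]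
      exact hKle ρ
  · have e : conv a (moyal h (normGaussian M) (normGaussian M)) =
        fun ρ => a ρ - smoothErr (moyalKernel h M) a ρ := funext fun ρ => by
      rw [← sub_conv_eq_smoothErr (integrable_moyalKernel hM) (integral_moyalKernel hM)
        ha.continuous (M := N) (fun ρ => by simpa using hN 0 (Nat.zero_le _) ρ) ρ, sub_sub_cancel,
        hmoy]
    rw [e]
    exact isWeylOp_sub hT hT₀
  · rw [sub_sub_cancel]
    refine hT₀n.trans ?_
    calc C₁ * (N * ∫ t, |moyalKernel h M t| * ‖t‖) ≤ C₁ * (N * (C₂ * Λ)) := by gcongr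
      _ = _ := by ring

end KernelBounds

/-! ### Eigenvalues under conjugation, reindexing and the `⋄`-product. -/

section ComplexSpectrum

variable {n m : Type} [Fintype n] [DecidableEq n] [Fintype m] [DecidableEq m]

lemma mem_complexSpectrum_iff {N : Matrix n n ℝ} {z : ℂ} :
    z ∈ complexSpectrum N ↔
      ∃ v : n → ℂ, v ≠ 0 ∧ (N.map fun t : ℝ => (t : ℂ)).mulVec v = z • v := by
  rw [complexSpectrum, ← Matrix.spectrum_toLin', ← Module.End.hasEigenvalue_iff_mem_spectrum]
  constructor
  · intro hz
    obtain ⟨v, hv⟩ := hz.exists_hasEigenvector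
    exact ⟨v, hv.2, by simpa using hv.apply_eq_smul⟩
  · rintro ⟨v, hv0, hv⟩
    refine Module.End.hasEigenvalue_of_hasEigenvector (x := v) ⟨?_, hv0⟩
    rw [Module.End.mem_eigenspace_iff]
    simpa using hv

lemma complexSpectrum_finite (N : Matrix n n ℝ) : (complexSpectrum N).Finite :=
  Matrix.finite_spectrum _

lemma complexSpectrum_nonempty [Nonempty n] (N : Matrix n n ℝ) : (complexSpectrum N).Nonempty :=
  spectrum.nonempty_of_isAlgClosed_of_finiteDimensional ℂ _

lemma map_ofReal_mul (N N' : Matrix n n ℝ) : (N * N').map (fun t : ℝ => (t : ℂ)) =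
    N.map (fun t : ℝ => (t : ℂ)) * N'.map (fun t : ℝ => (t : ℂ)) :=
  Matrix.map_mul (f := Complex.ofRealHom)

lemma mem_complexSpectrum_conj {N Q : Matrix n n ℝ} (hQ : IsUnit Q.det) {z : ℂ}
    (hz : z ∈ complexSpectrum N) : z ∈ complexSpectrum (Q * N * Q⁻¹) := by
  obtain ⟨v, hv0, hv⟩ := mem_complexSpectrum_iff.mp hz
  have h1 : (Q⁻¹).map (fun t : ℝ => (t : ℂ)) * Q.map (fun t : ℝ => (t : ℂ)) = 1 := by
    rw [← map_ofReal_mul, Matrix.nonsing_inv_mul _ hQ]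
    exact Matrix.map_one _ Complex.ofReal_zero Complex.ofReal_one
  refine mem_complexSpectrum_iff.mpr
    ⟨(Q.map fun t : ℝ => (t : ℂ)).mulVec v, fun h0 => hv0 ?_, ?_⟩
  · have := congrArg ((Q⁻¹).map fun t : ℝ => (t : ℂ)).mulVec h0
    rwa [Matrix.mulVec_mulVec, h1, Matrix.one_mulVec, Matrix.mulVec_zero] at this
  · rw [map_ofReal_mul, map_ofReal_mul, Matrix.mulVec_mulVec, Matrix.mul_assoc, h1, Matrix.mul_one,
      ← Matrix.mulVec_mulVec, hv, Matrix.mulVec_smul]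

lemma mem_complexSpectrum_reindex {N : Matrix n n ℝ} (e : n ≃ m) {z : ℂ}
    (hz : z ∈ complexSpectrum N) : z ∈ complexSpectrum (Matrix.reindex e e N) := by
  obtain ⟨v, hv0, hv⟩ := mem_complexSpectrum_iff.mp hz
  refine mem_complexSpectrum_iff.mpr ⟨v ∘ e.symm, fun h0 => hv0 ?_, ?_⟩
  · funext i
    simpa using congrFun h0 (e i)
  · have := Matrix.submatrix_mulVec_equiv (N.map fun t : ℝ => (t : ℂ)) (v ∘ e.symm) e.symm e.symm
    rw [Matrix.reindex_apply, ← Matrix.submatrix_map, this]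
    funext i
    simp only [Function.comp_apply, Equiv.symm_symm, Pi.smul_apply]
    have h2 : (v ∘ e.symm) ∘ e = v := by funext j; simp
    rw [h2, hv, Pi.smul_apply]

lemma blockDiagonal'_mulVec {ι : Type} [Fintype ι] [DecidableEq ι] {s : ι → Type}
    [∀ i, Fintype (s i)] (N : ∀ i, Matrix (s i) (s i) ℂ) (x : ∀ i, s i → ℂ) :
    (Matrix.blockDiagonal' N).mulVec (fun p => x p.1 p.2) =
      fun p => (N p.1).mulVec (x p.1) p.2 := by
  funext ⟨j, k⟩
  simp only [Matrix.mulVec, dotProduct, Fintype.sum_sigma]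
  rw [Finset.sum_eq_single j]
  · simp
  · intro i _ hi
    refine Finset.sum_eq_zero fun l _ => ?_
    rw [Matrix.blockDiagonal'_apply_ne _ _ _ hi.symm, zero_mul]
  · simp

/-- An eigenvector of the upper left block of one factor is extended by zero; the vanishing lower
left block keeps its image in the position coordinates. -/
lemma mem_complexSpectrum_diamondProd {r : ℕ} {dim : Fin (r + 1) → ℕ}
    {N : ∀ i, Matrix (Fin (dim i) ⊕ Fin (dim i)) (Fin (dim i) ⊕ Fin (dim i)) ℝ} {i : Fin (r + 1)}
    (hN : (N i).toBlocks₂₁ = 0) {z : ℂ} (hz : z ∈ complexSpectrum (N i).toBlocks₁₁) :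
    z ∈ complexSpectrum (diamondProd N) := by
  obtain ⟨v, hv0, hv⟩ := mem_complexSpectrum_iff.mp hz
  set x : ∀ j, Fin (dim j) → ℂ := Pi.single i v with hx
  refine mem_complexSpectrum_iff.mpr ⟨Sum.elim (fun p => x p.1 p.2) 0, fun h0 => hv0 ?_, ?_⟩
  · funext k
    have := congrFun h0 (Sum.inl ⟨i, k⟩)
    simpa [hx] using this
  · rw [diamondProd, Matrix.fromBlocks_map, Matrix.fromBlocks_mulVec]
    simp only [Sum.elim_comp_inl, Sum.elim_comp_inr, Matrix.mulVec_zero, add_zero]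
    rw [Matrix.blockDiagonal'_map _ _ Complex.ofReal_zero,
      Matrix.blockDiagonal'_map _ _ Complex.ofReal_zero, blockDiagonal'_mulVec,
      blockDiagonal'_mulVec]
    funext q
    rcases q with ⟨j, k⟩ | ⟨j, k⟩ <;> simp only [Sum.elim_inl, Sum.elim_inr, Pi.smul_apply]
    · rcases eq_or_ne j i with rfl | hj
      · rw [hx, Pi.single_eq_same, hv, Pi.smul_apply]
      · rw [hx, Pi.single_eq_of_ne hj, Matrix.mulVec_zero, Pi.zero_apply, smul_zero]
    · rcases eq_or_ne j i with rfl | hj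
      · rw [hN, Matrix.map_zero _ Complex.ofReal_zero, Matrix.zero_mulVec]
        simp
      · rw [hx, Pi.single_eq_of_ne hj, Matrix.mulVec_zero]
        simp

end ComplexSpectrum

/-! ### Lyapunov exponents of a reduction in terms of the spectrum of `A`. -/

section Lyapunov

variable {d : ℕ} {A : Matrix (Fin d ⊕ Fin d) (Fin d ⊕ Fin d) ℤ}

/-- The block `D i` has positive size, hence an eigenvalue, and this is an eigenvalue of `A`. It
ties the exponents of any reduction to the spectrum of `A` itself. -/
lemma exists_log_norm_eq_lyap (R : SympReduction A) (i : Fin R.r) :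
    ∃ β ∈ complexSpectrum (toRealMat A), Real.log ‖β‖ = R.lyap i := by
  have : Nonempty (Fin (R.dim i.succ)) := ⟨⟨0, R.dim_pos i⟩⟩
  obtain ⟨z, hz⟩ := complexSpectrum_nonempty (R.D i)
  refine ⟨z, ?_, by rw [R.D_spec i z hz, Real.log_exp]⟩
  rw [R.conj]
  refine mem_complexSpectrum_conj (SymplecticGroup.symplectic_det R.Q_symp) ?_
  refine mem_complexSpectrum_reindex _ (mem_complexSpectrum_diamondProd (i := i.succ) ?_ ?_)
  · simp [reductionBlock]
  · simpa [reductionBlock] using hz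

lemma log_norm_le_lyapMax {β : ℂ} (hβ : β ∈ complexSpectrum (toRealMat A)) :
    Real.log ‖β‖ ≤ lyapMax A :=
  le_csSup ((complexSpectrum_finite _).image _).bddAbove ⟨β, hβ, rfl⟩

/-- The positive Lyapunov exponents of any reduction are bounded below in terms of the matrix. -/
lemma exists_pos_le_lyap (A : Matrix (Fin d ⊕ Fin d) (Fin d ⊕ Fin d) ℤ) {ε₀ : ℝ} (hε₀ : 0 < ε₀) :
    ∃ μ : ℝ, 0 < μ ∧ μ ≤ ε₀ ∧ ∀ (R : SympReduction A) (i : Fin R.r), μ ≤ R.lyap i := by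
  -- A finite set of positive numbers that depends on `A` and `ε₀` only; it contains the exponents
  -- of every reduction, so its minimum is a uniform lower bound.
  set s : Set ℝ := insert ε₀ (((fun β : ℂ => Real.log ‖β‖) '' complexSpectrum (toRealMat A)) ∩
    Set.Ioi 0) with hs
  have hfin : s.Finite :=
    ((((complexSpectrum_finite _).image _).inter_of_left _).insert ε₀)
  obtain ⟨μ, hμ, hmin⟩ := Set.exists_min_image s id hfin ⟨ε₀, Set.mem_insert _ _⟩
  refine ⟨μ, ?_, hmin ε₀ (Set.mem_insert _ _), fun R i => ?_⟩
  · rcases hμ with rfl | hμ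
    · exact hε₀
    · exact hμ.2
  · obtain ⟨β, hβ, hl⟩ := exists_log_norm_eq_lyap R i
    exact hmin _ (Set.mem_insert_of_mem _ ⟨⟨β, hβ, hl⟩, R.lyap_pos i⟩)

end Lyapunov

/-! ### Bounds for `B(ħ)⁻¹` and `ħ J B(ħ)ᵀ`. -/

section ScalingBounds

variable {d : ℕ}

lemma norm_matAct_diagonal_le {f : Fin d ⊕ Fin d → ℝ} {c : ℝ} (hf : ∀ i, |f i| ≤ c)
    (hc : 0 ≤ c) (ρ : Phase d) : ‖matAct (Matrix.diagonal f) ρ‖ ≤ c * ‖ρ‖ := by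
  rw [EuclideanSpace.norm_eq, EuclideanSpace.norm_eq]
  refine Real.sqrt_le_iff.mpr ⟨by positivity, ?_⟩
  rw [mul_pow, Real.sq_sqrt (Finset.sum_nonneg fun i _ => by positivity), Finset.mul_sum]
  refine Finset.sum_le_sum fun i _ => ?_
  have : matAct (Matrix.diagonal f) ρ i = f i * ρ i := by simp [matAct, Matrix.mulVec_diagonal]
  rw [this, norm_mul, mul_pow]
  gcongr
  exact hf i

lemma norm_matAct_le (M : Matrix (Fin d ⊕ Fin d) (Fin d ⊕ Fin d) ℝ) (ρ : Phase d) :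
    ‖matAct M ρ‖ ≤ ‖matL M‖ * ‖ρ‖ := (matL M).le_opNorm ρ

lemma norm_matAct_conj_diagonal_le (P Q : Matrix (Fin d ⊕ Fin d) (Fin d ⊕ Fin d) ℝ)
    {f : Fin d ⊕ Fin d → ℝ} {c : ℝ} (hf : ∀ i, |f i| ≤ c) (hc : 0 ≤ c) (ρ : Phase d) :
    ‖matAct (P * Matrix.diagonal f * Q) ρ‖ ≤ ‖matL P‖ * ‖matL Q‖ * c * ‖ρ‖ := by
  rw [matAct_mul, matAct_mul]
  calc _ ≤ ‖matL P‖ * (c * (‖matL Q‖ * ‖ρ‖)) := by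
        refine (norm_matAct_le P _).trans ?_
        gcongr
        refine (norm_matAct_diagonal_le hf hc _).trans ?_
        gcongr
        exact norm_matAct_le Q ρ
    _ = _ := by ring

variable {A : Matrix (Fin d ⊕ Fin d) (Fin d ⊕ Fin d) ℤ}

/-- The power of `h` in a diagonal entry of the scaling matrix. -/
def scalingExponent (R : SympReduction A) (ε₀ : ℝ) (j : Fin d) : ℝ :=
  R.exponent ε₀ ((blockNumbering R.dim_sum).symm j).1

lemma scaled_B (R : SympReduction A) (ε₀ h : ℝ) : R.B ε₀ h = R.Q * Matrix.diagonal
    (Sum.elim (fun j => h ^ (-scalingExponent R ε₀ j)) fun j => h ^ (-scalingExponent R ε₀ j)) *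
      R.Q⁻¹ := by
  rw [← Matrix.fromBlocks_diagonal]; rfl

/-- All numerators lie between `μ` and `λ_max`: the zeroth by the choice of `ε₀`, the others because
they are logarithms of moduli of eigenvalues. The upper bound `1 / 2` limits the squeezing to the
scale of the uncertainty principle. -/
lemma exponent_mem {ε₀ μ : ℝ} (hA : 0 < lyapMax A) (hε₀ : ε₀ ≤ lyapMax A) (hμ : μ ≤ ε₀)
    (R : SympReduction A) (hR : ∀ i, μ ≤ R.lyap i) (i : Fin (R.r + 1)) :
    μ / (2 * lyapMax A) ≤ R.exponent ε₀ i ∧ R.exponent ε₀ i ≤ 1 / 2 := by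
  have h2 : 0 < 2 * lyapMax A := by positivity
  have key : ∀ x, μ ≤ x → x ≤ lyapMax A →
      μ / (2 * lyapMax A) ≤ x / (2 * lyapMax A) ∧ x / (2 * lyapMax A) ≤ 1 / 2 := fun x hx hx' =>
    ⟨by gcongr, by rw [div_le_iff₀ h2]; linarith⟩
  refine Fin.cases ?_ (fun i => ?_) i
  · exact key ε₀ hμ hε₀
  · obtain ⟨β, hβ, hl⟩ := exists_log_norm_eq_lyap R i
    exact key _ (hR i) (hl ▸ log_norm_le_lyapMax hβ)

variable {R : SympReduction A} {ε₀ h : ℝ}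

/-- The matrix `Q diag(h^{γ_j}) Q⁻¹`, inverse to `B(h)`. -/
def invB (R : SympReduction A) (ε₀ h : ℝ) : Matrix (Fin d ⊕ Fin d) (Fin d ⊕ Fin d) ℝ :=
  R.Q * Matrix.diagonal
    (Sum.elim (fun j => h ^ scalingExponent R ε₀ j) fun j => h ^ scalingExponent R ε₀ j) * R.Q⁻¹

lemma invB_mul_B (hh : 0 < h) : invB R ε₀ h * R.B ε₀ h = 1 := by
  have hQ := SymplecticGroup.symplectic_det R.Q_symp
  have h1 : ∀ j, h ^ scalingExponent R ε₀ j * h ^ (-scalingExponent R ε₀ j) = 1 := fun j => by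
    rw [← Real.rpow_add hh, add_neg_cancel, Real.rpow_zero]
  have hdiag : Matrix.diagonal
      (Sum.elim (fun j => h ^ scalingExponent R ε₀ j) fun j => h ^ scalingExponent R ε₀ j) *
      Matrix.diagonal (Sum.elim (fun j => h ^ (-scalingExponent R ε₀ j))
        fun j => h ^ (-scalingExponent R ε₀ j)) = 1 := by
    rw [Matrix.diagonal_mul_diagonal, ← Matrix.diagonal_one]
    congr 1
    funext i
    rcases i with i | i <;> exact h1 i
  rw [invB, scaled_B]
  calc _ = R.Q * (Matrix.diagonal
        (Sum.elim (fun j => h ^ scalingExponent R ε₀ j) fun j => h ^ scalingExponent R ε₀ j) *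
        (R.Q⁻¹ * R.Q) * Matrix.diagonal (Sum.elim (fun j => h ^ (-scalingExponent R ε₀ j))
        fun j => h ^ (-scalingExponent R ε₀ j))) * R.Q⁻¹ := by simp only [Matrix.mul_assoc]
    _ = 1 := by
        rw [Matrix.nonsing_inv_mul _ hQ, Matrix.mul_one, hdiag, Matrix.mul_one,
          Matrix.mul_nonsing_inv _ hQ]

lemma det_B_ne_zero (hh : 0 < h) : (R.B ε₀ h).det ≠ 0 := fun h0 => by
  have := congrArg Matrix.det (invB_mul_B (R := R) (ε₀ := ε₀) hh)
  rw [Matrix.det_mul, h0, mul_zero, Matrix.det_one] at this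
  exact zero_ne_one this

/-- The constant in the bounds of `B(h)⁻¹` and `h J B(h)ᵀ`. -/
def reductionConst (R : SympReduction A) : ℝ :=
  ‖matL R.Q‖ * ‖matL R.Q⁻¹‖ +
    ‖matL (Matrix.J (Fin d) ℝ * (R.Q⁻¹).transpose)‖ * ‖matL R.Q.transpose‖

variable {g : ℝ}

/-- The inverse of `B(ħ)` is conjugate by `Q` to the diagonal matrix of the powers `ħ ^ γ_j`, and
for `ħ ≤ 1` the least exponent gives the largest power. -/
lemma norm_le_matAct_B (hh : h ∈ Set.Ioc (0 : ℝ) 1) (hg : ∀ i, g ≤ R.exponent ε₀ i) (ρ : Phase d) :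
    ‖ρ‖ ≤ reductionConst R * h ^ g * ‖matAct (R.B ε₀ h) ρ‖ := by
  have hpos : 0 ≤ h ^ g := Real.rpow_nonneg hh.1.le _
  have e : ρ = matAct (invB R ε₀ h) (matAct (R.B ε₀ h) ρ) := by
    rw [← matAct_mul, invB_mul_B hh.1, matAct_one]
  have hle : ∀ j, |h ^ scalingExponent R ε₀ j| ≤ h ^ g := fun j => by
    rw [abs_of_pos (Real.rpow_pos_of_pos hh.1 _)]
    exact Real.rpow_le_rpow_of_exponent_ge hh.1 hh.2 (hg _)
  have h1 := norm_matAct_conj_diagonal_le R.Q R.Q⁻¹ (c := h ^ g)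
    (f := Sum.elim (fun j => h ^ scalingExponent R ε₀ j) fun j => h ^ scalingExponent R ε₀ j)
    (fun i => by rcases i with i | i <;> exact hle i) hpos (matAct (R.B ε₀ h) ρ)
  calc ‖ρ‖ = ‖matAct (invB R ε₀ h) (matAct (R.B ε₀ h) ρ)‖ := by rw [← e]
    _ ≤ _ := h1
    _ ≤ _ := by
        gcongr
        exact le_add_of_nonneg_right (by positivity)

/-- The factor `ħ` turns the entries `ħ ^ (-γ_j)` into `ħ ^ (1 - γ_j)`, and `1 - γ_j ≥ 1 / 2 ≥ g`.
-/
lemma norm_sympDual_B_le (hh : h ∈ Set.Ioc (0 : ℝ) 1) (hg : g ≤ 1 / 2)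
    (hR : ∀ i, R.exponent ε₀ i ≤ 1 / 2) (y : Phase d) :
    ‖matAct (sympDual h (R.B ε₀ h)) y‖ ≤ reductionConst R * h ^ g * ‖y‖ := by
  set f : Fin d ⊕ Fin d → ℝ := Sum.elim (fun j => h ^ (-scalingExponent R ε₀ j))
    fun j => h ^ (-scalingExponent R ε₀ j) with hf
  have e1 : sympDual h (R.B ε₀ h) = (Matrix.J (Fin d) ℝ * (R.Q⁻¹).transpose) *
      Matrix.diagonal (fun i => h * f i) * R.Q.transpose := by
    have e2 : Matrix.diagonal (fun i => h * f i) = h • Matrix.diagonal f := by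
      rw [← Matrix.diagonal_smul]; rfl
    rw [sympDual, scaled_B, Matrix.transpose_mul, Matrix.transpose_mul, Matrix.diagonal_transpose,
      e2, Matrix.mul_smul, Matrix.smul_mul]
    simp only [Matrix.mul_assoc, hf]
  have hle : ∀ j, |h * h ^ (-scalingExponent R ε₀ j)| ≤ h ^ g := fun j => by
    have e3 : h * h ^ (-scalingExponent R ε₀ j) = h ^ (1 - scalingExponent R ε₀ j) := by
      rw [sub_eq_add_neg, Real.rpow_add hh.1, Real.rpow_one]
    rw [e3, abs_of_pos (Real.rpow_pos_of_pos hh.1 _)]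
    refine Real.rpow_le_rpow_of_exponent_ge hh.1 hh.2 ?_
    have : scalingExponent R ε₀ j ≤ 1 / 2 := hR _
    linarith
  have hpos : 0 ≤ h ^ g := Real.rpow_nonneg hh.1.le _
  rw [e1]
  refine (norm_matAct_conj_diagonal_le _ _ (c := h ^ g)
    (fun i => by rcases i with i | i <;> exact hle i) hpos y).trans ?_
  gcongr
  exact le_add_of_nonneg_left (by positivity)

end ScalingBounds

end WeylCalculus

end

/-! ### The estimate for adapted Gaussians. -/

theorem lemma4p1 (d : ℕ) (A : Matrix (Fin d ⊕ Fin d) (Fin d ⊕ Fin d) ℤ)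
    (hA : A ∈ Matrix.symplecticGroup (Fin d) ℤ)
    (hA_one : (1 : ℂ) ∉ complexSpectrum (toRealMat A))
    (hA_exp : ∃ β ∈ complexSpectrum (toRealMat A), 1 < ‖β‖)
    (ε₀ : ℝ) (hε₀ : 0 < ε₀) (hε₀_le : ε₀ ≤ lyapMax A) :
    ∃ γ : ℝ, 0 < γ ∧
      ∀ (R : SympReduction A) (a : ℝ → Phase d → ℂ), IsSymbolS0 a →
        ∃ C : ℝ, ∀ h ∈ Set.Ioc (0 : ℝ) 1,
          ∃ S T Tplus :
              MeasureTheory.Lp ℂ 2 (MeasureTheory.volume : MeasureTheory.Measure (Config d)) →L[ℂ]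
                MeasureTheory.Lp ℂ 2 (MeasureTheory.volume : MeasureTheory.Measure (Config d)),
            IsWeylOp h (R.gaussian ε₀ h) S ∧
            IsWeylOp h (moyal h (R.gaussian ε₀ h) (R.gaussian ε₀ h)) (S ∘L S) ∧
            IsWeylOp h (a h) T ∧
            IsWeylOp h (R.plusSymbol ε₀ h (a h)) Tplus ∧
            ‖T - Tplus‖ ≤ C * h ^ γ := by
  have hlyap : 0 < lyapMax A := hε₀.trans_le hε₀_le
  obtain ⟨μ, hμ, hμε, hμR⟩ := WeylCalculus.exists_pos_le_lyap A hε₀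
  -- The rate is fixed before the reduction `R` is introduced; `R` enters only the constant, through
  -- `reductionConst`.
  refine ⟨μ / (2 * lyapMax A), by positivity, fun R a ha => ?_⟩
  have hexp := WeylCalculus.exponent_mem hlyap hε₀_le hμε R (hμR R)
  obtain ⟨hsmooth, hbdd⟩ := ha
  choose N hN using hbdd
  obtain ⟨C, hC, hmain⟩ := WeylCalculus.exists_norm_weyl_sub_plus_le d
  -- The sum runs over the orders `0` to `2 * d + 2`, so it dominates every derivative bound of the
  -- symbol that is used, uniformly in `h`.
  refine ⟨C * (∑ k ∈ Finset.range (2 * d + 3), |N k|) * WeylCalculus.reductionConst R,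
    fun h hh => ?_⟩
  have hG : R.gaussian ε₀ h = WeylCalculus.normGaussian (R.B ε₀ h) := by
    funext ρ
    rw [SympReduction.gaussian, WeylCalculus.normGaussian, WeylCalculus.gauss, neg_mul]
  have hle := hmain h hh (R.B ε₀ h) (WeylCalculus.reductionConst R * h ^ (μ / (2 * lyapMax A)))
    (WeylCalculus.det_B_ne_zero hh.1)
    (WeylCalculus.norm_le_matAct_B hh fun i => (hexp i).1)
    -- The index `0` always exists, even when `d_0 = 0`, so its two bounds combine to show that the
    -- rate is at most `1 / 2`.
    (WeylCalculus.norm_sympDual_B_le hh ((hexp 0).1.trans (hexp 0).2) fun i => (hexp i).2)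
    (a h) (∑ k ∈ Finset.range (2 * d + 3), |N k|)
    (contDiff_infty.mp (hsmooth h hh) _)
    (fun k hk ρ => (hN k h hh ρ).trans ((le_abs_self _).trans
      (Finset.single_le_sum (f := fun k => |N k|) (fun k _ => abs_nonneg _)
        (Finset.mem_range.mpr (by omega)))))
  rw [SympReduction.plusSymbol, hG]
  obtain ⟨S, T, Tplus, hS, hSS, hT, hTp, hnorm⟩ := hle
  exact ⟨S, T, Tplus, hS, hSS, hT, hTp, hnorm.trans (le_of_eq (by ring))⟩
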